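/- All graphs are simple and undirected, and may be infinite. A graph $G$ is \emph{locally finite} if every vertex has finite degree; it is \emph{$2$-connected} if it has more than two vertices and $G-X$ is connected for every set $X$ of at most one vertex; it is \emph{claw-free} if no induced subgraph of $G$ is isomorphic to $K_{1,3}$. A \emph{paw} is a graph consisting of a triangle $a_0b_1b_2$ and a further vertex $a_1$ adjacent to $a_0$ only. For an induced paw $H$ of $G$, say that $H$ satisfies $\varphi(a_1,b_i)$ if $a_1$ and $b_i$ have a common neighbour in $G$ outside $V(H)$. The \emph{ends} of $G$ are the equivalence classes of rays (one-way infinite paths) of $G$, two rays being equivalent if for every finite vertex set $S$ they have tails in the same component of $G-S$; for an end $\omega$, let $C(S,\omega)$ be the component of $G-S$ containing tails of the rays in $\omega$. For a locally finite connected graph $G$, the Freudenthal compactification $|G|$ is the set of all points of $G$, viewed as a $1$-complex, together with all ends of $G$, in which a set $U$ is open if its intersection with $G$ is open in the $1$-complex and for every end $\omega\in U$ there are a finite set $S\subseteq V(G)$ and $0<\varepsilon\le 1$ such that $U$ contains $C(S,\omega)$ (including its edges), all ends $\omega'$ with $C(S,\omega')=C(S,\omega)$, and all points at distance less than $\varepsilon$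 from $C(S,\omega)$ on the edges between $C(S,\omega)$ and $S$. A \emph{circle} in $|G|$ is a subspace homeomorphic to the unit circle $S^1$, and $G$ is \emph{Hamiltonian} if some circle in $|G|$ contains all vertices of $G$. \textbf{Theorem.} Let $G$ be a locally finite, $2$-connected, claw-free graph. If every induced paw of $G$ satisfies $\varphi(a_1,b_i)$ for some $i\in\{1,2\}$, then $G$ is Hamiltonian. -/

import Mathlib

noncomputable section

namespace SimpleGraph

open Filter

variable {V : Type*}

/-! ### Connectivity, claws and paws -/

/-- `G` is `k`-connected: it has more than `k` vertices, and deleting fewer than `k` vertices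
never disconnects it. -/
def IsKConnected (G : SimpleGraph V) (k : ℕ) : Prop :=
  (k : ℕ∞) < ENat.card V ∧
    ∀ X : Finset V, X.card < k → (G.induce ((X : Set V)ᶜ)).Connected

/-- The claw `K_{1,3}`. -/
abbrev claw : SimpleGraph (Fin 1 ⊕ Fin 3) := completeBipartiteGraph (Fin 1) (Fin 3)

/-- `G` is claw-free: no induced subgraph of `G` is isomorphic to the claw. -/
def IsClawFree (G : SimpleGraph V) : Prop := ¬ claw.IsIndContained G

/-- The four vertices of the paw. -/
inductive PawVertex
  | a₀
  | a₁
  | b₁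
  | b₂

/-- The paw: the triangle `a₀ b₁ b₂` together with the pendant edge `a₀ a₁`. -/
def paw : SimpleGraph PawVertex :=
  fromEdgeSet {s(.a₀, .b₁), s(.a₀, .b₂), s(.b₁, .b₂), s(.a₀, .a₁)}

/-- `φ_H(v, w)` for the induced subgraph `H = G[X]`: the vertices `v` and `w` have a common
neighbour in `G` outside `X`. -/
def Phi (G : SimpleGraph V) (X : Set V) (v w : V) : Prop :=
  ∃ u, u ∉ X ∧ G.Adj v u ∧ G.Adj w u

/-- Every induced paw of `G` satisfies `φ(a₁, b₁)` or `φ(a₁, b₂)`. An induced paw is given as an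
embedding of the paw onto an induced subgraph of `G`. -/
def PawCondition (G : SimpleGraph V) : Prop :=
  ∀ f : paw ↪g G,
    G.Phi (Set.range f) (f .a₁) (f .b₁) ∨ G.Phi (Set.range f) (f .a₁) (f .b₂)

/-! ### Rays and ends -/

/-- A ray (one-way infinite path), listed from its start vertex. -/
structure Ray (G : SimpleGraph V) where
  /-- The `n`-th vertex of the ray. -/
  vert : ℕ → V
  injective : Function.Injective vert
  adj : ∀ n, G.Adj (vert n) (vert (n + 1))

variable {G : SimpleGraph V}

theorem Ray.exists_comp (r : G.Ray) (S : Finset V) :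
    ∃ C : G.ComponentCompl (S : Set V), ∀ᶠ n in atTop, r.vert n ∈ C := by
  have hfin : {n | r.vert n ∈ S}.Finite :=
    Set.Finite.preimage r.injective.injOn S.finite_toSet
  obtain ⟨N, hN⟩ := hfin.bddAbove
  have hout : ∀ n, N + 1 ≤ n → r.vert n ∉ (S : Set V) := fun n hn hmem => by
    have : n ≤ N := hN hmem
    omega
  refine ⟨G.componentComplMk (hout (N + 1) le_rfl), eventually_atTop.2 ⟨N + 1, fun n hn => ?_⟩⟩
  induction n, hn using Nat.le_induction with
  | base => exact G.componentComplMk_mem _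
  | succ n hn ih => exact ComponentCompl.mem_of_adj _ _ ih (hout _ (by omega)) (r.adj n)

/-- The component of `G - S` that contains a tail of the ray `r`. -/
def Ray.comp (r : G.Ray) (S : Finset V) : G.ComponentCompl (S : Set V) :=
  (r.exists_comp S).choose

/-- `r.comp S` contains a tail of `r`, and it is the only component of `G - S` that does. -/
theorem Ray.comp_eq_iff (r : G.Ray) (S : Finset V) (C : G.ComponentCompl (S : Set V)) :
    r.comp S = C ↔ ∀ᶠ n in atTop, r.vert n ∈ C := by
  have h := (r.exists_comp S).choose_spec
  refine ⟨fun hC => hC ▸ h, fun hC => ?_⟩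
  obtain ⟨n, h₁, h₂⟩ := (h.and hC).exists
  by_contra hne
  exact Set.disjoint_left.1 (ComponentCompl.pairwise_disjoint hne) h₁ h₂

/-- Two rays are equivalent if no finite vertex set separates them: for every finite `S` they
have tails in the same component of `G - S`. -/
instance raySetoid (G : SimpleGraph V) : Setoid G.Ray where
  r r₁ r₂ := ∀ S : Finset V, r₁.comp S = r₂.comp S
  iseqv := ⟨fun _ _ => rfl, fun h S => (h S).symm, fun h h' S => (h S).trans (h' S)⟩

/-- The ends of `G`: equivalence classes of rays. -/
def RayEnd (G : SimpleGraph V) : Type _ := Quotient (raySetoid G)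

/-- `C(S, ω)`: the component of `G - S` that contains a tail of every ray in `ω`. -/
def RayEnd.comp (ω : G.RayEnd) (S : Finset V) : G.ComponentCompl (S : Set V) :=
  Quotient.lift (fun r : G.Ray => r.comp S) (fun _ _ (h : ∀ _, _) => h S) ω

theorem RayEnd.hom_comp (ω : G.RayEnd) {S T : Finset V} (h : S ⊆ T) :
    (ω.comp T).hom (Finset.coe_subset.2 h) = ω.comp S := by
  induction ω using Quotient.inductionOn with
  | _ r =>
    exact ((r.comp_eq_iff S _).2 (((r.comp_eq_iff T _).1 rfl).mono fun _ hn =>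
      ComponentCompl.subset_hom _ _ hn)).symm

theorem RayEnd.comp_subset (ω : G.RayEnd) {S T : Finset V} (h : S ⊆ T) {v : V}
    (hv : v ∈ ω.comp T) : v ∈ ω.comp S := by
  rw [← ω.hom_comp h]
  exact ComponentCompl.subset_hom _ _ hv

/-! ### The Freudenthal compactification -/

/-- The point of the edge `u v` at distance `t` from `u`, in barycentric coordinates. -/
def edgePoint (u v : V) (t : ℝ) : V →₀ ℝ :=
  Finsupp.single u (1 - t) + Finsupp.single v t

/-- The point set of `G` seen as a 1-complex, in barycentric coordinates: the vertices, and for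
every edge a copy of the unit interval joining its two endvertices. -/
def Realization (G : SimpleGraph V) : Type _ :=
  {x : V →₀ ℝ // (∃ v, x = Finsupp.single v 1) ∨
    ∃ d : G.Dart, ∃ t : unitInterval, x = edgePoint d.fst d.snd t}

/-- The point set of `|G|`: the points of the 1-complex `G`, and the ends of `G`. -/
inductive Freudenthal (G : SimpleGraph V)
  | pt (x : G.Realization)
  | ofEnd (ω : G.RayEnd)

namespace Freudenthal

/-- A vertex of `G` as a point of `|G|`. -/
def vertex (G : SimpleGraph V) (v : V) : G.Freudenthal :=
  .pt ⟨Finsupp.single v 1, .inl ⟨v, rfl⟩⟩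

/-- The edge of `G` underlying `d`, parametrized by `[0,1]` from `d.fst` to `d.snd`. -/
def arc (d : G.Dart) (t : unitInterval) : G.Freudenthal :=
  .pt ⟨edgePoint d.fst d.snd t, .inr ⟨d, t, rfl⟩⟩

/-- The basic open neighbourhood `Ĉ_ε(S, ω)` of the end `ω`, for `0 < ε ≤ 1`: the component `C = C(S, ω)` with its
edges, the ends `ω'` with `C(S, ω') = C`, and the points at distance less than `ε` from `C` on
the edges between `C` and `S`. -/
def basicNhd (S : Finset V) (ω : G.RayEnd) (ε : ℝ) : Set G.Freudenthal :=
  {x | (∃ v ∈ ω.comp S, x = vertex G v) ∨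
    (∃ d : G.Dart, d.fst ∈ ω.comp S ∧ d.snd ∈ ω.comp S ∧ ∃ t, x = arc d t) ∨
    (∃ d : G.Dart, d.fst ∈ ω.comp S ∧ d.snd ∈ S ∧ ∃ t : unitInterval, (t : ℝ) < ε ∧ x = arc d t) ∨
    (∃ ω' : G.RayEnd, ω'.comp S = ω.comp S ∧ x = ofEnd ω')}

theorem basicNhd_mono {S T : Finset V} (h : S ⊆ T) (ω : G.RayEnd) {δ ε : ℝ} (hδ : δ ≤ ε) :
    basicNhd T ω δ ⊆ basicNhd S ω ε := by
  rintro x (⟨v, hv, rfl⟩ | ⟨d, h₁, h₂, t, rfl⟩ | ⟨d, h₁, h₂, t, ht, rfl⟩ | ⟨ω', hω', rfl⟩)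
  · exact .inl ⟨v, ω.comp_subset h hv, rfl⟩
  · exact .inr (.inl ⟨d, ω.comp_subset h h₁, ω.comp_subset h h₂, t, rfl⟩)
  · by_cases hS : d.snd ∈ S
    · exact .inr (.inr (.inl ⟨d, ω.comp_subset h h₁, hS, t, ht.trans_le hδ, rfl⟩))
    · exact .inr (.inl ⟨d, ω.comp_subset h h₁,
        ComponentCompl.mem_of_adj _ _ (ω.comp_subset h h₁) (by simpa using hS) d.adj, t, rfl⟩)
  · exact .inr (.inr (.inr ⟨ω', by rw [← ω'.hom_comp h, hω', ω.hom_comp h], rfl⟩))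

/-- The topology of `|G|`: a set is open if it meets every edge in an open set (the topology of
the 1-complex) and contains a basic neighbourhood of each of its ends. -/
instance (G : SimpleGraph V) : TopologicalSpace G.Freudenthal where
  IsOpen U := (∀ d : G.Dart, IsOpen (arc d ⁻¹' U)) ∧
    ∀ ω : G.RayEnd, ofEnd ω ∈ U → ∃ S : Finset V, ∃ ε ∈ Set.Ioc (0 : ℝ) 1, basicNhd S ω ε ⊆ U
  isOpen_univ := ⟨fun _ => isOpen_univ, fun _ _ => ⟨∅, 1, ⟨one_pos, le_rfl⟩, Set.subset_univ _⟩⟩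
  isOpen_inter := by
    classical
    rintro U W ⟨hU, hU'⟩ ⟨hW, hW'⟩
    refine ⟨fun d => (hU d).inter (hW d), fun ω hω => ?_⟩
    obtain ⟨S, ε, hε, hS⟩ := hU' ω hω.1
    obtain ⟨T, δ, hδ, hT⟩ := hW' ω hω.2
    exact ⟨S ∪ T, min ε δ, ⟨lt_min hε.1 hδ.1, (min_le_left _ _).trans hε.2⟩,
      Set.subset_inter
      ((basicNhd_mono Finset.subset_union_left ω (min_le_left _ _)).trans hS)
      ((basicNhd_mono Finset.subset_union_right ω (min_le_right _ _)).trans hT)⟩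
  isOpen_sUnion := by
    intro 𝒰 h
    refine ⟨fun d => ?_, fun ω hω => ?_⟩
    · rw [Set.preimage_sUnion]
      exact isOpen_biUnion fun U hU => (h U hU).1 d
    · obtain ⟨U, hU, hωU⟩ := hω
      obtain ⟨S, ε, hε, hS⟩ := (h U hU).2 ω hωU
      exact ⟨S, ε, hε, hS.trans (Set.subset_sUnion_of_mem hU)⟩

end Freudenthal

/-- A circle in a space: a subset homeomorphic to the unit circle `S¹`. -/
def IsCircle {X : Type*} [TopologicalSpace X] (C : Set X) : Prop :=
  Nonempty (Circle ≃ₜ C)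

/-- `G` is Hamiltonian: some circle in `|G|` contains all vertices of `G`. -/
def HasHamiltonCircle (G : SimpleGraph V) : Prop :=
  ∃ C : Set G.Freudenthal, IsCircle C ∧ ∀ v, Freudenthal.vertex G v ∈ C

end SimpleGraph

end

/-! In a finite claw-free graph with the paw condition a cycle `D` that misses a vertex can always
grow. Let `v` be outside `D` and adjacent to `u` on `D`, and let `n`, `p` be the neighbours of `u`
on `D`. If `v` is adjacent to neither, there being no claw at `u` makes `n` and `p` adjacent, so `u,
v, n, p` induce a paw, and the common neighbour it provides is used to reroute `D` through `v`
(`CycleOn.extend`).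

For infinite `G`, fix a vertex `o` and let the hull of radius `r` be the ball around `o` together
with all finite components outside it; hulls are finite and exhaust `G`. Claw-freeness makes the
outside neighbours of a hull vertex a clique (`adj_of_mem_hull`), so every infinite component `K`
outside the hull inherits the paw condition (`pawPropOn_outer`). Growing cycles gives Hamilton
cycles of a hull and, for large `R`, of the trace of each `K` on the hull of radius `R`. A Hamilton
cycle of the inner hull is merged with the cycle of each `K` along two edges
(`Interface.mergeable`), and all other edges entering `K` are then deleted. The deleted edges lie
too deep to affect later mergers. Iterating gives Hamilton cycles of larger and larger hulls, such
that every later cycle crosses the boundary of each earlier component in at most two edges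
(`exists_stage_sequence`).

These cycles, cut open at `o`, order the vertices of their hulls. An ultrafilter limit of these
orders is a linear order on `V`. By local finiteness successors, predecessors and the last vertex
survive in the limit, and having at most two crossings makes every component outside a hull a closed
interval (`exists_isCircleOrder`).

Finally the vertices get positive summable weights, and each `v` is placed on the real line at the
total weight of its predecessors. The edge from `v` to its successor fills an interval as long as
the weight of `v`; each remaining point is a gap in the order, and the interval components around it
converge to an end. Identifying the two extreme points gives a continuous injection of a circle into
the Hausdorff space `|G|`, hence an embedding through all vertices. -/

namespace SimpleGraph

variable {V : Type*}

/-! ### Paths and cycles on multisets of vertices -/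

/-- `H` has a path from `a` to `b` that visits exactly the elements of `m`. -/
def PathOn (H : SimpleGraph V) (m : Multiset V) (a b : V) : Prop :=
  ∃ l : List V, l.IsChain H.Adj ∧ (l : Multiset V) = m ∧ l.head? = some a ∧ l.getLast? = some b

namespace PathOn

variable {H H' : SimpleGraph V} {m n : Multiset V} {a b c d : V}

theorem single (H : SimpleGraph V) (a : V) : PathOn H {a} a a :=
  ⟨[a], by simp, by simp, by simp, by simp⟩

theorem append (h : PathOn H m a b) (h' : PathOn H n c d) (hbc : H.Adj b c) :
    PathOn H (m + n) a d := by
  obtain ⟨l, hl, rfl, ha, hb⟩ := h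
  obtain ⟨l', hl', rfl, hc, hd⟩ := h'
  refine ⟨l ++ l', ?_, by simp, ?_, ?_⟩
  · rw [List.isChain_append]
    refine ⟨hl, hl', fun x hx y hy => ?_⟩
    rw [hb] at hx; rw [hc] at hy
    simp only [Option.mem_def, Option.some.injEq] at hx hy
    exact hx ▸ hy ▸ hbc
  · simp [List.head?_append, ha]
  · simp [List.getLast?_append, hd]

theorem symm (h : PathOn H m a b) : PathOn H m b a := by
  obtain ⟨l, hl, rfl, ha, hb⟩ := h
  refine ⟨l.reverse, ?_, by simp, by simpa using hb, by simpa using ha⟩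
  rw [List.isChain_reverse]
  exact hl.imp fun _ _ h => h.symm

/-- Multisets forget the order of visits: a rerouting is given by concatenating segments along
edges, and that it visits the right vertices is an identity in a commutative monoid, left to `abel`.
-/
theorem cast (h : PathOn H m a b) (e : n = m) : PathOn H n a b := e ▸ h

theorem cons (h : PathOn H m a b) (hc : H.Adj c a) : PathOn H ({c} + m) c b :=
  (single H c).append h hc

theorem snoc (h : PathOn H m a b) (hc : H.Adj b c) : PathOn H (m + {c}) a c :=
  h.append (single H c) hc

theorem left_mem (h : PathOn H m a b) : a ∈ m := by
  obtain ⟨l, hl, rfl, ha, hb⟩ := h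
  exact List.mem_of_mem_head? (by simp [ha])

theorem right_mem (h : PathOn H m a b) : b ∈ m := h.symm.left_mem

theorem mono_on (h : PathOn H m a b) (hH : ∀ x ∈ m, ∀ y ∈ m, H.Adj x y → H'.Adj x y) :
    PathOn H' m a b := by
  obtain ⟨l, hl, rfl, ha, hb⟩ := h
  refine ⟨l, ?_, rfl, ha, hb⟩
  rw [List.isChain_iff_getElem] at hl ⊢
  intro i hi
  exact hH _ (by simp) _ (by simp) (hl i hi)

theorem split {w : V} (h : PathOn H m a b) (hw : w ∈ m) (hwa : w ≠ a) (hwb : w ≠ b) :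
    ∃ m₁ m₂ e f, PathOn H m₁ a e ∧ PathOn H m₂ f b ∧ H.Adj e w ∧ H.Adj w f ∧
      m = m₁ + {w} + m₂ := by
  obtain ⟨l, hl, rfl, ha, hb⟩ := h
  obtain ⟨l₁, l₂, rfl⟩ := List.append_of_mem (Multiset.mem_coe.1 hw)
  rw [List.isChain_append, List.isChain_cons] at hl
  obtain ⟨h₁, ⟨h₂, h₃⟩, h₄⟩ := hl
  have n₁ : l₁ ≠ [] := by rintro rfl; simp at ha; exact hwa ha
  have n₂ : l₂ ≠ [] := by rintro rfl; simp at hb; exact hwb hb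
  obtain ⟨e, he⟩ : ∃ e, l₁.getLast? = some e := ⟨_, List.getLast?_eq_some_getLast n₁⟩
  obtain ⟨f, hf⟩ : ∃ f, l₂.head? = some f := ⟨_, List.head?_eq_some_head n₂⟩
  refine ⟨l₁, l₂, e, f, ⟨l₁, h₁, rfl, ?_, he⟩, ⟨l₂, h₃, rfl, hf, ?_⟩, ?_, ?_, ?_⟩
  · rw [List.head?_append_of_ne_nil _ n₁] at ha; exact ha
  · rw [List.getLast?_append_of_ne_nil _ (by simp), List.getLast?_cons_of_ne_nil n₂] at hb
    exact hb
  · exact h₄ e (by simp [he]) w (by simp)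
  · exact h₂ f (by simp [hf])
  · rw [← Multiset.coe_singleton, Multiset.coe_add, Multiset.coe_add]
    simp

theorem exists_last (h : PathOn H m a b) (hab : a ≠ b) :
    ∃ m' e, PathOn H m' a e ∧ H.Adj e b ∧ m = m' + {b} := by
  obtain ⟨l, hl, rfl, ha, hb⟩ := h
  obtain ⟨l', rfl⟩ := List.getLast?_eq_some_iff.1 hb
  have n₁ : l' ≠ [] := by rintro rfl; simp at ha; exact hab ha.symm
  obtain ⟨e, he⟩ : ∃ e, l'.getLast? = some e := ⟨_, List.getLast?_eq_some_getLast n₁⟩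
  rw [List.isChain_append] at hl
  refine ⟨l', e, ⟨l', hl.1, rfl, ?_, he⟩, hl.2.2 e (by simp [he]) b (by simp), ?_⟩
  · rwa [List.head?_append_of_ne_nil _ n₁] at ha
  · exact (Multiset.coe_add _ _).symm

/-- A closed path may be cut open at every vertex. -/
theorem rotate {w : V} (h : PathOn H m a b) (hab : H.Adj a b) (hw : w ∈ m) :
    ∃ y, PathOn H m y w ∧ H.Adj w y := by
  by_cases hwb : w = b
  · subst hwb; exact ⟨a, h, hab.symm⟩
  by_cases hwa : w = a
  · subst hwa; exact ⟨b, h.symm, hab⟩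
  obtain ⟨m₁, m₂, e, f, h₁, h₂, he, hf, rfl⟩ := h.split hw hwa hwb
  exact ⟨f, ((h₂.append h₁ hab.symm).snoc he).cast (by abel), hf⟩

theorem card_eq_one (h : PathOn H m a a) (hm : m.Nodup) : m = {a} := by
  obtain ⟨l, hl, rfl, ha, hb⟩ := h
  obtain ⟨l', rfl⟩ := List.getLast?_eq_some_iff.1 hb
  cases l' with
  | nil => simp
  | cons x t =>
    simp at ha
    subst ha
    simp at hm

theorem exists_append_of_mem_of_not_mem {Q : V → Prop} {l : List V} (hx : ∃ x ∈ l, Q x)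
    (hy : ∃ y ∈ l, ¬ Q y) : ∃ l₁ l₂ u v, l = l₁ ++ l₂ ∧ l₁.getLast? = some u ∧
      l₂.head? = some v ∧ ((Q u ∧ ¬ Q v) ∨ (¬ Q u ∧ Q v)) := by
  induction l with
  | nil => simp at hx
  | cons c t ih =>
    rcases t with _ | ⟨d, t⟩
    · simp at hx hy; exact absurd hx hy
    by_cases hcd : (Q c ∧ ¬ Q d) ∨ (¬ Q c ∧ Q d)
    · exact ⟨[c], d :: t, c, d, rfl, by simp, by simp, hcd⟩
    obtain ⟨x, hx, hQx⟩ := hx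
    obtain ⟨y, hy, hQy⟩ := hy
    have hx' : ∃ x ∈ d :: t, Q x := by
      rcases List.mem_cons.1 hx with rfl | h
      · exact ⟨d, by simp, by tauto⟩
      · exact ⟨x, h, hQx⟩
    have hy' : ∃ x ∈ d :: t, ¬ Q x := by
      rcases List.mem_cons.1 hy with rfl | h
      · exact ⟨d, by simp, by tauto⟩
      · exact ⟨y, h, hQy⟩
    obtain ⟨l₁, l₂, u, v, h, hu, hv, huv⟩ := ih hx' hy'
    refine ⟨c :: l₁, l₂, u, v, by simp [h], ?_, hv, huv⟩
    have : l₁ ≠ [] := by rintro rfl; simp at hu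
    rw [List.getLast?_cons_of_ne_nil this, hu]

/-- Around a cycle, `Q` must change between two consecutive vertices; the cycle is cut open at that
edge. -/
theorem exists_boundary (h : PathOn H m a b) (hab : H.Adj a b) {Q : V → Prop} {x y : V}
    (hx : x ∈ m) (hQx : Q x) (hy : y ∈ m) (hQy : ¬ Q y) :
    ∃ q z, PathOn H m z q ∧ H.Adj q z ∧ Q q ∧ ¬ Q z := by
  obtain ⟨l, hl, rfl, ha, hb⟩ := h
  obtain ⟨l₁, l₂, u, v, rfl, hu, hv, huv⟩ :=
    exists_append_of_mem_of_not_mem ⟨x, Multiset.mem_coe.1 hx, hQx⟩ ⟨y, Multiset.mem_coe.1 hy, hQy⟩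
  rw [List.isChain_append] at hl
  have n₁ : l₁ ≠ [] := by rintro rfl; simp at hu
  have n₂ : l₂ ≠ [] := by rintro rfl; simp at hv
  have p₁ : PathOn H l₁ a u := ⟨l₁, hl.1, rfl, by
    rwa [List.head?_append_of_ne_nil _ n₁] at ha, hu⟩
  have p₂ : PathOn H l₂ v b := ⟨l₂, hl.2.1, rfl, hv, by
    rwa [List.getLast?_append_of_ne_nil _ n₂] at hb⟩
  have p : PathOn H ((l₁ ++ l₂ : List V) : Multiset V) v u :=
    (p₂.append p₁ hab.symm).cast (by simp [← Multiset.coe_add, add_comm])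
  have huv' : H.Adj u v := hl.2.2 u (by simp [hu]) v (by simp [hv])
  rcases huv with ⟨h₁, h₂⟩ | ⟨h₁, h₂⟩
  · exact ⟨u, v, p, huv', h₁, h₂⟩
  · exact ⟨v, u, p.symm, huv'.symm, h₂, h₁⟩

end PathOn

/-- `H` has a cycle that visits exactly the elements of `m`. -/
def CycleOn (H : SimpleGraph V) (m : Multiset V) : Prop :=
  ∃ a b, PathOn H m a b ∧ H.Adj a b ∧ 3 ≤ m.card

theorem CycleOn.mono_on {H H' : SimpleGraph V} {m : Multiset V} (h : CycleOn H m)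
    (hH : ∀ x ∈ m, ∀ y ∈ m, H.Adj x y → H'.Adj x y) : CycleOn H' m := by
  obtain ⟨a, b, p, hab, hc⟩ := h
  exact ⟨a, b, p.mono_on hH, hH _ p.left_mem _ p.right_mem hab, hc⟩

/-- Deleting a vertex from a cycle leaves a path between its two neighbours on the cycle. -/
theorem CycleOn.delete {H : SimpleGraph V} {m : Multiset V} {u : V} (h : CycleOn H m)
    (hm : m.Nodup) (hu : u ∈ m) :
    ∃ m' n p, PathOn H m' n p ∧ H.Adj u n ∧ H.Adj u p ∧ n ≠ p ∧ m = {u} + m' := by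
  obtain ⟨a, b, p, hab, hc⟩ := h
  obtain ⟨y, hy, huy⟩ := p.rotate hab hu
  obtain ⟨m', e, h', he, rfl⟩ := hy.exists_last huy.ne'
  refine ⟨m', y, e, h', huy, he.symm, ?_, add_comm _ _⟩
  rintro rfl
  have := h'.card_eq_one (Multiset.nodup_of_le (Multiset.le_add_right _ _) hm)
  subst this
  simp at hc

end SimpleGraph

/-! ### Surgery on cycles: growing one cycle, merging two -/

namespace SimpleGraph

variable {V : Type*}

/-! ### Claws and paws -/

/-- Among three neighbours of a vertex, two are adjacent. -/
def ClawProp (G : SimpleGraph V) : Prop :=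
  ∀ ⦃u a b c⦄, G.Adj u a → G.Adj u b → G.Adj u c → a ≠ b → a ≠ c → b ≠ c →
    G.Adj a b ∨ G.Adj a c ∨ G.Adj b c

/-- Every induced paw in `K` satisfies the paw condition with a common neighbour in `K`. -/
def PawPropOn (G : SimpleGraph V) (K : Set V) : Prop :=
  ∀ ⦃a₀ a₁ b₁ b₂⦄, a₀ ∈ K → a₁ ∈ K → b₁ ∈ K → b₂ ∈ K → G.Adj a₀ a₁ → G.Adj a₀ b₁ →
    G.Adj a₀ b₂ → G.Adj b₁ b₂ → ¬ G.Adj a₁ b₁ → ¬ G.Adj a₁ b₂ → a₁ ≠ b₁ → a₁ ≠ b₂ →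
    ∃ w ∈ K, w ≠ a₀ ∧ w ≠ a₁ ∧ w ≠ b₁ ∧ w ≠ b₂ ∧ G.Adj a₁ w ∧ (G.Adj b₁ w ∨ G.Adj b₂ w)

theorem IsClawFree.clawProp {G : SimpleGraph V} (h : G.IsClawFree) : G.ClawProp := by
  intro u a b c ha hb hc hab hac hbc
  by_contra! hno
  obtain ⟨n₁, n₂, n₃⟩ := hno
  have n₁' : ¬ G.Adj b a := fun h => n₁ h.symm
  have n₂' : ¬ G.Adj c a := fun h => n₂ h.symm
  have n₃' : ¬ G.Adj c b := fun h => n₃ h.symm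
  let g : Fin 1 ⊕ Fin 3 → V := Sum.elim (fun _ => u) ![a, b, c]
  have hinj : Function.Injective g := by
    rintro (i | i) (j | j) hij
    · exact congrArg _ (Subsingleton.elim _ _)
    · fin_cases j <;> simp [g] at hij <;> subst hij <;> simp at ha hb hc
    · fin_cases i <;> simp [g] at hij <;> subst hij <;> simp at ha hb hc
    · fin_cases i <;> fin_cases j <;> simp_all [g]
  have hadj : ∀ {x y}, G.Adj (g x) (g y) ↔ claw.Adj x y := by
    rintro (i | i) (j | j)
    · simp [g]
    · fin_cases j <;> simp [g, ha, hb, hc]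
    · fin_cases i <;> simp [g, ha.symm, hb.symm, hc.symm]
    · fin_cases i <;> fin_cases j <;> simp [g, n₁, n₂, n₃, n₁', n₂', n₃']
  exact h ⟨⟨⟨g, hinj⟩, hadj⟩⟩

theorem PawCondition.pawPropOn {G : SimpleGraph V} (h : G.PawCondition) :
    G.PawPropOn Set.univ := by
  intro a₀ a₁ b₁ b₂ _ _ _ _ h₁ h₂ h₃ h₄ n₁ n₂ ne₁ ne₂
  have n₁' : ¬ G.Adj b₁ a₁ := fun h => n₁ h.symm
  have n₂' : ¬ G.Adj b₂ a₁ := fun h => n₂ h.symm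
  let g : PawVertex → V
    | .a₀ => a₀
    | .a₁ => a₁
    | .b₁ => b₁
    | .b₂ => b₂
  have hinj : Function.Injective g := by
    intro x y hxy
    have e₁ := h₁.ne
    have e₂ := h₂.ne
    have e₃ := h₃.ne
    have e₄ := h₄.ne
    cases x <;> cases y <;> simp_all [g]
  have hadj : ∀ {x y}, G.Adj (g x) (g y) ↔ paw.Adj x y := by
    intro x y
    cases x <;> cases y <;>
      simp [g, paw, h₁, h₂, h₃, h₄, n₁, n₂, n₁', n₂', h₁.symm, h₂.symm, h₃.symm, h₄.symm]
  let f : paw ↪g G := ⟨⟨g, hinj⟩, hadj⟩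
  have hr : ∀ v, f v = g v := fun _ => rfl
  have key : ∀ u, u ∉ Set.range f → u ≠ a₀ ∧ u ≠ a₁ ∧ u ≠ b₁ ∧ u ≠ b₂ := fun u hu =>
    ⟨fun e => hu ⟨.a₀, e.symm⟩, fun e => hu ⟨.a₁, e.symm⟩, fun e => hu ⟨.b₁, e.symm⟩,
      fun e => hu ⟨.b₂, e.symm⟩⟩
  rcases h f with ⟨u, hu, hu₁, hu₂⟩ | ⟨u, hu, hu₁, hu₂⟩
  · obtain ⟨k₁, k₂, k₃, k₄⟩ := key u hu
    exact ⟨u, trivial, k₁, k₂, k₃, k₄, hu₁, .inl hu₂⟩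
  · obtain ⟨k₁, k₂, k₃, k₄⟩ := key u hu
    exact ⟨u, trivial, k₁, k₂, k₃, k₄, hu₁, .inr hu₂⟩

theorem ne_of_nodup_add {m n : Multiset V} (h : (m + n).Nodup) {a b : V} (ha : a ∈ m)
    (hb : b ∈ n) : a ≠ b := by
  rintro rfl
  exact Multiset.disjoint_left.1 (Multiset.nodup_add.1 h).2.2 ha hb

/-! ### Extending a cycle -/

section Extend

variable {G : SimpleGraph V}

/-- If `w` is new, the cycle makes the detour `u v w n`. If `w` already lies on the cycle, there
being no claw at `w` with its two cycle neighbours and `v` allows either bypassing `w` and using the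
same detour, or inserting `v` next to `w`. -/
theorem CycleOn.extend_aux (hclaw : G.ClawProp) {m : Multiset V} {u v n p w : V}
    (hm : PathOn G m n p) (hun : G.Adj u n) (hup : G.Adj u p) (nd : ({u} + m).Nodup)
    (hv : v ∉ ({u} + m : Multiset V)) (huv : G.Adj u v) (hvw : G.Adj v w) (hnw : G.Adj n w)
    (hwu : w ≠ u) (hwp : w ≠ p) (hc : 2 ≤ m.card) :
    ∃ D, CycleOn G D ∧ D.Nodup ∧ v ∈ D ∧ {u} + m ≤ D ∧ ∀ x ∈ D, x ∈ {u} + m ∨ x = v ∨ x = w := by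
  have hvm : v ∉ m := fun h => hv (by simp [h])
  have hvu : v ≠ u := fun h => hv (by simp [h])
  by_cases hwm : w ∈ m
  · have key : CycleOn G ({v} + ({u} + m)) := by
      obtain ⟨m₁, m₂, a, b, h₁, h₂, ha, hb, rfl⟩ := hm.split hwm hnw.ne' hwp
      have am := h₁.right_mem
      have bm := h₂.left_mem
      have nd' : (m₁ + {w} + m₂).Nodup := (Multiset.nodup_add.1 nd).2.1
      have hab : a ≠ b := ne_of_nodup_add nd' (by simp [am]) bm
      have hav : a ≠ v := fun h => hvm (by simp [← h, am])
      have hbv : b ≠ v := fun h => hvm (by simp [← h, bm])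
      have hcard : 3 ≤ (({v} + ({u} + (m₁ + {w} + m₂)) : Multiset V)).card := by
        simp at hc ⊢; omega
      rcases hclaw ha.symm hb hvw.symm hab hav hbv with h | h | h
      · exact ⟨n, w, ((((h₁.append h₂ h).snoc hup.symm).snoc huv).snoc hvw).cast (by abel),
          hnw, hcard⟩
      · exact ⟨n, u, ((((h₁.snoc h).snoc hvw).append h₂ hb).snoc hup.symm).cast (by abel),
          hun.symm, hcard⟩
      · exact ⟨n, u, ((((h₁.snoc ha).snoc hvw.symm).append h₂ h.symm).snoc hup.symm).cast
          (by abel), hun.symm, hcard⟩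
    refine ⟨_, key, ?_, by simp, Multiset.le_add_left _ _, ?_⟩
    · rw [Multiset.singleton_add, Multiset.nodup_cons]; exact ⟨hv, nd⟩
    · intro x hx; simp at hx ⊢; tauto
  · refine ⟨{w} + ({v} + ({u} + m)), ⟨n, w, ?_, hnw, ?_⟩, ?_, by simp, ?_, ?_⟩
    · exact (((hm.snoc hup.symm).snoc huv).snoc hvw).cast (by abel)
    · simp
    · rw [Multiset.singleton_add, Multiset.nodup_cons, Multiset.singleton_add v,
        Multiset.nodup_cons]
      refine ⟨?_, hv, nd⟩
      simp [hwu, hwm, hvw.ne']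
    · exact (Multiset.le_add_left _ _).trans (Multiset.le_add_left _ _)
    · intro x hx; simp at hx ⊢; tauto

/-- A cycle in `K` extends over every adjacent vertex `v` of `K`, by adding `v` or `v` and a
common neighbour of `v` and a vertex of the cycle. -/
theorem CycleOn.extend (hclaw : G.ClawProp) {K : Set V} (hpaw : G.PawPropOn K) {D : Multiset V}
    (hD : CycleOn G D) (nd : D.Nodup) (hDK : ∀ x ∈ D, x ∈ K) {u v : V} (hu : u ∈ D) (hv : v ∉ D)
    (hvK : v ∈ K) (huv : G.Adj u v) {U : Set V}
    (hU : ∀ b ∈ D, ∀ w ∈ K, G.Adj u b → ¬ G.Adj v b → G.Adj v w → G.Adj b w → w ∈ U) :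
    ∃ D', CycleOn G D' ∧ D'.Nodup ∧ v ∈ D' ∧ D ≤ D' ∧
      ∀ x ∈ D', x ∈ D ∨ x = v ∨ (x ∈ U ∧ x ∈ K) := by
  obtain ⟨m, n, p, hm, hun, hup, hnp, rfl⟩ := hD.delete nd hu
  have hvm : v ∉ m := fun h => hv (by simp [h])
  have hnm := hm.left_mem
  have hpm := hm.right_mem
  have hc : 2 ≤ m.card := by
    obtain ⟨a, b, -, -, h⟩ := hD
    simp at h; omega
  have hnv : n ≠ v := fun h => hvm (h ▸ hnm)
  have hpv : p ≠ v := fun h => hvm (h ▸ hpm)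
  have hnd' : ({v} + ({u} + m) : Multiset V).Nodup := by
    rw [Multiset.singleton_add, Multiset.nodup_cons]; exact ⟨hv, nd⟩
  have hcard : 3 ≤ (({v} + ({u} + m)) : Multiset V).card := by simp; omega
  have hmem : ∀ x ∈ ({v} + ({u} + m) : Multiset V),
      x ∈ ({u} + m : Multiset V) ∨ x = v ∨ (x ∈ U ∧ x ∈ K) := by
    intro x hx; simp at hx ⊢; tauto
  by_cases hvn : G.Adj v n
  · exact ⟨_, ⟨n, v, ((hm.snoc hup.symm).snoc huv).cast (by abel), hvn.symm, hcard⟩, hnd',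
      by simp, Multiset.le_add_left _ _, hmem⟩
  by_cases hvp : G.Adj v p
  · exact ⟨_, ⟨p, v, ((hm.symm.snoc hun.symm).snoc huv).cast (by abel), hvp.symm, hcard⟩, hnd',
      by simp, Multiset.le_add_left _ _, hmem⟩
  have hnp' : G.Adj n p := by
    rcases hclaw hun hup huv hnp hnv hpv with h | h | h
    · exact h
    · exact absurd h.symm hvn
    · exact absurd h.symm hvp
  have hnD : n ∈ ({u} + m : Multiset V) := by simp [hnm]
  have hpD : p ∈ ({u} + m : Multiset V) := by simp [hpm]
  -- The paw has triangle `u n p` and pendant vertex `v`.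
  obtain ⟨w, hwK, hwu, hwv, hwn, hwp, hvw, hw⟩ := hpaw (hDK u hu) hvK (hDK n hnD) (hDK p hpD)
    huv hun hup hnp' hvn hvp hnv.symm hpv.symm
  rcases hw with hw | hw
  · obtain ⟨D', h₁, h₂, h₃, h₄, h₅⟩ := extend_aux hclaw hm hun hup nd hv huv hvw hw hwu hwp hc
    refine ⟨D', h₁, h₂, h₃, h₄, fun x hx => ?_⟩
    rcases h₅ x hx with h | h | rfl
    · exact .inl h
    · exact .inr (.inl h)
    · exact .inr (.inr ⟨hU n hnD _ hwK hun hvn hvw hw, hwK⟩)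
  · obtain ⟨D', h₁, h₂, h₃, h₄, h₅⟩ :=
      extend_aux hclaw hm.symm hup hun nd hv huv hvw hw hwu hwn hc
    refine ⟨D', h₁, h₂, h₃, h₄, fun x hx => ?_⟩
    rcases h₅ x hx with h | h | rfl
    · exact .inl h
    · exact .inr (.inl h)
    · exact .inr (.inr ⟨hU p hpD _ hwK hup hvp hvw hw, hwK⟩)

end Extend

end SimpleGraph

namespace SimpleGraph

variable {V : Type*}

/-! ### Merging two cycles -/

/-- The standing assumptions for joining a Hamilton cycle of `C` with a Hamilton cycle of `D`
in the subgraph `H` of `G`. Near the interface, the set `T` of the vertices of `C` at distance at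
most one from a neighbour of `D`, the graphs `G` and `H` agree. -/
structure Interface (G H : SimpleGraph V) (C D : Multiset V) (T : Set V) : Prop where
  le : H ≤ G
  claw : G.ClawProp
  paw : G.PawPropOn Set.univ
  nodupC : C.Nodup
  nodupD : D.Nodup
  disj : ∀ ⦃x⦄, x ∈ C → x ∉ D
  adjT : ∀ ⦃a b⦄, a ∈ T → b ∈ T → G.Adj a b → H.Adj a b
  adjD : ∀ ⦃a b⦄, a ∈ D → b ∈ D → G.Adj a b → H.Adj a b
  memT : ∀ ⦃c d⦄, c ∈ C → d ∈ D → G.Adj c d → c ∈ T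
  memT' : ∀ ⦃c d c'⦄, c ∈ C → d ∈ D → G.Adj c d → c' ∈ C → G.Adj c c' → c' ∈ T
  clique : ∀ ⦃c d d'⦄, c ∈ C → d ∈ D → d' ∈ D → G.Adj c d → G.Adj c d' → d ≠ d' → G.Adj d d'
  closeC : ∀ ⦃c d x⦄, c ∈ C → d ∈ D → G.Adj c d → G.Adj c x → x ∈ C ∨ x ∈ D
  closeD : ∀ ⦃c d x⦄, c ∈ C → d ∈ D → G.Adj c d → G.Adj d x → x ∈ C ∨ x ∈ D

/-- Hamilton paths of `C` and `D` whose ends are joined by two edges. -/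
def Mergeable (G H : SimpleGraph V) (C D : Multiset V) : Prop :=
  ∃ a b c d, PathOn H C a b ∧ PathOn H D c d ∧ G.Adj a c ∧ G.Adj b d

namespace Interface

variable {G H : SimpleGraph V} {C D : Multiset V} {T : Set V}

/-- It would suffice that `s` or `t` is adjacent to `p`, a cycle neighbour of `q`. Otherwise the
other cycle neighbour `z`, which sees nothing of `C`, is the pendant vertex of a paw with triangle
`q s t`, and the common neighbour `w` of `z` and, say, `s` is forced into `D`. The cycle through `D`
can then be rerouted to a path from `w` to `q`. -/
theorem mergeable_of_common_neighbor (I : Interface G H C D T) {s t q z p : V} {D' : Multiset V}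
    (hC : PathOn H C s t) (hst : G.Adj s t) (hsq : G.Adj s q) (htq : G.Adj t q)
    (hD' : PathOn H D' z p) (hqz : H.Adj q z) (hqp : H.Adj q p) (hzp : z ≠ p)
    (hD : D = {q} + D') (hz : ∀ c ∈ C, ¬ G.Adj c z) : Mergeable G H C D := by
  have hqD : q ∈ D := by simp [hD]
  have hmD : ∀ x ∈ D', x ∈ D := fun x hx => by simp [hD, hx]
  have hzD := hmD z hD'.left_mem
  have hpD := hmD p hD'.right_mem
  have hsC := hC.left_mem
  have htC := hC.right_mem
  have hCD : ∀ {x y}, x ∈ C → y ∈ D → x ≠ y := fun hx hy e => I.disj hx (e ▸ hy)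
  by_cases hsp : G.Adj s p
  · exact ⟨t, s, q, p, hC.symm, (hD'.cons hqz).cast hD, htq, hsp⟩
  by_cases htp : G.Adj t p
  · exact ⟨s, t, q, p, hC, (hD'.cons hqz).cast hD, hsq, htp⟩
  have hzp' : G.Adj z p := by
    rcases I.claw hsq.symm (I.le hqz) (I.le hqp) (hCD hsC hzD) (hCD hsC hpD) hzp with h | h | h
    · exact absurd h (hz s hsC)
    · exact absurd h hsp
    · exact h
  obtain ⟨w, -, hwq, hwz, hws, hwt, hzw, hw⟩ := I.paw trivial trivial trivial trivial
    (I.le hqz) hsq.symm htq.symm hst (fun h => hz s hsC h.symm) (fun h => hz t htC h.symm)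
    (hCD hsC hzD).symm (hCD htC hzD).symm
  have key : ∀ {s t}, PathOn H C s t → G.Adj s q → G.Adj t q → G.Adj s w → ¬ G.Adj s p →
      Mergeable G H C D := by
    intro s t hC hsq htq hsw hsp
    have hsC := hC.left_mem
    have hwD : w ∈ D := (I.closeC hsC hqD hsq hsw).resolve_left fun h => hz w h hzw.symm
    have hqw : G.Adj q w := I.clique hsC hqD hwD hsq hsw hwq.symm
    have hwD' : w ∈ D' := by
      rw [hD] at hwD; simpa [hwq] using hwD
    obtain ⟨E, F, e, f, hE, hF, he, hf, rfl⟩ := hD'.split hwD' hwz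
      (by rintro rfl; exact hsp hsw)
    have heD := hmD e (by simp [hE.right_mem])
    have hfD := hmD f (by simp [hF.left_mem])
    have nd := I.nodupD
    rw [hD] at nd
    have hef : e ≠ f := ne_of_nodup_add (Multiset.nodup_add.1 nd).2.1
      (by simp [hE.right_mem]) hF.left_mem
    have hqe : q ≠ e := ne_of_nodup_add nd (by simp) (by simp [hE.right_mem])
    have hqf : q ≠ f := ne_of_nodup_add nd (by simp) (by simp [hF.left_mem])
    -- In each case the claw-freeness at `w` closes the hole left by moving `w` to the front, or
    -- makes a cycle neighbour of `w` adjacent to `s` and hence, by the clique property, to `q`.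
    rcases I.claw (I.le he.symm) (I.le hf) hsw.symm hef (hCD hsC heD).symm
      (hCD hsC hfD).symm with h | h | h
    · exact ⟨s, t, w, q, hC, (((hE.append hF (I.adjD heD hfD h)).cons
        (I.adjD hwD hzD hzw.symm)).snoc hqp.symm).cast (by rw [hD]; abel), hsw, htq⟩
    · exact ⟨s, t, w, q, hC, (((hF.append hE (I.adjD hpD hzD hzp'.symm)).cons hf).snoc
        (I.adjD heD hqD (I.clique hsC heD hqD h.symm hsq hqe.symm))).cast
        (by rw [hD]; abel), hsw, htq⟩
    · exact ⟨s, t, w, q, hC, (((hE.symm.append hF.symm (I.adjD hzD hpD hzp')).cons he.symm).snoc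
        (I.adjD hfD hqD (I.clique hsC hfD hqD h.symm hsq hqf.symm))).cast
        (by rw [hD]; abel), hsw, htq⟩
  rcases hw with hw | hw
  · exact key hC hsq htq hw hsp
  · exact key hC.symm htq hsq hw htp

/-- `s` and `t` are consecutive on the cycle through `C`, and `s` has a neighbour `x` in `C` that
has a neighbour `y` in `D`. -/
theorem mergeable_of_left (I : Interface G H C D T) {s t p x y w q : V} {C' : Multiset V}
    (hC' : PathOn H C' t p) (hst : H.Adj s t) (hsp : H.Adj s p) (hpt : G.Adj p t)
    (hC : C = {s} + C') (hxC : x ∈ C) (hxs : G.Adj x s) (hyD : y ∈ D) (hxy : G.Adj x y)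
    (hw : PathOn H D y w) (htw : G.Adj t w) (hq : PathOn H D y q) (hsq : G.Adj s q) :
    Mergeable G H C D := by
  have hsC : s ∈ C := by simp [hC]
  have hmC : ∀ x ∈ C', x ∈ C := fun x hx => by simp [hC, hx]
  have hpC := hmC p hC'.right_mem
  have htC := hmC t hC'.left_mem
  by_cases hxt : x = t
  · subst hxt
    exact ⟨x, s, y, q, (hC'.snoc hsp.symm).cast (by rw [hC]; abel), hq, hxy, hsq⟩
  by_cases hxp : x = p
  · subst hxp
    exact ⟨x, s, y, q, (hC'.symm.snoc hst.symm).cast (by rw [hC]; abel), hq, hxy, hsq⟩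
  have hxC' : x ∈ C' := by rw [hC] at hxC; simpa [hxs.ne] using hxC
  obtain ⟨E, F, e, f, hE, hF, he, hf, rfl⟩ := hC'.split hxC' hxt hxp
  have heC := hmC e (by simp [hE.right_mem])
  have hfC := hmC f (by simp [hF.left_mem])
  have hxT := I.memT hxC hyD hxy
  have hsT := I.memT' hxC hyD hxy hsC hxs
  have heT := I.memT' hxC hyD hxy heC (I.le he.symm)
  have hfT := I.memT' hxC hyD hxy hfC (I.le hf)
  have hpT := I.memT' hsC hq.right_mem hsq hpC (I.le hsp)
  have htT := I.memT' hsC hq.right_mem hsq htC (I.le hst)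
  have nd := I.nodupC
  rw [hC] at nd
  have hef : e ≠ f := ne_of_nodup_add (Multiset.nodup_add.1 nd).2.1
    (by simp [hE.right_mem]) hF.left_mem
  have hne : ∀ {c}, c ∈ C → c ≠ y := fun hc e => I.disj hc (e ▸ hyD)
  -- Either `x` is bypassed and moved behind `s`, where it is joined to `y`, or one of its cycle
  -- neighbours is itself adjacent to `y`.
  rcases I.claw (I.le he.symm) (I.le hf) hxy hef (hne heC) (hne hfC) with h | h | h
  · exact ⟨t, x, w, y, (((hE.append hF (I.adjT heT hfT h)).snoc hsp.symm).snoc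
      (I.adjT hsT hxT hxs.symm)).cast (by rw [hC]; abel), hw.symm, htw, hxy⟩
  · exact ⟨e, s, y, q, (((hE.symm.append hF.symm (I.adjT htT hpT hpt.symm)).snoc hf.symm).snoc
      (I.adjT hxT hsT hxs)).cast (by rw [hC]; abel), hq, h, hsq⟩
  · exact ⟨t, f, w, y, (((hE.snoc he).snoc (I.adjT hxT hsT hxs)).append hF.symm hsp).cast
      (by rw [hC]; abel), hw.symm, htw, h⟩

/-- The vertex `q` and the segment `E` of `D`, both of whose ends are neighbours of `q`, lie
between `q'` and `w` on the cycle through `D`; a further neighbour `x` of `s` in `D` is adjacent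
to an end of `E`. -/
theorem mergeable_of_right (I : Interface G H C D T) {s t q q' w f x y y' : V}
    {E F : Multiset V} (hC : PathOn H C s t) (hE : PathOn H E y' y) (hF : PathOn H F f q')
    (hwf : H.Adj w f) (hqq' : H.Adj q q') (hqy : G.Adj q y) (hqy' : G.Adj q y')
    (hsq : G.Adj s q) (hsq' : G.Adj s q') (htw : G.Adj t w)
    (hD : D = {q} + (E + {w} + F)) (hxD : x ∈ D) (hxs : G.Adj s x) (hxy : G.Adj x y)
    (hxq : x ≠ q) (hsw : ¬ G.Adj s w) (hsf : ¬ G.Adj s f) (hsy : ¬ G.Adj s y)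
    (hsy' : ¬ G.Adj s y') : Mergeable G H C D := by
  have hsC := hC.left_mem
  have hqD : q ∈ D := by simp [hD]
  have hwD : w ∈ D := by simp [hD]
  have hmE : ∀ x ∈ E, x ∈ D := fun x hx => by simp [hD, hx]
  have hmF : ∀ x ∈ F, x ∈ D := fun x hx => by simp [hD, hx]
  have hyD := hmE y hE.right_mem
  have hy'D := hmE y' hE.left_mem
  have hq'D := hmF q' hF.right_mem
  have hne : ∀ {d}, d ∈ D → d ≠ s := fun hd e => I.disj hsC (e ▸ hd)
  have qy := I.adjD hqD hyD hqy
  have qy' := I.adjD hqD hy'D hqy'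
  have xy := I.adjD hxD hyD hxy
  have nd := I.nodupD
  rw [hD] at nd
  have ndE : E.Nodup := (Multiset.nodup_add.1 (Multiset.nodup_add.1
    (Multiset.nodup_add.1 nd).2.1).1).1
  have ndF : F.Nodup := (Multiset.nodup_add.1 (Multiset.nodup_add.1 nd).2.1).2.1
  have cl : ∀ {a b}, a ∈ D → b ∈ D → G.Adj s a → G.Adj s b → a ≠ b → H.Adj a b :=
    fun ha hb sa sb hab => I.adjD ha hb (I.clique hsC ha hb sa sb hab)
  -- Every rerouting below runs from a neighbour of `s` to `w`, the partner of `t`, and enters `w`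
  -- from `f`. The neighbours of `s` in `D` form a clique, which supplies the chords at `x`, `q` and
  -- `q'`.
  by_cases hxq' : x = q'
  · subst hxq'
    exact ⟨s, t, q, w, hC, ((((hE.cons qy').append hF.symm xy.symm)).snoc hwf.symm).cast
      (by rw [hD]; abel), hsq, htw⟩
  have hx : x ∈ E ∨ x ∈ F := by
    rw [hD] at hxD
    have : x ≠ w := by rintro rfl; exact hsw hxs
    simpa [hxq, this] using hxD
  have xq' := cl hxD hq'D hxs hsq' hxq'
  have xq := cl hxD hqD hxs hsq hxq
  rcases hx with hx | hx
  · obtain ⟨E₁, E₂, e, g, hE₁, hE₂, he, hg, rfl⟩ := hE.split hx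
      (by rintro rfl; exact hsy' hxs) (by rintro rfl; exact hsy hxs)
    have heD := hmE e (by simp [hE₁.right_mem])
    have hgD := hmE g (by simp [hE₂.left_mem])
    have heg : e ≠ g := ne_of_nodup_add ndE (by simp [hE₁.right_mem]) hE₂.left_mem
    have neq' : ∀ {a}, a ∈ E₁ + {x} + E₂ → a ≠ q' := fun ha =>
      ne_of_nodup_add (Multiset.nodup_add.1 nd).2.1 (by simp at ha ⊢; tauto) hF.right_mem
    rcases I.claw (I.le he.symm) (I.le hg) hxs.symm heg (hne heD) (hne hgD) with h | h | h
    · exact ⟨s, t, q, w, hC, ((((((hE₁.append hE₂ (I.adjD heD hgD h)).cons qy').snoc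
        xy.symm).append hF.symm xq').snoc hwf.symm)).cast (by rw [hD]; abel), hsq, htw⟩
    · have eq' := cl heD hq'D h.symm hsq' (neq' (by simp [hE₁.right_mem]))
      exact ⟨s, t, x, w, hC, ((((((hE₂.cons hg).snoc qy.symm).append hE₁ qy')).append
        hF.symm eq').snoc hwf.symm).cast (by rw [hD]; abel), hxs, htw⟩
    · exact ⟨s, t, g, w, hC, ((((hE₂.snoc qy.symm).append (hE₁.snoc he) qy').append hF.symm
        xq').snoc hwf.symm).cast (by rw [hD]; abel), h.symm, htw⟩
  · obtain ⟨F₁, F₂, e, g, hF₁, hF₂, he, hg, rfl⟩ := hF.split hx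
      (by rintro rfl; exact hsf hxs) hxq'
    have heD := hmF e (by simp [hF₁.right_mem])
    have hgD := hmF g (by simp [hF₂.left_mem])
    have heg : e ≠ g := ne_of_nodup_add ndF (by simp [hF₁.right_mem]) hF₂.left_mem
    rcases I.claw (I.le he.symm) (I.le hg) hxs.symm heg (hne heD) (hne hgD) with h | h | h
    · exact ⟨s, t, q, w, hC, (((((hE.cons qy').snoc xy.symm).append hF₂.symm xq').append
        hF₁.symm (I.adjD hgD heD h.symm)).snoc hwf.symm).cast (by rw [hD]; abel), hsq, htw⟩
    · have qe := cl hqD heD hsq h.symm (ne_of_nodup_add nd (by simp) (by simp [hF₁.right_mem]))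
      exact ⟨s, t, q', w, hC, ((((((hF₂.symm.snoc hg.symm).append hE.symm xy).snoc
        qy'.symm).append hF₁.symm qe)).snoc hwf.symm).cast (by rw [hD]; abel), hsq', htw⟩
    · exact ⟨s, t, g, w, hC, (((((hF₂.snoc hqq'.symm).append hE qy').snoc xy.symm).append
        hF₁.symm he.symm).snoc hwf.symm).cast (by rw [hD]; abel), h.symm, htw⟩

end Interface

end SimpleGraph

/-! ### Merging two cycles: four-cycles across the interface and the general case -/

namespace SimpleGraph

variable {V : Type*}

namespace Interface

variable {G H : SimpleGraph V} {C D : Multiset V} {T : Set V}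

/-- The cycle through `D` runs `q' q e w f ⋯ q'`. -/
theorem mergeable_of_triangle (I : Interface G H C D T) {s t q q' e w f p : V}
    {F C' : Multiset V} (hC' : PathOn H C' t p) (hst : H.Adj s t) (hsp : H.Adj s p)
    (hpt : G.Adj p t) (hC : C = {s} + C') (hF : PathOn H F f q') (hqe : H.Adj q e)
    (hew : H.Adj e w) (hwf : H.Adj w f) (hqq' : H.Adj q q') (hqw : H.Adj q w)
    (hsq : G.Adj s q) (hsq' : G.Adj s q') (htw : G.Adj t w) (htf : G.Adj t f)
    (hD : D = {q} + ({e} + {w} + F)) (hsw : ¬ G.Adj s w) (hsf : ¬ G.Adj s f)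
    (hse : ¬ G.Adj s e) (heq' : ¬ G.Adj e q') : Mergeable G H C D := by
  have hsC : s ∈ C := by simp [hC]
  have hqD : q ∈ D := by simp [hD]
  have hwD : w ∈ D := by simp [hD]
  have heD : e ∈ D := by simp [hD]
  have hmF : ∀ x ∈ F, x ∈ D := fun x hx => by simp [hD, hx]
  have hq'D := hmF q' hF.right_mem
  have hfD := hmF f hF.left_mem
  have nd := I.nodupD
  rw [hD] at nd
  have ndF : F.Nodup := (Multiset.nodup_add.1 (Multiset.nodup_add.1 nd).2.1).2.1
  have hneF : ∀ {a}, a ∈ F → a ≠ e := fun ha =>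
    (ne_of_nodup_add (Multiset.nodup_add.1 nd).2.1 (by simp) ha).symm
  have hst' : PathOn H C s t := ((hC'.symm.cons hsp)).cast (by rw [hC])
  have hse' : e ≠ s := fun h => I.disj hsC (h ▸ heD)
  -- The paw has triangle `q s q'` and pendant vertex `e`.
  obtain ⟨x, -, hxq, hxe, hxs, hxq', hex, hx⟩ := I.paw (a₀ := q) (a₁ := e) (b₁ := s) (b₂ := q')
    trivial trivial trivial trivial (I.le hqe) hsq.symm (I.le hqq') hsq' (fun h => hse h.symm)
    heq' hse' (hneF hF.right_mem).symm
  by_cases hsx : G.Adj s x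
  · rcases I.closeC hsC hqD hsq hsx with hxC | hxD
    · refine I.mergeable_of_left (y := e) (w := w) (q := q) hC' hst hsp hpt hC hxC hsx.symm heD
        hex.symm ?_ htw ?_ hsq
      · exact ((((hF.symm.cons hqq').cons hqe.symm)).snoc hwf.symm).cast (by rw [hD]; abel)
      · exact (((hF.cons hwf).snoc hqq'.symm).cons hew).cast (by rw [hD]; abel)
    · exact I.mergeable_of_right hst' (PathOn.single H e) hF hwf hqq' (I.le hqe) (I.le hqe)
        hsq hsq' htw hD hxD hsx hex.symm hxq hsw hsf hse hse
  have hq'x : G.Adj q' x := hx.resolve_left hsx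
  rcases I.closeD hsC hq'D hsq' hq'x with hxC | hxD
  -- A vertex of `C` adjacent to both `e` and `q'` would make these two adjacent.
  · exact absurd (I.clique hxC heD hq'D hex.symm hq'x.symm (hneF hF.right_mem).symm) heq'
  have ex := I.adjD heD hxD hex
  have q'x := I.adjD hq'D hxD hq'x
  by_cases hxw : x = w
  · subst hxw
    exact ⟨s, t, q, f, hst', (((hF.symm.cons q'x.symm).cons hew).cons hqe).cast
      (by rw [hD]; abel), hsq, htf⟩
  by_cases hxf : x = f
  · subst hxf
    exact ⟨s, t, q, w, hst', ((((hF.symm.cons hqq').snoc ex.symm).snoc hew)).cast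
      (by rw [hD]; abel), hsq, htw⟩
  have hxF : x ∈ F := by
    rw [hD] at hxD; simpa [hxq, hxe, hxw] using hxD
  obtain ⟨F₁, F₂, a, b, hF₁, hF₂, ha, hb, rfl⟩ := hF.split hxF hxf hxq'
  have haF : a ∈ F₁ + {x} + F₂ := by simp [hF₁.right_mem]
  have hbF : b ∈ F₁ + {x} + F₂ := by simp [hF₂.left_mem]
  have hab : a ≠ b := ne_of_nodup_add ndF (by simp [hF₁.right_mem]) hF₂.left_mem
  rcases I.claw (I.le ha.symm) (I.le hb) hex.symm hab (hneF haF) (hneF hbF) with h | h | h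
  · exact ⟨s, t, q, f, hst', (((((hF₂.symm.cons q'x.symm).append hF₁.symm
      (I.adjD (hmF b hbF) (hmF a haF) h.symm)).cons ex).cons hew.symm).cons hqw).cast
      (by rw [hD]; abel), hsq, htf⟩
  · exact ⟨s, t, q, w, hst', (((((hF₂.symm.snoc hb.symm).snoc ex.symm).append hF₁.symm
      (I.adjD heD (hmF a haF) h.symm)).snoc hwf.symm).cons hqq').cast (by rw [hD]; abel),
      hsq, htw⟩
  · exact ⟨s, t, q, w, hst', (((((hF₂.symm.snoc (I.adjD (hmF b hbF) heD h)).snoc ex).append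
      hF₁.symm ha.symm).snoc hwf.symm).cons hqq').cast (by rw [hD]; abel), hsq, htw⟩

/-- `s` and `t` are consecutive on the cycle through `C`, and `s t w q` is a 4-cycle with
`q` and `w` in `D`. -/
theorem mergeable_of_square (I : Interface G H C D T) {s t p q w : V} {C' : Multiset V}
    (hC' : PathOn H C' t p) (hst : H.Adj s t) (hsp : H.Adj s p) (hpt : G.Adj p t)
    (hC : C = {s} + C') (hDc : CycleOn H D) (hqD : q ∈ D) (hwD : w ∈ D) (hsq : G.Adj s q)
    (htw : G.Adj t w) (hqw : G.Adj q w) (htq : ¬ G.Adj t q) : Mergeable G H C D := by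
  have hsC : s ∈ C := by simp [hC]
  have htC : t ∈ C := by simp [hC, hC'.left_mem]
  have hst' : PathOn H C s t := ((hC'.symm.cons hsp)).cast (by rw [hC])
  have hne : ∀ {c d}, c ∈ C → d ∈ D → c ≠ d := fun hc hd e => I.disj hc (e ▸ hd)
  have qw := I.adjD hqD hwD hqw
  obtain ⟨D', n, m, hD', hqn, hqm, hnm, hD⟩ := hDc.delete I.nodupD hqD
  have hmD : ∀ x ∈ D', x ∈ D := fun x hx => by simp [hD, hx]
  have hnD := hmD n hD'.left_mem
  have hmmD := hmD m hD'.right_mem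
  have hwD' : w ∈ D' := by have := hwD; rw [hD] at this; simpa [hqw.ne'] using this
  have nd := I.nodupD
  rw [hD] at nd
  have hneq : ∀ {a}, a ∈ D' → q ≠ a := fun ha => ne_of_nodup_add nd (by simp) ha
  -- If the cycle neighbours of `q` are adjacent, `D` without `q` is still a cycle, and `q` can be
  -- reinserted next to `w` or at its other side.
  by_cases hnm' : G.Adj n m
  · obtain ⟨y, hy, hwy⟩ := hD'.rotate (I.adjD hnD hmmD hnm') hwD'
    have hyD := hmD y hy.left_mem
    rcases I.claw hqw.symm htw.symm (I.le hwy) (hne htC hqD).symm (hneq hy.left_mem)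
      (hne htC hyD) with h | h | h
    · exact absurd h.symm htq
    · exact ⟨s, t, q, w, hst', (hy.cons (I.adjD hqD hyD h)).cast hD, hsq, htw⟩
    · exact ⟨s, t, q, y, hst', (hy.symm.cons qw).cast hD, hsq, h⟩
  -- Otherwise there being no claw at `q` joins `s` to one of its two cycle neighbours, called `q'`;
  -- by the clique property `s` is not adjacent to the other one, `g`.
  have key : ∀ {g q'}, PathOn H D' g q' → H.Adj q g → H.Adj q q' → ¬ G.Adj g q' → g ≠ q' →
      G.Adj s q' → Mergeable G H C D := by
    clear hnm' hnm hnD hmmD hqn hqm hD' n m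
    intro g q' hD' hqg hqq' hgq' hgq'n hsq'
    have hgD := hmD g hD'.left_mem
    have hq'D := hmD q' hD'.right_mem
    have hsg : ¬ G.Adj s g := fun h => hgq' (I.clique hsC hgD hq'D h hsq' hgq'n)
    by_cases hwq' : w = q'
    · subst hwq'
      exact ⟨s, t, q, w, hst', (hD'.cons hqg).cast hD, hsq, htw⟩
    by_cases hwg : w = g
    · subst hwg
      exact ⟨s, t, q, w, hst', (hD'.symm.cons hqq').cast hD, hsq, htw⟩
    obtain ⟨E, F, e, f, hE, hF, he, hf, rfl⟩ := hD'.split hwD' hwg hwq'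
    have heD' : e ∈ E + {w} + F := by simp [hE.right_mem]
    have hfD' : f ∈ E + {w} + F := by simp [hF.left_mem]
    have heD := hmD e heD'
    have hfD := hmD f hfD'
    have hef : e ≠ f := ne_of_nodup_add (Multiset.nodup_add.1 nd).2.1
      (by simp [hE.right_mem]) hF.left_mem
    by_cases hsw : G.Adj s w
    · rcases I.claw (I.le he.symm) (I.le hf) htw.symm hef (hne htC heD).symm
        (hne htC hfD).symm with h | h | h
      · exact ⟨t, s, w, q, hst'.symm, (((hF.symm.append hE.symm (I.adjD hfD heD h.symm)).cons
          (I.adjD hwD hq'D (I.clique hsC hwD hq'D hsw hsq' hwq'))).snoc hqg.symm).cast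
          (by rw [hD]; abel), htw, hsq⟩
      · exact ⟨s, t, w, e, hst', ((((hF.cons hf).snoc hqq'.symm)).append hE hqg).cast
          (by rw [hD]; abel), hsw, h.symm⟩
      · exact ⟨s, t, w, f, hst', ((((hE.symm.cons he.symm).snoc hqg.symm)).append hF.symm
          hqq').cast (by rw [hD]; abel), hsw, h.symm⟩
    have hgw : G.Adj g w := by
      rcases I.claw hsq.symm (I.le hqg) hqw (hne hsC hgD) (hne hsC hwD) (Ne.symm hwg)
        with h | h | h
      · exact absurd h hsg
      · exact absurd h hsw
      · exact h
    by_cases hef' : G.Adj e f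
    · exact ⟨t, s, w, q, hst'.symm, (((hE.append hF (I.adjD heD hfD hef')).cons
        (I.adjD hwD hgD hgw.symm)).snoc hqq'.symm).cast (by rw [hD]; abel), htw, hsq⟩
    by_cases hte : G.Adj t e
    · have htf : ¬ G.Adj t f := fun h => hef' (I.clique htC heD hfD hte h hef)
      have hfq : G.Adj f q := by
        rcases I.claw htw.symm (I.le hf) hqw.symm (hne htC hfD) (hne htC hqD)
          (hneq hfD').symm with h | h | h
        · exact absurd h htf
        · exact absurd h htq
        · exact h
      exact ⟨s, t, q', w, hst', ((((hF.symm.snoc (I.adjD hfD hqD hfq)).append hE hqg)).snoc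
        he).cast (by rw [hD]; abel), hsq', htw⟩
    have htf : G.Adj t f := by
      rcases I.claw (I.le he.symm) (I.le hf) htw.symm hef (hne htC heD).symm
        (hne htC hfD).symm with h | h | h
      · exact absurd h hef'
      · exact absurd h.symm hte
      · exact h.symm
    have heq : G.Adj e q := by
      rcases I.claw htw.symm (I.le he.symm) hqw.symm (hne htC heD) (hne htC hqD)
        (hneq heD').symm with h | h | h
      · exact absurd h hte
      · exact absurd h htq
      · exact h
    by_cases hse : G.Adj s e
    · exact ⟨s, t, e, w, hst', (((hE.symm.snoc hqg.symm).append hF.symm hqq').snoc hf.symm).cast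
        (by rw [hD]; abel), hse, htw⟩
    by_cases hsf : G.Adj s f
    · exact ⟨s, t, f, w, hst', (((hF.snoc hqq'.symm).append hE hqg).snoc he).cast
        (by rw [hD]; abel), hsf, htw⟩
    by_cases hge : g = e
    · subst hge
      obtain rfl := hE.card_eq_one (Multiset.nodup_add.1 (Multiset.nodup_add.1
        (Multiset.nodup_add.1 nd).2.1).1).1
      exact I.mergeable_of_triangle hC' hst hsp hpt hC hF hqg he hf hqq' qw hsq hsq' htw htf hD
        hsw hsf hsg hgq'
    have hge' : G.Adj g e := by
      rcases I.claw hsq.symm (I.le hqg) heq.symm (hne hsC hgD) (hne hsC heD) hge with h | h | h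
      · exact absurd h hsg
      · exact absurd h hse
      · exact h
    -- What remains is a paw with triangle `q g e` and pendant vertex `s`. Its common neighbour `x`
    -- lies in `C` or in `D`, which are the situations of `mergeable_of_left` and
    -- `mergeable_of_right`.
    obtain ⟨x, -, hxq, hxs, hxg, hxe, hsx, hx⟩ := I.paw (a₀ := q) (a₁ := s) (b₁ := g) (b₂ := e)
      trivial trivial trivial trivial hsq.symm (I.le hqg) heq.symm hge' hsg hse (hne hsC hgD)
      (hne hsC heD)
    have qe := I.adjD hqD heD heq.symm
    rcases I.closeC hsC hqD hsq hsx with hxC | hxD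
    · rcases hx with hx | hx
      · refine I.mergeable_of_left (y := g) (w := w) (q := q') hC' hst hsp hpt hC hxC hsx.symm hgD
          hx.symm ?_ htw ?_ hsq'
        · exact (((hE.snoc qe.symm).append hF.symm hqq').snoc hf.symm).cast (by rw [hD]; abel)
        · exact ((((hE.snoc qe.symm).snoc qw).append hF hf)).cast (by rw [hD]; abel)
      · refine I.mergeable_of_left (y := e) (w := w) (q := q') hC' hst hsp hpt hC hxC hsx.symm heD
          hx.symm ?_ htw ?_ hsq'
        · exact (((hE.symm.snoc hqg.symm).append hF.symm hqq').snoc hf.symm).cast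
            (by rw [hD]; abel)
        · exact ((((hE.symm.snoc hqg.symm).snoc qw).append hF hf)).cast (by rw [hD]; abel)
    · rcases hx with hx | hx
      · exact I.mergeable_of_right hst' hE.symm hF hf hqq' (I.le hqg) heq.symm hsq hsq' htw hD
          hxD hsx hx.symm hxq hsw hsf hsg hse
      · exact I.mergeable_of_right hst' hE hF hf hqq' heq.symm (I.le hqg) hsq hsq' htw hD
          hxD hsx hx.symm hxq hsw hsf hse hsg
  rcases I.claw hsq.symm (I.le hqn) (I.le hqm) (hne hsC hnD) (hne hsC hmmD) hnm with h | h | h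
  · exact key hD'.symm hqm hqn (fun h => hnm' h.symm) hnm.symm h
  · exact key hD' hqn hqm hnm' hnm h
  · exact (hnm' h).elim

/-- Two disjoint cycles that are joined by an edge can be merged along two edges. -/
theorem mergeable (I : Interface G H C D T) (hCc : CycleOn H C) (hDc : CycleOn H D)
    {s q z : V} (hsC : s ∈ C) (hsq : G.Adj s q) (hqz : H.Adj q z) (hD : PathOn H D z q)
    (hz : ∀ c ∈ C, ¬ G.Adj c z) : Mergeable G H C D := by
  have hqD := hD.right_mem
  have hzD := hD.left_mem
  obtain ⟨D', y, hD', hyq, hDe⟩ := hD.exists_last hqz.ne'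
  have hzy : z ≠ y := by
    rintro rfl
    have nd := I.nodupD
    rw [hDe] at nd
    have h1 := hD'.card_eq_one (Multiset.nodup_add.1 nd).1
    obtain ⟨_, _, _, _, h3⟩ := hDc
    rw [hDe, h1] at h3
    simp at h3
  have common : ∀ {s t}, PathOn H C s t → G.Adj s t → G.Adj s q → G.Adj t q →
      Mergeable G H C D := fun h hst hsq htq =>
    I.mergeable_of_common_neighbor h hst hsq htq hD' hqz hyq.symm hzy
      (by rw [hDe, add_comm]) hz
  have hne : ∀ {c d}, c ∈ C → d ∈ D → c ≠ d := fun hc hd e => I.disj hc (e ▸ hd)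
  obtain ⟨C', n, p, hC', hsn, hsp, hnp, hC⟩ := hCc.delete I.nodupC hsC
  have hmC : ∀ x ∈ C', x ∈ C := fun x hx => by simp [hC, hx]
  have hnC := hmC n hC'.left_mem
  have hpC := hmC p hC'.right_mem
  by_cases hnq : G.Adj n q
  · exact common ((hC'.symm.cons hsp).cast hC) (I.le hsn) hsq hnq
  by_cases hpq : G.Adj p q
  · exact common ((hC'.cons hsn).cast hC) (I.le hsp) hsq hpq
  have hnp' : G.Adj n p := by
    rcases I.claw (I.le hsn) (I.le hsp) hsq hnp (hne hnC hqD) (hne hpC hqD) with h | h | h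
    · exact h
    · exact absurd h hnq
    · exact absurd h hpq
  -- Neither cycle neighbour of `s` sees `q`, so `s n p` with pendant vertex `q` is an induced paw.
  obtain ⟨w, -, hws, hwq, hwn, hwp, hqw, hw⟩ := I.paw (a₀ := s) (a₁ := q) (b₁ := n) (b₂ := p)
    trivial trivial trivial trivial hsq (I.le hsn) (I.le hsp) hnp' (fun h => hnq h.symm)
    (fun h => hpq h.symm) (hne hnC hqD).symm (hne hpC hqD).symm
  have key : ∀ {n p}, PathOn H C' n p → H.Adj s n → H.Adj s p → G.Adj n p → G.Adj n w →
      w ≠ n → w ≠ p → ¬ G.Adj n q → Mergeable G H C D := by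
    clear hnq hpq hnp' hw hwn hwp hnC hpC hnp hsn hsp hC' n p
    intro n p hC' hsn hsp hnp hnw hwn hwp hnq
    have hnC := hmC n hC'.left_mem
    rcases I.closeD hsC hqD hsq hqw with hwC | hwD
    · have hsw : G.Adj w s := by
        rcases I.claw hqw hsq.symm (I.le hqz) hws (hne hwC hzD) (hne hsC hzD) with h | h | h
        · exact h
        · exact absurd h (hz w hwC)
        · exact absurd h (hz s hsC)
      have hwC' : w ∈ C' := by have := hwC; rw [hC] at this; simpa [hws] using this
      obtain ⟨E, F, e, f, hE, hF, he, hf, rfl⟩ := hC'.split hwC' hwn hwp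
      have heC := hmC e (by simp [hE.right_mem])
      have hfC := hmC f (by simp [hF.left_mem])
      have hef : e ≠ f := by
        have nd := I.nodupC
        rw [hC] at nd
        exact ne_of_nodup_add (Multiset.nodup_add.1 nd).2.1 (by simp [hE.right_mem]) hF.left_mem
      have hwT := I.memT hwC hqD hqw.symm
      have hnT := I.memT' hsC hqD hsq hnC (I.le hsn)
      have heT := I.memT' hwC hqD hqw.symm heC (I.le he.symm)
      have hfT := I.memT' hwC hqD hqw.symm hfC (I.le hf)
      rcases I.claw (I.le he.symm) (I.le hf) hqw.symm hef (hne heC hqD) (hne hfC hqD)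
        with h | h | h
      · exact common ((((hE.append hF (I.adjT heT hfT h)).cons (I.adjT hwT hnT hnw.symm)).snoc
          hsp.symm).cast (by rw [hC]; abel)) hsw hqw.symm hsq
      · exact common ((((hE.symm.snoc hsn.symm).append hF.symm hsp).snoc hf.symm).cast
          (by rw [hC]; abel)) (I.le he) h hqw.symm
      · exact common ((((hF.snoc hsp.symm).append hE hsn).snoc he).cast
          (by rw [hC]; abel)) (I.le hf.symm) h hqw.symm
    · exact I.mergeable_of_square hC' hsn hsp hnp.symm hC hDc hqD hwD hsq hnw hqw hnq
  rcases hw with hw | hw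
  · exact key hC' hsn hsp hnp' hw hwn hwp hnq
  · exact key hC'.symm hsp hsn hnp'.symm hw hwp hwn hpq

end Interface

end SimpleGraph

/-! ### Connectivity inside vertex sets, distance levels and hulls -/

namespace SimpleGraph

variable {V : Type*}

/-! ### Reachability inside a set of vertices -/

/-- `G` has a walk from `a` to `b` all of whose vertices lie in `K`. -/
def ReachIn (G : SimpleGraph V) (K : Set V) (a b : V) : Prop :=
  ∃ p : G.Walk a b, ∀ x ∈ p.support, x ∈ K

namespace ReachIn

variable {G : SimpleGraph V} {K L : Set V} {a b c : V}

theorem refl (ha : a ∈ K) : G.ReachIn K a a := ⟨.nil, by simpa using ha⟩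

theorem of_adj (h : G.Adj a b) (ha : a ∈ K) (hb : b ∈ K) : G.ReachIn K a b :=
  ⟨.cons h .nil, by simp [ha, hb]⟩

theorem trans (h : G.ReachIn K a b) (h' : G.ReachIn K b c) : G.ReachIn K a c := by
  obtain ⟨p, hp⟩ := h
  obtain ⟨q, hq⟩ := h'
  refine ⟨p.append q, fun x hx => ?_⟩
  rcases Walk.mem_support_append_iff _ _ |>.1 hx with hx | hx
  · exact hp x hx
  · exact hq x hx

theorem symm (h : G.ReachIn K a b) : G.ReachIn K b a := by
  obtain ⟨p, hp⟩ := h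
  exact ⟨p.reverse, fun x hx => hp x (by simpa using hx)⟩

theorem mono (h : G.ReachIn K a b) (hKL : K ⊆ L) : G.ReachIn L a b := by
  obtain ⟨p, hp⟩ := h
  exact ⟨p, fun x hx => hKL (hp x hx)⟩

theorem left_mem (h : G.ReachIn K a b) : a ∈ K := by
  obtain ⟨p, hp⟩ := h
  exact hp _ p.start_mem_support

theorem right_mem (h : G.ReachIn K a b) : b ∈ K := h.symm.left_mem

theorem exists_finset (h : G.ReachIn K a b) :
    ∃ F : Finset V, (F : Set V) ⊆ K ∧ G.ReachIn F a b := by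
  classical
  obtain ⟨p, hp⟩ := h
  exact ⟨p.support.toFinset, fun x hx => hp x (by simpa using hx), p, fun x hx => by simpa using hx⟩

theorem pathOn (h : G.ReachIn K a b) :
    ∃ m : Multiset V, m.Nodup ∧ PathOn G m a b ∧ ∀ x ∈ m, x ∈ K := by
  classical
  obtain ⟨p, hp⟩ := h
  refine ⟨p.bypass.support, ?_, ⟨p.bypass.support, Walk.isChain_adj_support _, rfl, ?_, ?_⟩,
    fun x hx => hp x (p.support_bypass_subset_support hx)⟩
  · exact Multiset.coe_nodup.2 (p.bypass_isPath.support_nodup)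
  · rw [List.head?_eq_some_head (Walk.support_ne_nil _), Walk.head_support]
  · rw [List.getLast?_eq_some_getLast (Walk.support_ne_nil _), Walk.getLast_support]

/-- A walk that leaves `L` does so along an edge. -/
theorem exists_exit (h : G.ReachIn K a b) (ha : a ∈ L) (hb : b ∉ L) :
    ∃ x y, G.Adj x y ∧ x ∈ L ∧ y ∉ L ∧ y ∈ K ∧ G.ReachIn (K ∩ L) a x := by
  obtain ⟨p, hp⟩ := h
  induction p with
  | nil => exact absurd ha hb
  | @cons u v w huv p ih =>
    have hu : u ∈ K := hp u (by simp)
    have hv : v ∈ K := hp v (by simp)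
    by_cases hvL : v ∈ L
    · obtain ⟨x, y, hxy, hx, hy, hyK, hr⟩ := ih hvL hb fun x hx => hp x (by simp [hx])
      exact ⟨x, y, hxy, hx, hy, hyK,
        ReachIn.trans (of_adj huv (And.intro hu ha) (And.intro hv hvL)) hr⟩
    · exact ⟨u, v, huv, ha, hvL, hv, refl ⟨hu, ha⟩⟩

theorem of_closed (h : G.ReachIn K a b) (ha : a ∈ L)
    (hL : ∀ x y, x ∈ L → y ∈ K → G.Adj x y → y ∈ L) : b ∈ L := by
  by_contra hb
  obtain ⟨x, y, hxy, hx, hy, hyK, -⟩ := h.exists_exit ha hb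
  exact hy (hL x y hx hyK hxy)

theorem inter_of_closed (h : G.ReachIn K a b) (ha : a ∈ L)
    (hL : ∀ x y, x ∈ L → y ∈ K → G.Adj x y → y ∈ L) : G.ReachIn (K ∩ L) a b := by
  have : b ∈ {x | G.ReachIn (K ∩ L) a x} := h.of_closed (refl ⟨h.left_mem, ha⟩) (by
    intro x y hx hy hxy
    exact ReachIn.trans hx (of_adj hxy hx.right_mem ⟨hy, hL x y hx.right_mem.2 hy hxy⟩))
  exact this

end ReachIn

theorem reachIn_of_induce_reachable {G : SimpleGraph V} {K : Set V} {a b : K}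
    (h : (G.induce K).Reachable a b) : G.ReachIn K a b := by
  obtain ⟨p⟩ := h
  induction p with
  | nil => exact .refl (Subtype.prop _)
  | @cons a b _ h _ ih => exact (ReachIn.of_adj (show G.Adj a b from h) a.2 b.2).trans ih

theorem reachIn_of_induce_connected {G : SimpleGraph V} {K : Set V} (h : (G.induce K).Connected)
    {a b : V} (ha : a ∈ K) (hb : b ∈ K) : G.ReachIn K a b :=
  reachIn_of_induce_reachable (h.preconnected ⟨a, ha⟩ ⟨b, hb⟩)

/-! ### Two-connected graphs -/

namespace IsKConnected

variable {G : SimpleGraph V}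

theorem connected (h : G.IsKConnected 2) : G.Connected := by
  have h₀ := h.2 ∅ (by simp)
  obtain ⟨x⟩ := h₀.nonempty
  have : Nonempty V := ⟨x⟩
  refine ⟨fun a b => ?_⟩
  obtain ⟨p, -⟩ := reachIn_of_induce_connected h₀ (a := a) (b := b) (by simp) (by simp)
  exact ⟨p⟩

theorem reachIn_compl (h : G.IsKConnected 2) {x a b : V} (ha : a ≠ x) (hb : b ≠ x) :
    G.ReachIn {x}ᶜ a b := by
  have := h.2 {x} (by simp)
  exact reachIn_of_induce_connected (by rwa [Finset.coe_singleton] at this)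
    (by simpa using ha) (by simpa using hb)

theorem exists_ne (h : G.IsKConnected 2) (x y : V) : ∃ z, z ≠ x ∧ z ≠ y := by
  classical
  by_contra! hno
  have : (Set.univ : Set V) ⊆ ({x, y} : Finset V) := fun z _ => by
    by_cases hz : z = x
    · simp [hz]
    · simp [hno z hz]
  have h₁ := h.1
  rw [← Set.encard_univ] at h₁
  have h₂ := Set.encard_le_encard this
  rw [Set.encard_coe_eq_coe_finsetCard] at h₂
  have h₃ : (({x, y} : Finset V).card : ℕ∞) ≤ 2 := by exact_mod_cast Finset.card_le_two
  exact absurd (h₁.trans_le (h₂.trans h₃)) (lt_irrefl _)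

theorem exists_two_neighbors (h : G.IsKConnected 2) (x : V) :
    ∃ y z, G.Adj x y ∧ G.Adj x z ∧ y ≠ z := by
  have key : ∀ w, ∃ y, G.Adj x y ∧ y ≠ w := by
    intro w
    by_cases hw : w = x
    · subst hw
      obtain ⟨z, hz, -⟩ := h.exists_ne w w
      obtain ⟨p⟩ := h.connected.preconnected w z
      cases p with
      | nil => exact absurd rfl hz
      | cons h _ => exact ⟨_, h, h.ne'⟩
    · obtain ⟨z, hz, hz'⟩ := h.exists_ne x w
      obtain ⟨a, b, hab, ha, hb, hb', -⟩ :=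
        (h.reachIn_compl (Ne.symm hw) hz').exists_exit (L := {x}) rfl hz
      rw [Set.mem_singleton_iff] at ha
      subst ha
      exact ⟨b, hab, hb'⟩
  obtain ⟨y, hy, -⟩ := key x
  obtain ⟨z, hz, hzy⟩ := key y
  exact ⟨y, z, hy, hz, hzy.symm⟩

end IsKConnected

theorem exists_cycleOn_of_reachIn {G : SimpleGraph V} {K : Set V} {x y z : V} (hx : x ∈ K)
    (hxy : G.Adj x y) (hxz : G.Adj x z) (hyz : y ≠ z) (h : G.ReachIn (K \ {x}) y z) :
    ∃ D : Multiset V, CycleOn G D ∧ D.Nodup ∧ ∀ v ∈ D, v ∈ K := by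
  obtain ⟨m, nd, hm, hmK⟩ := h.pathOn
  refine ⟨{x} + m, ⟨x, z, hm.cons hxy, hxz, ?_⟩, ?_, ?_⟩
  · have h₁ : ({y} + {z} : Multiset V) ≤ m := by
      rw [Multiset.le_iff_subset (by simp [hyz])]
      intro v hv
      simp only [Multiset.mem_add, Multiset.mem_singleton] at hv
      rcases hv with rfl | rfl
      exacts [hm.left_mem, hm.right_mem]
    have := Multiset.card_le_card h₁
    simp at this ⊢
    omega
  · rw [Multiset.singleton_add, Multiset.nodup_cons]
    exact ⟨fun h => (hmK x h).2 rfl, nd⟩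
  · intro v hv
    rcases Multiset.mem_add.1 hv with hv | hv
    · rwa [Multiset.mem_singleton.1 hv]
    · exact (hmK v hv).1

/-! ### Distance levels -/

section Levels

variable {G : SimpleGraph V} {o : V}

theorem Connected.dist_le_succ (hG : G.Connected) {u v : V} (h : G.Adj u v) :
    G.dist o v ≤ G.dist o u + 1 := by
  have := hG.dist_triangle (u := o) (v := u) (w := v)
  rwa [dist_eq_one_iff_adj.2 h] at this

theorem Connected.exists_lower (hG : G.Connected) {v : V} (h : 0 < G.dist o v) :
    ∃ u, G.Adj u v ∧ G.dist o u + 1 = G.dist o v := by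
  obtain ⟨p, hp⟩ := hG.exists_walk_length_eq_dist v o
  rw [dist_comm] at hp
  cases p with
  | nil => simp at h
  | @cons _ u _ hvu q =>
    refine ⟨u, hvu.symm, ?_⟩
    have h₁ := dist_le q
    rw [dist_comm] at h₁
    have h₂ := hG.dist_le_succ (o := o) hvu.symm
    simp at hp
    omega

theorem Connected.finite_ball (hG : G.Connected) [G.LocallyFinite] (o : V) (r : ℕ) :
    {v | G.dist o v ≤ r}.Finite := by
  induction r with
  | zero =>
    refine (Set.finite_singleton o).subset fun v hv => ?_
    simp at hv
    rcases hv with h | h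
    · exact h.symm
    · exact absurd (hG.preconnected o v) h
  | succ r ih =>
    refine (ih.union (ih.biUnion fun u _ => (G.neighborSet u).toFinite)).subset fun v hv => ?_
    by_cases h : G.dist o v ≤ r
    · exact .inl h
    · obtain ⟨u, hu, hd⟩ := hG.exists_lower (o := o) (v := v) (by omega)
      have hv : G.dist o v ≤ r + 1 := hv
      exact .inr (Set.mem_biUnion (x := u) (show G.dist o u ≤ r by omega) hu)

theorem Connected.countable [G.LocallyFinite] (hG : G.Connected) : Countable V := by
  obtain ⟨o⟩ := hG.nonempty
  have : (Set.univ : Set V) = ⋃ r, {v | G.dist o v ≤ r} := by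
    ext v; simpa using ⟨_, le_rfl⟩
  rw [← Set.countable_univ_iff, this]
  exact Set.countable_iUnion fun r => (hG.finite_ball o r).countable

variable (G o) in
/-- The component of `v` in the subgraph of the vertices at distance more than `r` from `o`. -/
def outer (r : ℕ) (v : V) : Set V := {x | G.ReachIn {u | r < G.dist o u} v x}

variable (G o) in
/-- The ball of radius `r` around `o` together with the finite components of its complement. -/
def hull (r : ℕ) : Set V := {v | (G.outer o r v).Finite}

theorem lt_dist_of_mem_outer {r : ℕ} {v x : V} (h : x ∈ G.outer o r v) : r < G.dist o x :=
  h.right_mem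

theorem outer_eq {r : ℕ} {v x : V} (h : x ∈ G.outer o r v) : G.outer o r x = G.outer o r v :=
  Set.ext fun _ => ⟨fun h' => h.trans h', fun h' => h.symm.trans h'⟩

theorem mem_outer_self {r : ℕ} {v : V} (h : r < G.dist o v) : v ∈ G.outer o r v := .refl h

theorem mem_outer_of_adj {r : ℕ} {v x y : V} (h : x ∈ G.outer o r v) (hxy : G.Adj x y)
    (hy : r < G.dist o y) : y ∈ G.outer o r v :=
  h.trans (.of_adj hxy h.right_mem hy)

theorem mem_hull_of_dist_le {r : ℕ} {v : V} (h : G.dist o v ≤ r) : v ∈ G.hull o r := by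
  -- For `v` inside the ball there is no admissible walk at all, so `outer` is empty and `v` belongs
  -- to the hull.
  refine Set.finite_empty.subset fun x hx => ?_
  exact absurd (show r < G.dist o v from hx.left_mem) (by omega)

theorem lt_dist_of_notMem_hull {r : ℕ} {v : V} (h : v ∉ G.hull o r) : r < G.dist o v := by
  by_contra! h'
  exact h (mem_hull_of_dist_le h')

theorem mem_hull_iff_of_mem_outer {r : ℕ} {v x : V} (h : x ∈ G.outer o r v) :
    x ∈ G.hull o r ↔ v ∈ G.hull o r := by
  change (G.outer o r x).Finite ↔ (G.outer o r v).Finite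
  rw [outer_eq h]

theorem mem_hull_iff_of_adj {r : ℕ} {x y : V} (hxy : G.Adj x y) (hx : r < G.dist o x)
    (hy : r < G.dist o y) : x ∈ G.hull o r ↔ y ∈ G.hull o r :=
  (mem_hull_iff_of_mem_outer (mem_outer_of_adj (mem_outer_self hx) hxy hy)).symm

theorem hull_mono {r s : ℕ} (h : r ≤ s) : G.hull o r ⊆ G.hull o s := fun _ hv =>
  Set.Finite.subset hv fun _ hx => ReachIn.mono hx fun _ (hu : s < _) => h.trans_lt hu

theorem Connected.exists_mem_outer_dist_eq (hG : G.Connected) {r : ℕ} {v : V}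
    (h : r < G.dist o v) : ∃ u ∈ G.outer o r v, G.dist o u = r + 1 := by
  induction hn : G.dist o v using Nat.strong_induction_on generalizing v with
  | _ n ih =>
    subst hn
    by_cases h1 : G.dist o v = r + 1
    · exact ⟨v, mem_outer_self h, h1⟩
    · obtain ⟨u, huv, hd⟩ := hG.exists_lower (o := o) (v := v) (by omega)
      have hu : r < G.dist o u := by omega
      obtain ⟨w, hw, hd'⟩ := ih _ (by omega) hu rfl
      refine ⟨w, ?_, hd'⟩
      rwa [← outer_eq (mem_outer_of_adj (mem_outer_self h) huv.symm hu)]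

/-- Every component outside the ball has a vertex at level `r + 1`, so only finitely many components
are added. -/
theorem Connected.finite_hull [G.LocallyFinite] (hG : G.Connected) (r : ℕ) :
    (G.hull o r).Finite := by
  have h₁ : ({u | G.dist o u ≤ r + 1} ∩ G.hull o r).Finite := (hG.finite_ball o _).inter_of_left _
  refine ((hG.finite_ball o r).union (h₁.biUnion fun u hu => hu.2)).subset fun v hv => ?_
  by_cases h : G.dist o v ≤ r
  · exact .inl h
  · obtain ⟨u, hu, hd⟩ := hG.exists_mem_outer_dist_eq (o := o) (v := v) (r := r) (by omega)
    refine .inr (Set.mem_biUnion (x := u) ⟨hd.le, (mem_hull_iff_of_mem_outer hu).2 hv⟩ ?_)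
    rw [outer_eq hu]
    exact mem_outer_self (by omega)

/-- Adjacent vertices beyond level `r` share a component, so they are both in the hull or both
outside; an edge can leave the hull only from level `r`. -/
theorem dist_eq_of_mem_hull_of_adj {r : ℕ} (hG : G.Connected) {s t : V} (hs : s ∈ G.hull o r)
    (ht : t ∉ G.hull o r) (hst : G.Adj s t) : G.dist o s = r ∧ G.dist o t = r + 1 := by
  have h₁ := lt_dist_of_notMem_hull ht
  have h₂ : ¬ r < G.dist o s := fun h => ht ((mem_hull_iff_of_adj hst h h₁).1 hs)
  have := hG.dist_le_succ (o := o) hst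
  omega

theorem not_adj_of_dist (hG : G.Connected) {u v : V} (h : G.dist o u + 1 < G.dist o v) :
    ¬ G.Adj u v := fun h' => by
  have := hG.dist_le_succ (o := o) h'
  omega

/-- The neighbours of a vertex of the hull outside the hull form a clique. -/
theorem adj_of_mem_hull (hG : G.Connected) (hclaw : G.ClawProp) {r : ℕ} (hr : 1 ≤ r) {s t t' : V}
    (hs : s ∈ G.hull o r) (ht : t ∉ G.hull o r) (ht' : t' ∉ G.hull o r) (hst : G.Adj s t)
    (hst' : G.Adj s t') (hne : t ≠ t') : G.Adj t t' := by
  obtain ⟨h₁, h₂⟩ := dist_eq_of_mem_hull_of_adj hG hs ht hst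
  obtain ⟨-, h₃⟩ := dist_eq_of_mem_hull_of_adj hG hs ht' hst'
  -- The third leg of the claw at `s` is a neighbour at level `r - 1`, which sees nothing at level
  -- `r + 1`; this needs `1 ≤ r`.
  obtain ⟨y, hy, hd⟩ := hG.exists_lower (o := o) (v := s) (by omega)
  have ne : ∀ {z}, G.dist o z = r + 1 → y ≠ z := by rintro z hz rfl; omega
  rcases hclaw hy.symm hst hst' (ne h₂) (ne h₃) hne with h | h | h
  · exact absurd h (not_adj_of_dist hG (o := o) (by omega))
  · exact absurd h (not_adj_of_dist hG (o := o) (by omega))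
  · exact h

/-- A common neighbour outside the component would lie in the hull, and then its two neighbours in
the component would be adjacent, contrary to the paw being induced. -/
theorem pawPropOn_outer (hG : G.Connected) (hclaw : G.ClawProp) (hpaw : G.PawPropOn Set.univ)
    {r : ℕ} (hr : 1 ≤ r) {v : V} (hv : v ∉ G.hull o r) : G.PawPropOn (G.outer o r v) := by
  intro a₀ a₁ b₁ b₂ h₀ h₁ h₂ h₃ e₁ e₂ e₃ e₄ n₁ n₂ n₃ n₄
  obtain ⟨w, -, w₁, w₂, w₃, w₄, hw, hw'⟩ :=
    hpaw trivial trivial trivial trivial e₁ e₂ e₃ e₄ n₁ n₂ n₃ n₄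
  refine ⟨w, ?_, w₁, w₂, w₃, w₄, hw, hw'⟩
  by_contra hwK
  have hwd : w ∈ G.hull o r := mem_hull_of_dist_le (by
    by_contra! h
    exact hwK (mem_outer_of_adj h₁ hw h))
  have out : ∀ {x}, x ∈ G.outer o r v → x ∉ G.hull o r := fun hx h =>
    hv ((mem_hull_iff_of_mem_outer hx).1 h)
  rcases hw' with hb | hb
  · exact n₁ (adj_of_mem_hull hG hclaw hr hwd (out h₁) (out h₂) hw.symm hb.symm n₃)
  · exact n₂ (adj_of_mem_hull hG hclaw hr hwd (out h₁) (out h₃) hw.symm hb.symm n₄)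

end Levels

end SimpleGraph

/-! ### Hamilton cycles of regions cut off by a hull -/

namespace SimpleGraph

open Filter

variable {V : Type*} {G : SimpleGraph V} {o : V} {K : Set V} {k : ℕ}

/-! ### Hamilton cycles of finite pieces -/

/-- A connected set of vertices with the paw property that is closed under descending to
level `k`. -/
structure Region (G : SimpleGraph V) (o : V) (K : Set V) (k : ℕ) : Prop where
  conn : ∀ x ∈ K, ∀ y ∈ K, G.ReachIn K x y
  lower : ∀ v ∈ K, k < G.dist o v → ∀ u, G.Adj u v → G.dist o u + 1 = G.dist o v → u ∈ K
  paw : G.PawPropOn K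

theorem region_univ (hG : G.Connected) (hpaw : G.PawPropOn Set.univ) :
    Region G o Set.univ 0 where
  conn x _ y _ := ⟨(hG.preconnected x y).some, fun _ _ => trivial⟩
  lower _ _ _ _ _ _ := trivial
  paw := hpaw

theorem outer_conn {r : ℕ} {v x y : V} (hx : x ∈ G.outer o r v) (hy : y ∈ G.outer o r v) :
    G.ReachIn (G.outer o r v) x y :=
  ((hx.symm.trans hy).inter_of_closed hx fun _ _ h h' hadj => mem_outer_of_adj h hadj h').mono
    Set.inter_subset_right

theorem region_outer (hG : G.Connected) (hclaw : G.ClawProp) (hpaw : G.PawPropOn Set.univ)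
    {r : ℕ} (hr : 1 ≤ r) {v : V} (hv : v ∉ G.hull o r) :
    Region G o (G.outer o r v) (r + 1) where
  conn _ hx _ hy := outer_conn hx hy
  lower x hx hd u hu hd' := mem_outer_of_adj hx hu.symm (by omega)
  paw := pawPropOn_outer hG hclaw hpaw hr hv

namespace Region

theorem exists_descent (hG : G.Connected) (hK : Region G o K k) {R : ℕ} {v : V} (hv : v ∈ K)
    (hR : G.dist o v ≤ R) :
    ∃ u ∈ K, G.dist o u ≤ k ∧ G.ReachIn (K ∩ {x | G.dist o x ≤ R}) v u := by
  induction hn : G.dist o v using Nat.strong_induction_on generalizing v with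
  | _ n ih =>
    subst hn
    by_cases hk : G.dist o v ≤ k
    · exact ⟨v, hv, hk, .refl ⟨hv, hR⟩⟩
    · obtain ⟨u, huv, hd⟩ := hG.exists_lower (o := o) (v := v) (by omega)
      have hu := hK.lower v hv (by omega) u huv hd
      obtain ⟨w, hw, hwk, hr⟩ := ih _ (by omega) hu (by omega) rfl
      exact ⟨w, hw, hwk, ReachIn.trans (ReachIn.of_adj huv.symm (And.intro hv hR)
        (And.intro hu (show G.dist o u ≤ R by omega))) hr⟩

/-- The finitely many vertices of `K` up to level `k` are connected inside some ball, and all others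
descend to them along decreasing levels without leaving the ball. -/
theorem eventually_conn [G.LocallyFinite] (hG : G.Connected) (hK : Region G o K k) :
    ∀ᶠ R in atTop, ∀ x ∈ K, ∀ y ∈ K, G.dist o x ≤ R → G.dist o y ≤ R →
      G.ReachIn (K ∩ {x | G.dist o x ≤ R}) x y := by
  have hQ : (K ∩ {x | G.dist o x ≤ k}).Finite := (hG.finite_ball o k).inter_of_right _
  have : ∀ᶠ R in atTop, ∀ x ∈ K ∩ {x | G.dist o x ≤ k}, ∀ y ∈ K ∩ {x | G.dist o x ≤ k},
      G.ReachIn (K ∩ {x | G.dist o x ≤ R}) x y := by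
    rw [eventually_all_finite hQ]
    intro x hx
    rw [eventually_all_finite hQ]
    intro y hy
    obtain ⟨F, hF, hr⟩ := (hK.conn x hx.1 y hy.1).exists_finset
    filter_upwards [eventually_ge_atTop (F.sup (G.dist o))] with R hR
    exact hr.mono fun z hz => ⟨hF hz, (Finset.le_sup (f := G.dist o) hz).trans hR⟩
  filter_upwards [this] with R hR x hx y hy hxR hyR
  obtain ⟨u, hu, huk, hxu⟩ := hK.exists_descent hG hx hxR
  obtain ⟨w, hw, hwk, hyw⟩ := hK.exists_descent hG hy hyR
  exact (hxu.trans (hR u ⟨hu, huk⟩ w ⟨hw, hwk⟩)).trans hyw.symm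

/-- The point is to choose `v` so that the extra vertex `w` of `CycleOn.extend` stays in the hull.
As long as some vertex of `K` up to level `R - 1` is missing, a walk inside that ball leaves `D` at
a suitable `v`, whose neighbours have level at most `R`. After that, `v` is a missing vertex of
least level. -/
theorem exists_extension (hG : G.Connected) (hclaw : G.ClawProp) (hK : Region G o K k) {R : ℕ}
    (hkR : k < R) (hR : 2 ≤ R)
    (hconn : ∀ x ∈ K, ∀ y ∈ K, G.dist o x ≤ R - 1 → G.dist o y ≤ R - 1 →
      G.ReachIn (K ∩ {x | G.dist o x ≤ R - 1}) x y)
    {D : Multiset V} (hD : CycleOn G D) (nd : D.Nodup) (hDK : ∀ x ∈ D, x ∈ K)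
    (hDR : ∀ x ∈ D, x ∈ G.hull o R) {c : V} (hc : c ∈ D) (hcR : G.dist o c ≤ R - 1)
    {t : V} (ht : t ∉ D) (htK : t ∈ K) (htR : t ∈ G.hull o R) :
    ∃ D', CycleOn G D' ∧ D'.Nodup ∧ D ≤ D' ∧ (∀ x ∈ D', x ∈ K ∧ x ∈ G.hull o R) ∧
      ∃ v ∈ D', v ∉ D ∧ v ∈ K ∧ v ∈ G.hull o R := by
  suffices ∃ u v, u ∈ D ∧ v ∉ D ∧ v ∈ K ∧ v ∈ G.hull o R ∧ G.Adj u v ∧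
      ∀ b ∈ D, ∀ w ∈ K, G.Adj u b → ¬ G.Adj v b → G.Adj v w → G.Adj b w → w ∈ G.hull o R by
    obtain ⟨u, v, hu, hv, hvK, hvR, huv, hU⟩ := this
    obtain ⟨D', h₁, h₂, h₃, h₄, h₅⟩ := hD.extend hclaw hK.paw nd hDK hu hv hvK huv hU
    refine ⟨D', h₁, h₂, h₄, fun x hx => ?_, v, h₃, hv, hvK, hvR⟩
    rcases h₅ x hx with h | rfl | h
    · exact ⟨hDK x h, hDR x h⟩
    · exact ⟨hvK, hvR⟩
    · exact ⟨h.2, h.1⟩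
  by_cases hall : ∀ x ∈ K, G.dist o x ≤ R - 1 → x ∈ D
  · obtain ⟨v, ⟨hv, hvK, hvR⟩, hmin⟩ := WellFounded.has_min (measure (G.dist o)).wf
      {v | v ∉ D ∧ v ∈ K ∧ v ∈ G.hull o R} ⟨t, ht, htK, htR⟩
    have hvd : R ≤ G.dist o v := by
      by_contra! h
      exact hv (hall v hvK (by omega))
    obtain ⟨u, huv, hd⟩ := hG.exists_lower (o := o) (v := v) (by omega)
    have huK := hK.lower v hvK (by omega) u huv hd
    have huD : u ∈ D := by
      by_contra hu
      have huR : u ∈ G.hull o R := by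
        by_cases h : G.dist o u ≤ R
        · exact mem_hull_of_dist_le h
        · exact (mem_hull_iff_of_adj huv (by omega) (by omega)).2 hvR
      exact hmin u ⟨hu, huK, huR⟩ (show G.dist o u < G.dist o v by omega)
    refine ⟨u, v, huD, hv, hvK, hvR, huv, fun b hb w hw hub hvb hvw hbw => ?_⟩
    by_cases hwR : G.dist o w ≤ R
    · exact mem_hull_of_dist_le hwR
    by_cases hvR' : R < G.dist o v
    · exact (mem_hull_iff_of_adj hvw hvR' (by omega)).1 hvR
    -- Now `v` is at level `R` and `w` beyond it, so `b` is at level `R` as well. With a neighbour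
    -- `y` of `u` at level `R - 2`, there being no claw at `u` would make `v` and `b` adjacent.
    have h₁ := hG.dist_le_succ (o := o) hbw
    have h₂ := hG.dist_le_succ (o := o) hub
    obtain ⟨y, hyu, hd'⟩ := hG.exists_lower (o := o) (v := u) (by omega)
    have ne : ∀ {z}, G.dist o z = R → y ≠ z := by rintro z hz rfl; omega
    rcases hclaw hyu.symm huv hub (ne (by omega)) (ne (by omega)) (fun h => hv (h ▸ hb))
      with h | h | h
    · exact absurd h (not_adj_of_dist hG (o := o) (by omega))
    · exact absurd h (not_adj_of_dist hG (o := o) (by omega))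
    · exact absurd h hvb
  · push Not at hall
    obtain ⟨x, hx, hxR, hxD⟩ := hall
    obtain ⟨u, v, huv, hu, hv, hvK, -⟩ :=
      (hconn c (hDK c hc) x hx hcR hxR).exists_exit (L := {x | x ∈ D}) hc hxD
    have hvd : G.dist o v ≤ R - 1 := hvK.2
    refine ⟨u, v, hu, hv, hvK.1, mem_hull_of_dist_le (by omega), huv,
      fun b _ w _ _ _ hvw _ => mem_hull_of_dist_le ?_⟩
    have := hG.dist_le_succ (o := o) hvw
    omega

theorem exists_cycleOn_hull [G.LocallyFinite] (hG : G.Connected) (hclaw : G.ClawProp)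
    (hK : Region G o K k) {R : ℕ} (hkR : k < R) (hR : 2 ≤ R)
    (hconn : ∀ x ∈ K, ∀ y ∈ K, G.dist o x ≤ R - 1 → G.dist o y ≤ R - 1 →
      G.ReachIn (K ∩ {x | G.dist o x ≤ R - 1}) x y)
    {D : Multiset V} (hD : CycleOn G D) (nd : D.Nodup) (hDK : ∀ x ∈ D, x ∈ K)
    (hDR : ∀ x ∈ D, x ∈ G.hull o R) {c : V} (hc : c ∈ D) (hcR : G.dist o c ≤ R - 1) :
    ∃ D, CycleOn G D ∧ D.Nodup ∧ ∀ x, x ∈ D ↔ x ∈ K ∧ x ∈ G.hull o R := by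
  have hfin := hG.finite_hull (o := o) R
  induction hn : (G.hull o R \ {x | x ∈ D}).ncard using Nat.strong_induction_on
    generalizing D with
  | _ n ih =>
    subst hn
    by_cases hall : ∀ t, t ∈ K → t ∈ G.hull o R → t ∈ D
    · exact ⟨D, hD, nd, fun x => ⟨fun h => ⟨hDK x h, hDR x h⟩, fun h => hall x h.1 h.2⟩⟩
    push Not at hall
    obtain ⟨t, htK, htR, ht⟩ := hall
    obtain ⟨D', h₁, h₂, h₃, h₄, v, hv, hv', hvK, hvR⟩ :=
      hK.exists_extension hG hclaw hkR hR hconn hD nd hDK hDR hc hcR ht htK htR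
    refine ih _ ?_ h₁ h₂ (fun x hx => (h₄ x hx).1) (fun x hx => (h₄ x hx).2)
      (Multiset.mem_of_le h₃ hc) rfl
    refine Set.ncard_lt_ncard ?_ (hfin.subset Set.sdiff_subset)
    refine ⟨fun x hx => ⟨hx.1, fun h => hx.2 (Multiset.mem_of_le h₃ h)⟩, fun h => ?_⟩
    exact (h (⟨hvR, hv'⟩ : v ∈ G.hull o R \ {x | x ∈ D})).2 hv

theorem eventually_exists_cycleOn_hull [G.LocallyFinite] (hG : G.Connected)
    (hclaw : G.ClawProp) (hK : Region G o K k)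
    (hcyc : ∃ D : Multiset V, CycleOn G D ∧ D.Nodup ∧ ∀ v ∈ D, v ∈ K) :
    ∀ᶠ R in atTop, ∃ D, CycleOn G D ∧ D.Nodup ∧ ∀ x, x ∈ D ↔ x ∈ K ∧ x ∈ G.hull o R := by
  classical
  obtain ⟨D, hD, nd, hDK⟩ := hcyc
  have hc := (tendsto_sub_atTop_nat 1).eventually (hK.eventually_conn hG)
  filter_upwards [hc, eventually_gt_atTop k, eventually_ge_atTop 2,
    eventually_gt_atTop (D.toFinset.sup (G.dist o))] with R hR hkR h2 hDR
  have hb : ∀ x ∈ D, G.dist o x ≤ R - 1 := fun x hx => by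
    have := Finset.le_sup (f := G.dist o) (Multiset.mem_toFinset.2 hx)
    omega
  obtain ⟨a, b, p, -, -⟩ := id hD
  exact hK.exists_cycleOn_hull hG hclaw hkR h2 hR hD nd hDK
    (fun x hx => mem_hull_of_dist_le ((hb x hx).trans (Nat.sub_le _ _))) p.left_mem
    (hb a p.left_mem)

end Region

theorem exists_cycleOn (h : G.IsKConnected 2) :
    ∃ D : Multiset V, CycleOn G D ∧ D.Nodup ∧ ∀ v ∈ D, v ∈ Set.univ := by
  obtain ⟨x⟩ := h.connected.nonempty
  obtain ⟨y, z, hy, hz, hyz⟩ := h.exists_two_neighbors x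
  exact exists_cycleOn_of_reachIn trivial hy hz hyz
    ((h.reachIn_compl hy.ne' hz.ne').mono fun w hw => ⟨trivial, hw⟩)

/-- The component is infinite, so it has a vertex `x` beyond a ball in which its trace is connected.
By 2-connectedness two neighbours of `x` have walks to `o` avoiding `x`; these reach the bottom
level of the component before leaving it, and are joined there inside the ball, away from `x`. -/
theorem exists_cycleOn_outer [G.LocallyFinite] (h : G.IsKConnected 2) (hclaw : G.ClawProp)
    (hpaw : G.PawPropOn Set.univ) {r : ℕ} (hr : 1 ≤ r) {v : V} (hv : v ∉ G.hull o r) :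
    ∃ D : Multiset V, CycleOn G D ∧ D.Nodup ∧ ∀ x ∈ D, x ∈ G.outer o r v := by
  have hG := h.connected
  have hK := region_outer hG hclaw hpaw hr hv
  obtain ⟨ρ, hρ, hρr⟩ := ((hK.eventually_conn hG).and (eventually_gt_atTop (r + 1))).exists
  obtain ⟨x, hxK, hx⟩ : ∃ x ∈ G.outer o r v, ρ < G.dist o x := by
    by_contra! hno
    exact hv ((hG.finite_ball o ρ).subset hno)
  obtain ⟨y, z, hy, hz, hyz⟩ := h.exists_two_neighbors x
  have key : ∀ y, G.Adj x y → ∃ q ∈ G.outer o r v, G.dist o q ≤ ρ ∧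
      G.ReachIn (G.outer o r v \ {x}) y q := by
    intro y hy
    have hd := hG.dist_le_succ (o := o) hy.symm
    have hyK : y ∈ G.outer o r v := mem_outer_of_adj hxK hy (by omega)
    have hox : o ≠ x := by rintro rfl; simp at hx
    have hoK : o ∉ G.outer o r v := fun h => by
      have := lt_dist_of_mem_outer h
      simp at this
    obtain ⟨q, w, hqw, hq, hw, -, hr⟩ := (h.reachIn_compl hy.ne' hox).exists_exit hyK hoK
    refine ⟨q, hq, ?_, hr.mono fun t ht => ⟨ht.2, ht.1⟩⟩
    have h₁ : G.dist o w ≤ r := by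
      by_contra! h
      exact hw (mem_outer_of_adj hq hqw h)
    have := hG.dist_le_succ (o := o) hqw.symm
    omega
  obtain ⟨p, hp, hpd, hyp⟩ := key y hy
  obtain ⟨q, hq, hqd, hzq⟩ := key z hz
  refine exists_cycleOn_of_reachIn hxK hy hz hyz ((hyp.trans ?_).trans hzq.symm)
  refine (hρ p hp q hq hpd hqd).mono fun t ht => ⟨ht.1, ?_⟩
  rintro rfl
  have : G.dist o t ≤ ρ := ht.2
  omega

end SimpleGraph

/-! ### Nested Hamilton cycles with at most two crossings into each component -/

namespace SimpleGraph

open Filter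

variable {V : Type*} {G : SimpleGraph V} {o : V}

/-! ### Growing a Hamilton cycle of a hull -/

section Outer

variable {r R : ℕ} {v : V}

theorem notMem_hull_of_mem_outer (hv : v ∉ G.hull o r) {x : V} (hx : x ∈ G.outer o r v) :
    x ∉ G.hull o r := fun h => hv ((mem_hull_iff_of_mem_outer hx).1 h)

theorem mem_hull_of_adj_outer {x y : V} (hx : x ∈ G.outer o r v) (hy : y ∉ G.outer o r v)
    (h : G.Adj x y) : y ∈ G.hull o r :=
  mem_hull_of_dist_le (by
    by_contra! h'
    exact hy (mem_outer_of_adj hx h h'))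

theorem mem_outer_of_common_neighbor (hG : G.Connected) (hclaw : G.ClawProp) (hr : 1 ≤ r)
    (hv : v ∉ G.hull o r) {s d x : V} (hs : s ∈ G.hull o r) (hd : d ∈ G.outer o r v)
    (hx : x ∉ G.hull o r) (hsd : G.Adj s d) (hsx : G.Adj s x) : x ∈ G.outer o r v := by
  by_cases h : d = x
  · exact h ▸ hd
  · exact mem_outer_of_adj hd (adj_of_mem_hull hG hclaw hr hs (notMem_hull_of_mem_outer hv hd) hx
      hsd hsx h) (lt_dist_of_notMem_hull hx)

theorem mem_hull_add_one_of_adj (hG : G.Connected) {x y : V} (hx : x ∈ G.hull o r)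
    (h : G.Adj x y) : y ∈ G.hull o (r + 1) := by
  by_cases hy : y ∈ G.hull o r
  · exact hull_mono (Nat.le_succ r) hy
  · exact mem_hull_of_dist_le (dist_eq_of_mem_hull_of_adj hG hx hy h).2.le

theorem exists_outer_boundary (hG : G.Connected) (hv : v ∉ G.hull o r) :
    ∃ s d, s ∈ G.hull o r ∧ d ∈ G.outer o r v ∧ G.dist o d = r + 1 ∧ G.Adj s d := by
  obtain ⟨d, hd, hdd⟩ := hG.exists_mem_outer_dist_eq (lt_dist_of_notMem_hull hv)
  obtain ⟨s, hs, hsd⟩ := hG.exists_lower (o := o) (v := d) (by omega)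
  exact ⟨s, d, mem_hull_of_dist_le (by omega), hd, hdd, hs⟩

/-- A vertex at level `r + 2` has no neighbour outside its component. It guarantees that the cycle
in the component has a vertex not adjacent to the inner cycle, as merging requires. -/
theorem exists_outer_interior [G.LocallyFinite] (hG : G.Connected) (hv : v ∉ G.hull o r) :
    ∃ z ∈ G.outer o r v, G.dist o z = r + 2 := by
  obtain ⟨x, hx, hd⟩ : ∃ x ∈ G.outer o r v, r + 1 < G.dist o x := by
    by_contra! hno
    exact hv ((hG.finite_ball o (r + 1)).subset hno)
  obtain ⟨z, hz, hzd⟩ := hG.exists_mem_outer_dist_eq hd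
  exact ⟨z, hx.trans (hz.mono fun u (hu : r + 1 < _) => show r < _ by omega), hzd⟩

end Outer

/-- A subgraph `A` of `G` with a Hamilton cycle of the hull of radius `r`, such that all edges of
`G` that are missing in `A` meet a set `P` deep inside that hull. -/
structure Stage (G : SimpleGraph V) (o : V) (r : ℕ) (A : SimpleGraph V) (P : Set V)
    (C : Multiset V) : Prop where
  one_le : 1 ≤ r
  le : A ≤ G
  cyc : CycleOn A C
  nodup : C.Nodup
  mem : ∀ x, x ∈ C ↔ x ∈ G.hull o r
  removed : ∀ ⦃x y⦄, G.Adj x y → ¬ A.Adj x y → x ∈ P ∨ y ∈ P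
  inner : ∀ ⦃x⦄, x ∈ P → x ∈ G.hull o r
  inner₁ : ∀ ⦃x y⦄, x ∈ P → G.Adj x y → y ∈ G.hull o r
  inner₂ : ∀ ⦃x y z⦄, x ∈ P → G.Adj x y → G.Adj y z → z ∈ G.hull o r

/-- At most two edges of `A` join `K` to its complement. -/
def FewCrossings (A : SimpleGraph V) (K : Set V) : Prop :=
  ∃ e f : Sym2 V, ∀ x ∈ K, ∀ y ∉ K, A.Adj x y → s(x, y) = e ∨ s(x, y) = f

theorem FewCrossings.mono {A A' : SimpleGraph V} {K : Set V} (h : FewCrossings A K)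
    (hA : A' ≤ A) : FewCrossings A' K := by
  obtain ⟨e, f, h⟩ := h
  exact ⟨e, f, fun x hx y hy hxy => h x hx y hy (hA hxy)⟩

/-- Delete from `A` all edges that leave `K`, except `e` and `f`. -/
def thin (A : SimpleGraph V) (K : Set V) (e f : Sym2 V) : SimpleGraph V where
  Adj x y := A.Adj x y ∧ ((x ∈ K ↔ y ∈ K) ∨ s(x, y) = e ∨ s(x, y) = f)
  symm := ⟨fun x y h => ⟨h.1.symm, by rw [Sym2.eq_swap, iff_comm]; exact h.2⟩⟩
  loopless := ⟨fun x h => A.loopless.irrefl x h.1⟩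

theorem thin_le (A : SimpleGraph V) (K : Set V) (e f : Sym2 V) : thin A K e f ≤ A :=
  fun _ _ h => h.1

theorem fewCrossings_thin (A : SimpleGraph V) (K : Set V) (e f : Sym2 V) :
    FewCrossings (thin A K e f) K := by
  refine ⟨e, f, fun x hx y hy h => ?_⟩
  rcases h.2 with h | h
  · exact absurd (h.1 hx) hy
  · exact h

/-- The intermediate state when the components in `s` have been merged. -/
structure Partial (G : SimpleGraph V) (o : V) (r R : ℕ) (A A' : SimpleGraph V) (P : Set V)
    (s : Set (Set V)) (C : Multiset V) : Prop where
  le : A' ≤ A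
  cyc : CycleOn A' C
  nodup : C.Nodup
  mem : ∀ x, x ∈ C ↔ x ∈ G.hull o r ∨ ∃ K ∈ s, x ∈ K ∧ x ∈ G.hull o R
  removed : ∀ ⦃x y⦄, G.Adj x y → ¬ A'.Adj x y → (x ∈ P ∨ y ∈ P) ∨
    (x ∈ G.hull o r ∧ ∃ K ∈ s, y ∈ K) ∨ (y ∈ G.hull o r ∧ ∃ K ∈ s, x ∈ K)
  few : ∀ K ∈ s, FewCrossings A' K

/-- All vertices near the interface on the inner side lie in the hull of radius `r` but not in `P`,
since two steps from `P` stay inside that hull. A missing edge meets `P` or enters a component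
already merged, so none is missing at the interface. The margin `r + 2 ≤ R` puts all neighbours of
interface vertices of `D` into `C` or `D`. -/
theorem Partial.interface {r R : ℕ} {A A' : SimpleGraph V} {P : Set V} {s : Set (Set V)}
    {C₀ C D : Multiset V} {v : V} (hG : G.Connected) (hclaw : G.ClawProp)
    (hpaw : G.PawPropOn Set.univ) (hA : Stage G o r A P C₀) (hrR : r + 2 ≤ R)
    (hA' : Partial G o r R A A' P s C) (hs : ∀ K ∈ s, ∃ u, u ∉ G.hull o r ∧ K = G.outer o r u)
    (hv : v ∉ G.hull o r) (hvs : G.outer o r v ∉ s) (nd : D.Nodup)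
    (hD : ∀ x, x ∈ D ↔ x ∈ G.outer o r v ∧ x ∈ G.hull o R) :
    Interface G A' C D {a | a ∈ C ∧ ((∃ d ∈ D, G.Adj a d) ∨
      ∃ c ∈ C, G.Adj c a ∧ ∃ d ∈ D, G.Adj c d)} := by
  have disj : ∀ K ∈ s, ∀ x ∈ K, x ∉ G.outer o r v := by
    intro K hK x hx hxv
    obtain ⟨u, hu, rfl⟩ := hs K hK
    exact hvs (by rwa [← outer_eq hxv, outer_eq hx])
  have hCK : ∀ {x}, x ∈ C → x ∉ G.outer o r v := by
    intro x hx hxv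
    rcases (hA'.mem x).1 hx with h | ⟨K, hK, hxK, -⟩
    · exact notMem_hull_of_mem_outer hv hxv h
    · exact disj K hK x hxK hxv
  have hin : ∀ {c d}, c ∈ C → d ∈ D → G.Adj c d → c ∈ G.hull o r := fun hc hd h =>
    mem_hull_of_adj_outer ((hD _).1 hd).1 (hCK hc) h.symm
  have hout : ∀ {d}, d ∈ D → d ∉ G.hull o r := fun hd =>
    notMem_hull_of_mem_outer hv ((hD _).1 hd).1
  have hT : ∀ {a}, (a ∈ C ∧ ((∃ d ∈ D, G.Adj a d) ∨ ∃ c ∈ C, G.Adj c a ∧ ∃ d ∈ D, G.Adj c d)) →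
      a ∉ P ∧ a ∈ G.hull o r := by
    rintro a ⟨ha, ⟨d, hd, had⟩ | ⟨c, hc, hca, d, hd, hcd⟩⟩
    · exact ⟨fun h => hout hd (hA.inner₁ h had), hin ha hd had⟩
    · refine ⟨fun h => hout hd (hA.inner₂ h hca.symm hcd), ?_⟩
      by_contra ha'
      exact hCK ha (mem_outer_of_common_neighbor hG hclaw hA.one_le hv (hin hc hd hcd)
        ((hD _).1 hd).1 ha' hcd hca)
  have hsX : ∀ {x}, x ∈ G.hull o r → ¬ ∃ K ∈ s, x ∈ K := by
    rintro x hx ⟨K, hK, hxK⟩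
    obtain ⟨u, hu, rfl⟩ := hs K hK
    exact notMem_hull_of_mem_outer hu hxK hx
  refine ⟨hA'.le.trans hA.le, hclaw, hpaw, hA'.nodup, nd, ?_, ?_, ?_, ?_, ?_, ?_, ?_, ?_⟩
  · exact fun x hx hx' => hCK hx ((hD _).1 hx').1
  · intro a b ha hb hab
    by_contra hno
    rcases hA'.removed hab hno with (h | h) | ⟨-, h⟩ | ⟨-, h⟩
    · exact (hT ha).1 h
    · exact (hT hb).1 h
    · exact hsX (hT hb).2 h
    · exact hsX (hT ha).2 h
  · intro a b ha hb hab
    by_contra hno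
    rcases hA'.removed hab hno with (h | h) | ⟨h, -⟩ | ⟨h, -⟩
    · exact hout ha (hA.inner h)
    · exact hout hb (hA.inner h)
    · exact hout ha h
    · exact hout hb h
  · exact fun c d hc hd h => ⟨hc, .inl ⟨d, hd, h⟩⟩
  · exact fun c d c' hc hd h hc' h' => ⟨hc', .inr ⟨c, hc, h', d, hd, h⟩⟩
  · exact fun c d d' hc hd hd' h h' hne =>
      adj_of_mem_hull hG hclaw hA.one_le (hin hc hd h) (hout hd) (hout hd') h h' hne
  · intro c d x hc hd hcd hcx
    by_cases hx : x ∈ G.hull o r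
    · exact .inl ((hA'.mem x).2 (.inl hx))
    · refine .inr ((hD x).2 ⟨mem_outer_of_common_neighbor hG hclaw hA.one_le hv (hin hc hd hcd)
        ((hD _).1 hd).1 hx hcd hcx, ?_⟩)
      exact hull_mono (by omega) (mem_hull_add_one_of_adj hG (hin hc hd hcd) hcx)
  · intro c d x hc hd hcd hdx
    by_cases hx : x ∈ G.outer o r v
    · refine .inr ((hD x).2 ⟨hx, hull_mono hrR ?_⟩)
      exact mem_hull_add_one_of_adj hG (mem_hull_add_one_of_adj hG (hin hc hd hcd) hcd) hdx
    · exact .inl ((hA'.mem x).2 (.inl (mem_hull_of_adj_outer ((hD _).1 hd).1 hx hdx)))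

theorem Partial.insert [G.LocallyFinite] {r R : ℕ} {A A' : SimpleGraph V} {P : Set V}
    {s : Set (Set V)} {C₀ C D : Multiset V} {v : V} (hG : G.Connected) (hclaw : G.ClawProp)
    (hpaw : G.PawPropOn Set.univ) (hA : Stage G o r A P C₀) (hrR : r + 2 ≤ R)
    (hA' : Partial G o r R A A' P s C) (hs : ∀ K ∈ s, ∃ u, u ∉ G.hull o r ∧ K = G.outer o r u)
    (hv : v ∉ G.hull o r) (hvs : G.outer o r v ∉ s) (nd : D.Nodup)
    (hD : ∀ x, x ∈ D ↔ x ∈ G.outer o r v ∧ x ∈ G.hull o R) (hDc : CycleOn G D) :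
    ∃ A'' C', Partial G o r R A A'' P (insert (G.outer o r v) s) C' := by
  have I := hA'.interface hG hclaw hpaw hA hrR hs hv hvs nd hD
  have hDc' : CycleOn A' D := hDc.mono_on fun x hx y hy h => I.adjD hx hy h
  obtain ⟨s₀, d₀, hs₀, hd₀, hdd₀, hsd₀⟩ := exists_outer_boundary hG hv
  obtain ⟨z₀, hz₀, hzd₀⟩ := exists_outer_interior hG hv
  have hCK : ∀ {x}, x ∈ C → x ∉ G.outer o r v := by
    intro x hx hxv
    rcases (hA'.mem x).1 hx with h | ⟨K, hK, hxK, -⟩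
    · exact notMem_hull_of_mem_outer hv hxv h
    · obtain ⟨u, hu, rfl⟩ := hs K hK
      exact hvs (by rwa [← outer_eq hxv, outer_eq hxK])
  have hDK : ∀ {x}, x ∈ D → x ∈ G.outer o r v := fun hx => ((hD _).1 hx).1
  have hz₀D : z₀ ∈ D := (hD _).2 ⟨hz₀, mem_hull_of_dist_le (by omega)⟩
  have hz₀' : ¬ ∃ c ∈ C, G.Adj c z₀ := by
    rintro ⟨c, hc, hcz⟩
    have := hG.dist_le_succ (o := o) hcz
    exact hCK hc (mem_outer_of_adj hz₀ hcz.symm (by omega))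
  obtain ⟨a₁, b₁, hp, hab, -⟩ := id hDc'
  -- The cycle through `D` contains `d₀`, which has a neighbour in `C`, and `z₀`, which has none;
  -- between them it has consecutive `q` and `z` of these two kinds.
  obtain ⟨q, z, hqz, hadj, ⟨c, hc, hcq⟩, hz⟩ :=
    hp.exists_boundary hab (Q := fun d => ∃ c ∈ C, G.Adj c d)
      ((hD _).2 ⟨hd₀, mem_hull_of_dist_le (by omega)⟩) ⟨s₀, (hA'.mem _).2 (.inl hs₀), hsd₀⟩
      hz₀D hz₀'
  obtain ⟨a, b, c', d', pC, pD, hac, hbd⟩ := I.mergeable hA'.cyc hDc' hc hcq hadj hqz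
    fun c hc h => hz ⟨c, hc, h⟩
  have hle := thin_le A' (G.outer o r v) s(a, c') s(b, d')
  have hcross : ∀ {x y}, x ∈ C → y ∈ D → G.Adj x y → A'.Adj x y := by
    intro x y hx hy hxy
    have hyK := hDK hy
    by_contra hno
    rcases hA'.removed hxy hno with (h | h) | ⟨-, K, hK, h⟩ | ⟨h, -⟩
    · exact notMem_hull_of_mem_outer hv hyK (hA.inner₁ h hxy)
    · exact notMem_hull_of_mem_outer hv hyK (hA.inner h)
    · obtain ⟨u, hu, rfl⟩ := hs K hK
      exact hvs (by rwa [← outer_eq hyK, outer_eq h])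
    · exact notMem_hull_of_mem_outer hv hyK h
  -- Only the two merging edges survive among the edges leaving the new component.
  refine ⟨thin A' (G.outer o r v) s(a, c') s(b, d'), C + D, hle.trans hA'.le, ?_, ?_, ?_, ?_, ?_⟩
  · refine ⟨a, c', (pC.mono_on ?_).append (pD.symm.mono_on ?_) ?_, ?_, ?_⟩
    · exact fun x hx y hy h => ⟨h, .inl (by simp [hCK hx, hCK hy])⟩
    · exact fun x hx y hy h => ⟨h, .inl (by simp [hDK hx, hDK hy])⟩
    · exact ⟨hcross pC.right_mem pD.right_mem hbd, .inr (.inr rfl)⟩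
    · exact ⟨hcross pC.left_mem pD.left_mem hac, .inr (.inl rfl)⟩
    · obtain ⟨_, _, -, -, h⟩ := hA'.cyc
      rw [Multiset.card_add]; omega
  · exact Multiset.nodup_add.2 ⟨hA'.nodup, nd, Multiset.disjoint_left.2 fun hx => I.disj hx⟩
  · intro x
    rw [Multiset.mem_add, hA'.mem, hD]
    simp only [Set.mem_insert_iff, exists_eq_or_imp]
    rw [or_assoc]
    exact or_congr Iff.rfl or_comm
  · intro x y hxy hno
    by_cases h : A'.Adj x y
    · have h' : ¬ (x ∈ G.outer o r v ↔ y ∈ G.outer o r v) := fun h' => hno ⟨h, .inl h'⟩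
      by_cases hx : x ∈ G.outer o r v
      · have hy : y ∉ G.outer o r v := by tauto
        exact .inr (.inr ⟨mem_hull_of_adj_outer hx hy hxy, _, Set.mem_insert _ _, hx⟩)
      · have hy : y ∈ G.outer o r v := by tauto
        exact .inr (.inl ⟨mem_hull_of_adj_outer hy hx hxy.symm, _, Set.mem_insert _ _, hy⟩)
    · rcases hA'.removed hxy h with h | ⟨h, K, hK, h'⟩ | ⟨h, K, hK, h'⟩
      · exact .inl h
      · exact .inr (.inl ⟨h, K, Set.mem_insert_of_mem _ hK, h'⟩)
      · exact .inr (.inr ⟨h, K, Set.mem_insert_of_mem _ hK, h'⟩)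
  · rintro K (rfl | hK)
    · exact fewCrossings_thin _ _ _ _
    · exact (hA'.few K hK).mono hle

theorem Connected.finite_outers [G.LocallyFinite] (hG : G.Connected) (r : ℕ) :
    {K | ∃ u, u ∉ G.hull o r ∧ K = G.outer o r u}.Finite := by
  refine ((hG.finite_ball o (r + 1)).image (G.outer o r)).subset ?_
  rintro K ⟨u, hu, rfl⟩
  obtain ⟨d, hd, hdd⟩ := hG.exists_mem_outer_dist_eq (lt_dist_of_notMem_hull hu)
  exact ⟨d, hdd.le, outer_eq hd⟩

/-- Only finitely many components lie outside the hull, so a single `R` serves all of them and they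
are merged one at a time. Every edge deleted so far meets the old hull, which becomes the new `P`.
-/
theorem Stage.exists_next [G.LocallyFinite] {r : ℕ} {A : SimpleGraph V} {P : Set V}
    {C : Multiset V} (h2 : G.IsKConnected 2) (hclaw : G.ClawProp)
    (hpaw : G.PawPropOn Set.univ) (hA : Stage G o r A P C) :
    ∃ R A' C', r < R ∧ Stage G o R A' (G.hull o r) C' ∧ A' ≤ A ∧
      ∀ v, v ∉ G.hull o r → FewCrossings A' (G.outer o r v) := by
  have hG := h2.connected
  have hfin := hG.finite_outers (o := o) r
  have hev : ∀ᶠ R in atTop, ∀ K ∈ {K | ∃ u, u ∉ G.hull o r ∧ K = G.outer o r u},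
      ∃ D, CycleOn G D ∧ D.Nodup ∧ ∀ x, x ∈ D ↔ x ∈ K ∧ x ∈ G.hull o R := by
    rw [eventually_all_finite hfin]
    rintro K ⟨u, hu, rfl⟩
    exact (region_outer hG hclaw hpaw hA.one_le hu).eventually_exists_cycleOn_hull hG hclaw
      (exists_cycleOn_outer h2 hclaw hpaw hA.one_le hu)
  obtain ⟨R, hR, hrR⟩ := (hev.and (eventually_ge_atTop (r + 2))).exists
  obtain ⟨A', C', h'⟩ : ∃ A' C', Partial G o r R A A' P
      {K | ∃ u, u ∉ G.hull o r ∧ K = G.outer o r u} C' := by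
    refine Set.Finite.induction_on_subset
      (motive := fun s _ => ∃ A' C', Partial G o r R A A' P s C') _ hfin ?_ ?_
    · refine ⟨A, C, le_rfl, hA.cyc, hA.nodup, ?_, fun x y h h' => .inl (hA.removed h h'), ?_⟩
      · simpa using hA.mem
      · simp
    · rintro K s ⟨v, hv, rfl⟩ hs hKs ⟨A', C', h'⟩
      obtain ⟨D, hDc, nd, hD⟩ := hR _ ⟨v, hv, rfl⟩
      exact h'.insert hG hclaw hpaw hA hrR (fun K hK => hs hK) hv hKs nd hD hDc
  refine ⟨R, A', C', by omega, ⟨by omega, h'.le.trans hA.le, h'.cyc, h'.nodup, ?_, ?_, ?_, ?_, ?_⟩,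
    h'.le, fun v hv => h'.few _ ⟨v, hv, rfl⟩⟩
  · intro x
    rw [h'.mem]
    constructor
    · rintro (h | ⟨K, -, -, h⟩)
      · exact hull_mono (by omega) h
      · exact h
    · intro h
      by_cases hx : x ∈ G.hull o r
      · exact .inl hx
      · exact .inr ⟨_, ⟨x, hx, rfl⟩, mem_outer_self (lt_dist_of_notMem_hull hx), h⟩
  · intro x y hxy hno
    rcases h'.removed hxy hno with (h | h) | ⟨h, -⟩ | ⟨h, -⟩
    · exact .inl (hA.inner h)
    · exact .inr (hA.inner h)
    · exact .inl h
    · exact .inr h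
  · exact fun x hx => hull_mono (by omega) hx
  · exact fun x y hx h => hull_mono (by omega) (mem_hull_add_one_of_adj hG hx h)
  · exact fun x y z hx h h' => hull_mono hrR
      (mem_hull_add_one_of_adj hG (mem_hull_add_one_of_adj hG hx h) h')

theorem exists_stage [G.LocallyFinite] (h2 : G.IsKConnected 2) (hclaw : G.ClawProp)
    (hpaw : G.PawPropOn Set.univ) (o : V) : ∃ r C, Stage G o r G ∅ C := by
  have hG := h2.connected
  obtain ⟨r, ⟨D, hD, nd, hmem⟩, hr⟩ := (((region_univ hG hpaw).eventually_exists_cycleOn_hull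
    (o := o) hG hclaw (exists_cycleOn h2)).and (eventually_ge_atTop 1)).exists
  exact ⟨r, D, hr, le_rfl, hD, nd, by simpa using hmem, fun x y h h' => absurd h h',
    by simp, by simp, by simp⟩

/-- An exhausting sequence of hulls with Hamilton cycles in a decreasing sequence of subgraphs, so
that every component outside the `n`-th hull is entered by at most two edges of the later
subgraphs. -/
theorem exists_stage_sequence [G.LocallyFinite] (h2 : G.IsKConnected 2) (hclaw : G.ClawProp)
    (hpaw : G.PawPropOn Set.univ) (o : V) :
    ∃ (r : ℕ → ℕ) (A : ℕ → SimpleGraph V) (C : ℕ → Multiset V), StrictMono r ∧ (∀ n, A n ≤ G) ∧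
      (∀ n, CycleOn (A n) (C n)) ∧ (∀ n, (C n).Nodup) ∧ (∀ n x, x ∈ C n ↔ x ∈ G.hull o (r n)) ∧
      ∀ n m, n < m → ∀ v, v ∉ G.hull o (r n) → FewCrossings (A m) (G.outer o (r n) v) := by
  let S := {q : ℕ × SimpleGraph V × Multiset V // ∃ P, Stage G o q.1 q.2.1 P q.2.2}
  obtain ⟨r₀, C₀, h₀⟩ := exists_stage h2 hclaw hpaw o
  have hnext : ∀ q : S, ∃ q' : S, q.1.1 < q'.1.1 ∧ q'.1.2.1 ≤ q.1.2.1 ∧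
      ∀ v, v ∉ G.hull o q.1.1 → FewCrossings q'.1.2.1 (G.outer o q.1.1 v) := by
    rintro ⟨⟨r, A, C⟩, P, hA⟩
    obtain ⟨R, A', C', h₁, h₂, h₃, h₄⟩ := hA.exists_next h2 hclaw hpaw
    exact ⟨⟨⟨R, A', C'⟩, _, h₂⟩, h₁, h₃, h₄⟩
  choose f hf₁ hf₂ hf₃ using hnext
  let q : ℕ → S := fun n => f^[n] ⟨⟨r₀, G, C₀⟩, ∅, h₀⟩
  have hq : ∀ n, q (n + 1) = f (q n) := fun n => Function.iterate_succ_apply' _ _ _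
  have anti : Antitone fun n => (q n).1.2.1 := antitone_nat_of_succ_le fun n => by
    rw [hq]; exact hf₂ _
  refine ⟨fun n => (q n).1.1, fun n => (q n).1.2.1, fun n => (q n).1.2.2,
    strictMono_nat_of_lt_succ fun n => ?_, fun n => ?_, fun n => ?_, fun n => ?_, fun n => ?_, ?_⟩
  · rw [hq]; exact hf₁ _
  · exact (q n).2.choose_spec.le
  · exact (q n).2.choose_spec.cyc
  · exact (q n).2.choose_spec.nodup
  · exact (q n).2.choose_spec.mem
  · intro n m hnm v hv
    -- The bound is created at stage `n + 1` and persists because the subgraphs decrease.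
    refine FewCrossings.mono ?_ (anti (Nat.succ_le_of_lt hnm))
    simp only [Nat.succ_eq_add_one, hq]
    exact hf₃ _ v hv

end SimpleGraph

/-! ### Linear orders from Hamilton cycles and their ultrafilter limit -/

namespace SimpleGraph

open Filter

variable {V : Type*}

/-! ### Listing a Hamilton cycle -/

/-- An enumeration of `X` along a Hamilton cycle of `A` that starts at `o`. -/
structure Listing (A : SimpleGraph V) (X : Set V) (o : V) where
  /-- The number of vertices. -/
  len : ℕ
  /-- The vertex at a given position. -/
  vert : ℕ → V
  /-- The position of a given vertex. -/
  pos : V → ℕ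
  pos_lt : ∀ x ∈ X, pos x < len
  vert_pos : ∀ x ∈ X, vert (pos x) = x
  vert_mem : ∀ i < len, vert i ∈ X
  pos_vert : ∀ i < len, pos (vert i) = i
  adj : ∀ i, i + 1 < len → A.Adj (vert i) (vert (i + 1))
  start_mem : o ∈ X
  pos_start : pos o = 0
  adj_last : A.Adj (vert (len - 1)) o

theorem CycleOn.listing {A : SimpleGraph V} {C : Multiset V} (h : CycleOn A C) (nd : C.Nodup)
    {o : V} (ho : o ∈ C) : Nonempty (Listing A {x | x ∈ C} o) := by
  classical
  obtain ⟨a, b, p, hab, -⟩ := h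
  obtain ⟨y, hy, hoy⟩ := p.rotate hab ho
  obtain ⟨l, hl, rfl, hhead, hlast⟩ := hy.symm
  have hne : l ≠ [] := by rintro rfl; simp at hhead
  have hlen : 0 < l.length := List.length_pos_iff.2 hne
  have nd' : l.Nodup := nd
  have hg : ∀ i (hi : i < l.length), l.getD i o = l[i] := fun i hi => by
    simp [hi]
  refine ⟨⟨l.length, fun i => l.getD i o, fun x => l.idxOf x, ?_, ?_, ?_, ?_, ?_, ho, ?_, ?_⟩⟩
  · exact fun x hx => List.idxOf_lt_length_of_mem hx
  · intro x hx
    have := List.idxOf_lt_length_of_mem (show x ∈ l from hx)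
    simp only [hg _ this, List.getElem_idxOf]
  · intro i hi
    simp only [hg _ hi]
    exact List.getElem_mem hi
  · intro i hi
    simp only [hg _ hi]
    exact nd'.idxOf_getElem i hi
  · intro i hi
    simp only [hg _ hi, hg i (by omega)]
    exact List.isChain_iff_getElem.1 hl i hi
  · cases l with
    | nil => simp at hhead
    | cons c t =>
      simp at hhead
      simp [hhead]
  · have : l.getD (l.length - 1) o = y := by
      rw [hg _ (by omega), ← List.getLast_eq_getElem hne]
      rw [List.getLast?_eq_some_getLast hne] at hlast
      simpa using hlast
    simp only [this]
    exact hoy.symm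

theorem exists_step {P : ℕ → Prop} {i j : ℕ} (hij : i < j) (h : ¬ (P i ↔ P j)) :
    ∃ k, i ≤ k ∧ k < j ∧ ¬ (P k ↔ P (k + 1)) := by
  by_contra! hno
  apply h
  induction j, hij using Nat.le_induction with
  | base => exact hno i le_rfl (by omega)
  | succ j hj ih =>
    have h₁ : P i ↔ P j := by
      by_contra h'
      exact h' (ih h' fun k hk hkj => hno k hk (by omega))
    exact h₁.trans (hno j (by omega) (by omega))

namespace Listing

variable {A : SimpleGraph V} {X : Set V} {o : V} (L : Listing A X o) {K : Set V}

theorem pos_inj {x y : V} (hx : x ∈ X) (hy : y ∈ X) (h : L.pos x = L.pos y) : x = y := by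
  rw [← L.vert_pos x hx, h, L.vert_pos y hy]

theorem edge_inj {i j : ℕ} (hi : i + 1 < L.len) (hj : j + 1 < L.len)
    (h : s(L.vert i, L.vert (i + 1)) = s(L.vert j, L.vert (j + 1))) : i = j := by
  have inj : ∀ {i j}, i < L.len → j < L.len → L.vert i = L.vert j → i = j := fun hi hj h => by
    rw [← L.pos_vert _ hi, h, L.pos_vert _ hj]
  rcases Sym2.eq_iff.1 h with ⟨h₁, -⟩ | ⟨h₁, h₂⟩
  · exact inj (by omega) (by omega) h₁
  · have e₁ := inj (by omega) hj h₁
    have e₂ := inj hi (by omega) h₂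
    omega

/-- Otherwise `o, x, y, z`, in this order, are alternately outside and inside `K`, and the listing
crosses the boundary of `K` along three different edges. -/
theorem mem_of_pos_lt (hK : FewCrossings A K) (ho : o ∉ K) {x y z : V} (hx : x ∈ X) (hy : y ∈ X)
    (hz : z ∈ X) (hxK : x ∈ K) (hzK : z ∈ K) (hxy : L.pos x < L.pos y) (hyz : L.pos y < L.pos z) :
    y ∈ K := by
  by_contra hyK
  have vo : L.vert 0 = o := by rw [← L.pos_start, L.vert_pos o L.start_mem]
  have hx0 : 0 < L.pos x := by
    rcases Nat.eq_zero_or_pos (L.pos x) with h | h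
    · exact absurd (L.pos_inj hx L.start_mem (h.trans L.pos_start.symm)) fun h => ho (h ▸ hxK)
    · exact h
  have hlen := L.pos_lt z hz
  let P : ℕ → Prop := fun i => L.vert i ∈ K
  have P₀ : ¬ P 0 := by simpa [P, vo] using ho
  have Px : P (L.pos x) := by simpa [P, L.vert_pos x hx] using hxK
  have Py : ¬ P (L.pos y) := by simpa [P, L.vert_pos y hy] using hyK
  have Pz : P (L.pos z) := by simpa [P, L.vert_pos z hz] using hzK
  obtain ⟨i, hi, hi', hPi⟩ := exists_step (P := P) hx0 (by tauto)
  obtain ⟨j, hj, hj', hPj⟩ := exists_step (P := P) hxy (by tauto)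
  obtain ⟨k, hk, hk', hPk⟩ := exists_step (P := P) hyz (by tauto)
  obtain ⟨e, f, hef⟩ := hK
  have key : ∀ i, i + 1 < L.len → ¬ (P i ↔ P (i + 1)) →
      s(L.vert i, L.vert (i + 1)) = e ∨ s(L.vert i, L.vert (i + 1)) = f := by
    intro i hi hP
    by_cases h : P i
    · exact hef _ h _ (by tauto) (L.adj i hi)
    · have := hef _ (by tauto : P (i + 1)) _ h (L.adj i hi).symm
      rwa [Sym2.eq_swap] at this
  have d₁ : s(L.vert i, L.vert (i + 1)) ≠ s(L.vert j, L.vert (j + 1)) := fun h => by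
    have := L.edge_inj (by omega) (by omega) h
    omega
  have d₂ : s(L.vert i, L.vert (i + 1)) ≠ s(L.vert k, L.vert (k + 1)) := fun h => by
    have := L.edge_inj (by omega) (by omega) h
    omega
  have d₃ : s(L.vert j, L.vert (j + 1)) ≠ s(L.vert k, L.vert (k + 1)) := fun h => by
    have := L.edge_inj (by omega) (by omega) h
    omega
  have k₁ := key i (by omega) hPi
  have k₂ := key j (by omega) hPj
  have k₃ := key k (by omega) hPk
  grind

theorem finite (L : Listing A X o) : X.Finite :=
  ((Set.finite_Iio L.len).image L.vert).subset fun x hx => ⟨L.pos x, L.pos_lt x hx, L.vert_pos x hx⟩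

/-- The last vertex of `K` in the listing has a neighbour outside `K`. For the components considered
below only finitely many vertices have this property, which lets the ultrafilter fix one of them. -/
theorem exists_max (ho : o ∉ K) {x : V} (hx : x ∈ X) (hxK : x ∈ K) :
    ∃ z ∈ X, z ∈ K ∧ (∀ y ∈ X, y ∈ K → L.pos y ≤ L.pos z) ∧ ∃ y ∉ K, A.Adj z y := by
  obtain ⟨z, ⟨hz, hzK⟩, hmax⟩ := Set.exists_max_image (X ∩ K) L.pos
    (L.finite.subset Set.inter_subset_left) ⟨x, hx, hxK⟩
  refine ⟨z, hz, hzK, fun y hy hyK => hmax y ⟨hy, hyK⟩, ?_⟩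
  have hlt := L.pos_lt z hz
  by_cases h : L.pos z + 1 < L.len
  · refine ⟨L.vert (L.pos z + 1), fun hK => ?_, ?_⟩
    · have := hmax _ ⟨L.vert_mem _ h, hK⟩
      rw [L.pos_vert _ h] at this
      omega
    · have := L.adj _ h
      rwa [L.vert_pos z hz] at this
  · refine ⟨o, ho, ?_⟩
    have := L.adj_last
    rwa [show L.len - 1 = L.pos z by omega, L.vert_pos z hz] at this

theorem exists_min (ho : o ∉ K) {x : V} (hx : x ∈ X) (hxK : x ∈ K) :
    ∃ z ∈ X, z ∈ K ∧ (∀ y ∈ X, y ∈ K → L.pos z ≤ L.pos y) ∧ ∃ y ∉ K, A.Adj z y := by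
  obtain ⟨z, ⟨hz, hzK⟩, hmin⟩ := Set.exists_min_image (X ∩ K) L.pos
    (L.finite.subset Set.inter_subset_left) ⟨x, hx, hxK⟩
  refine ⟨z, hz, hzK, fun y hy hyK => hmin y ⟨hy, hyK⟩, ?_⟩
  have hlt := L.pos_lt z hz
  have h0 : L.pos z ≠ 0 := fun h =>
    ho (L.pos_inj hz L.start_mem (h.trans L.pos_start.symm) ▸ hzK)
  obtain ⟨i, hi⟩ := Nat.exists_eq_succ_of_ne_zero h0
  refine ⟨L.vert i, fun hK => ?_, ?_⟩
  · have := hmin _ ⟨L.vert_mem i (by omega), hK⟩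
    rw [L.pos_vert i (by omega)] at this
    omega
  · have := L.adj i (by omega)
    rw [← Nat.succ_eq_add_one, ← hi, L.vert_pos z hz] at this
    exact this.symm

end Listing

/-! ### The cyclic order of a Hamilton circle -/

theorem ComponentCompl.reachIn {G : SimpleGraph V} {X : Set V} (C : G.ComponentCompl X) {x y : V}
    (hx : x ∈ C) (hy : y ∈ C) : G.ReachIn Xᶜ x y := by
  obtain ⟨hx', hx⟩ := ComponentCompl.mem_supp_iff.1 hx
  obtain ⟨hy', hy⟩ := ComponentCompl.mem_supp_iff.1 hy
  exact reachIn_of_induce_reachable (ConnectedComponent.exact (hx.trans hy.symm))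

theorem mem_componentCompl_hull_iff {G : SimpleGraph V} {o : V} {r : ℕ} {X : Set V}
    (hX : X = G.hull o r) (C : G.ComponentCompl X) {v : V} (hv : v ∈ C) (x : V) :
    x ∈ C ↔ x ∈ G.outer o r v := by
  subst hX
  constructor
  · intro hx
    exact (C.reachIn hv hx).mono fun u hu => lt_dist_of_notMem_hull hu
  · intro hx
    refine ReachIn.of_closed (L := (C : Set V)) hx hv fun a b ha hb hab => ?_
    have ha' := ComponentCompl.notMem_of_mem ha
    exact ComponentCompl.mem_of_adj a b ha
      (fun h => ha' ((mem_hull_iff_of_adj hab (lt_dist_of_notMem_hull ha') hb).2 h)) hab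

/-- A linear order on the vertices of `G` that describes a Hamilton circle, cut open at the edge
`b o`: consecutive vertices are adjacent, and outside arbitrarily large finite sets all components
are closed intervals. -/
structure IsCircleOrder (G : SimpleGraph V) [LinearOrder V] (o b : V) : Prop where
  bot_le : ∀ v, o ≤ v
  le_top : ∀ v, v ≤ b
  adj : G.Adj b o
  exists_succ : ∀ v, v ≠ b → ∃ w, v ⋖ w ∧ G.Adj v w
  exists_pred : ∀ v, v ≠ o → ∃ w, w ⋖ v
  exists_interval : ∀ S : Finset V, ∃ X : Finset V, S ⊆ X ∧
    ∀ K : G.ComponentCompl (X : Set V), ∃ a c, ∀ x, x ∈ K ↔ a ≤ x ∧ x ≤ c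

/-- Vertices are compared by the germs of their positions along a nonprincipal ultrafilter. A vertex
chosen at each stage from a fixed finite set is constant on a set of the ultrafilter; this applies
to the successor and predecessor of a vertex, to the last vertex, and to the first and last vertex
of a component. -/
theorem exists_isCircleOrder {G : SimpleGraph V} [G.LocallyFinite] (h2 : G.IsKConnected 2)
    (hclaw : G.ClawProp) (hpaw : G.PawPropOn Set.univ) :
    ∃ (_ : LinearOrder V) (o b : V), IsCircleOrder G o b := by
  have hG := h2.connected
  obtain ⟨o⟩ := hG.nonempty
  obtain ⟨r, A, C, hr, hA, hcyc, nd, hmem, hfew⟩ := exists_stage_sequence h2 hclaw hpaw o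
  have ho : ∀ n, o ∈ G.hull o n := fun n => mem_hull_of_dist_le (by simp)
  have hX : ∀ n, {x | x ∈ C n} = G.hull o (r n) := fun n => Set.ext (hmem n)
  have hL : ∀ n, Nonempty (Listing (A n) (G.hull o (r n)) o) := fun n => by
    rw [← hX]
    exact (hcyc n).listing (nd n) ((hmem n o).2 (ho _))
  let L : ∀ n, Listing (A n) (G.hull o (r n)) o := fun n => (hL n).some
  let 𝒰 := hyperfilter ℕ
  have hin : ∀ v, ∀ᶠ n in 𝒰, v ∈ G.hull o (r n) := fun v =>
    (((hr.tendsto_atTop.eventually (eventually_ge_atTop (G.dist o v))).mono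
      fun n hn => mem_hull_of_dist_le hn)).filter_mono Nat.hyperfilter_le_atTop
  have hgt : ∀ n, ∀ᶠ m in 𝒰, n < m := fun n =>
    (eventually_gt_atTop n).filter_mono Nat.hyperfilter_le_atTop
  let g : V → (𝒰 : Filter ℕ).Germ ℕ := fun v => ((fun n => (L n).pos v : ℕ → ℕ) : Germ _ ℕ)
  have hg : Function.Injective g := by
    intro u v huv
    obtain ⟨n, hn, hu, hv⟩ := ((Germ.coe_eq.1 huv).and ((hin u).and (hin v))).exists
    exact (L n).pos_inj hu hv hn
  let inst : LinearOrder V := LinearOrder.lift' g hg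
  have hle : ∀ {u v : V}, u ≤ v ↔ ∀ᶠ n in 𝒰, (L n).pos u ≤ (L n).pos v := Germ.coe_le
  have hlt : ∀ {u v : V}, u < v ↔ ∀ᶠ n in 𝒰, (L n).pos u < (L n).pos v := by
    intro u v
    rw [lt_iff_not_ge, hle, ← Ultrafilter.eventually_not]
    simp
  have hcov : ∀ {u v : V}, (∀ᶠ n in 𝒰, (L n).pos v = (L n).pos u + 1) → u ⋖ v := by
    intro u v h
    refine ⟨hlt.2 (h.mono fun n hn => by omega), fun w hu hv => ?_⟩
    obtain ⟨n, h₁, h₂, h₃⟩ := (h.and ((hlt.1 hu).and (hlt.1 hv))).exists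
    omega
  have hnbr : ∀ v, (G.neighborSet v).Finite := fun v => Set.toFinite _
  -- The last vertex of each listing closes the cycle and is therefore one of the finitely many
  -- neighbours of `o`.
  obtain ⟨b, hb, hb'⟩ : ∃ b ∈ G.neighborSet o, ∀ᶠ n in 𝒰, (L n).vert ((L n).len - 1) = b := by
    rw [← Ultrafilter.eventually_exists_mem_iff (hnbr o)]
    exact Eventually.of_forall fun n => ⟨_, (hA n (L n).adj_last).symm, rfl⟩
  have hbtop : ∀ v, v ≤ b := fun v => hle.2 (by
    filter_upwards [hb', hin v] with n hn hv
    have h₁ := (L n).pos_lt v hv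
    rw [← hn, (L n).pos_vert _ (by omega)]
    omega)
  refine ⟨inst, o, b, fun v => hle.2 (Eventually.of_forall fun n => ?_), hbtop, hb.symm, ?_, ?_, ?_⟩
  · rw [(L n).pos_start]; omega
  · intro v hv
    have hvb := hlt.1 (lt_of_le_of_ne (hbtop v) hv)
    have : ∀ᶠ n in 𝒰, ∃ w ∈ G.neighborSet v, (L n).pos w = (L n).pos v + 1 := by
      filter_upwards [hvb, hin v, hin b] with n h₁ h₂ h₃
      have h₄ := (L n).pos_lt b h₃
      refine ⟨(L n).vert ((L n).pos v + 1), ?_, (L n).pos_vert _ (by omega)⟩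
      have := hA n ((L n).adj ((L n).pos v) (by omega))
      rwa [(L n).vert_pos v h₂] at this
    rw [Ultrafilter.eventually_exists_mem_iff (hnbr v)] at this
    obtain ⟨w, hw, h⟩ := this
    exact ⟨w, hcov h, hw⟩
  · intro v hv
    have : ∀ᶠ n in 𝒰, ∃ w ∈ G.neighborSet v, (L n).pos v = (L n).pos w + 1 := by
      filter_upwards [hin v] with n h₂
      have h₄ := (L n).pos_lt v h₂
      have h0 : (L n).pos v ≠ 0 := fun h =>
        hv ((L n).pos_inj h₂ (ho _) (h.trans (L n).pos_start.symm))
      obtain ⟨i, hi⟩ := Nat.exists_eq_succ_of_ne_zero h0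
      refine ⟨(L n).vert i, ?_, by rw [(L n).pos_vert i (by omega), hi]⟩
      have := hA n ((L n).adj i (by omega))
      rw [← Nat.succ_eq_add_one, ← hi, (L n).vert_pos v h₂] at this
      exact this.symm
    rw [Ultrafilter.eventually_exists_mem_iff (hnbr v)] at this
    obtain ⟨w, hw, h⟩ := this
    exact ⟨w, hcov h⟩
  · intro S
    obtain ⟨n, hn⟩ : ∃ n, S.sup (G.dist o) ≤ r n :=
      (hr.tendsto_atTop.eventually (eventually_ge_atTop _)).exists
    have hXn := hG.finite_hull (o := o) (r n)
    refine ⟨hXn.toFinset, fun x hx => ?_, fun K => ?_⟩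
    · simpa using mem_hull_of_dist_le ((Finset.le_sup (f := G.dist o) hx).trans hn)
    obtain ⟨v, hv⟩ := K.nonempty
    have hK := mem_componentCompl_hull_iff (o := o) (r := r n) (by simp) K hv
    have hvX : v ∉ G.hull o (r n) := by simpa using ComponentCompl.notMem_of_mem hv
    have hvo : v ∈ G.outer o (r n) v := (hK v).1 hv
    simp only [hK]
    have hoK : o ∉ G.outer o (r n) v := fun h => notMem_hull_of_mem_outer hvX h (ho _)
    -- The boundary vertices of the component are neighbours of the finite hull, so there are
    -- finitely many.
    let F : Set V := {z | z ∈ G.outer o (r n) v ∧ ∃ y ∉ G.outer o (r n) v, G.Adj z y}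
    have hF : F.Finite := by
      refine (hXn.biUnion fun y _ => hnbr y).subset ?_
      rintro z ⟨hz, y, hy, hzy⟩
      exact Set.mem_biUnion (mem_hull_of_adj_outer hz hy hzy) hzy.symm
    obtain ⟨c, hc, hc'⟩ : ∃ c ∈ F, ∀ᶠ m in 𝒰, ∀ y ∈ G.hull o (r m),
        y ∈ G.outer o (r n) v → (L m).pos y ≤ (L m).pos c := by
      rw [← Ultrafilter.eventually_exists_mem_iff hF]
      filter_upwards [hin v] with m hm
      obtain ⟨z, -, hzK, hmax, y, hy, hzy⟩ := (L m).exists_max hoK hm hvo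
      exact ⟨z, ⟨hzK, y, hy, hA m hzy⟩, hmax⟩
    obtain ⟨a, ha, ha'⟩ : ∃ a ∈ F, ∀ᶠ m in 𝒰, ∀ y ∈ G.hull o (r m),
        y ∈ G.outer o (r n) v → (L m).pos a ≤ (L m).pos y := by
      rw [← Ultrafilter.eventually_exists_mem_iff hF]
      filter_upwards [hin v] with m hm
      obtain ⟨z, -, hzK, hmin, y, hy, hzy⟩ := (L m).exists_min hoK hm hvo
      exact ⟨z, ⟨hzK, y, hy, hA m hzy⟩, hmin⟩
    refine ⟨a, c, fun x => ⟨fun hx => ⟨hle.2 ?_, hle.2 ?_⟩, fun ⟨hax, hxc⟩ => ?_⟩⟩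
    · filter_upwards [ha', hin x] with m hm hxm
      exact hm x hxm hx
    · filter_upwards [hc', hin x] with m hm hxm
      exact hm x hxm hx
    · rcases eq_or_lt_of_le hax with rfl | hax
      · exact ha.1
      rcases eq_or_lt_of_le hxc with rfl | hxc
      · exact hc.1
      obtain ⟨m, h₁, h₂, h₃, h₄, h₅, h₆⟩ := ((hlt.1 hax).and ((hlt.1 hxc).and ((hin a).and
        ((hin x).and ((hin c).and (hgt n)))))).exists
      exact (L m).mem_of_pos_lt (hfew n m h₆ v hvX) hoK h₃ h₄ h₅ ha.1 hc.1 h₁ h₂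

end SimpleGraph

noncomputable section

/-! ### Separating points of the compactification and constructing ends -/

namespace SimpleGraph

open Filter

variable {V : Type*} {G : SimpleGraph V}

/-! ### The Hausdorff property of the Freudenthal compactification -/

namespace Freudenthal

theorem continuous_arc (d : G.Dart) : Continuous (arc d) :=
  continuous_def.2 fun _ hU => hU.1 d

theorem arc_zero (d : G.Dart) : arc d 0 = vertex G d.fst := by
  simp [arc, vertex, edgePoint]

theorem arc_one (d : G.Dart) : arc d 1 = vertex G d.snd := by
  simp [arc, vertex, edgePoint]

/-- The total weight of the barycentric coordinates in `s`, with prescribed values at the ends. -/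
def weight (s : Set V) (e : G.RayEnd → ℝ) : G.Freudenthal → ℝ
  | .pt x => Finsupp.linearCombination ℝ (s.indicator (1 : V → ℝ)) x.1
  | .ofEnd ω => e ω

theorem weight_arc (s : Set V) (e : G.RayEnd → ℝ) (d : G.Dart) (t : unitInterval) :
    weight s e (arc d t) = (1 - t) * s.indicator 1 d.fst + t * s.indicator 1 d.snd := by
  simp [weight, arc, edgePoint, map_add, Finsupp.linearCombination_single, sub_mul]

theorem weight_vertex (s : Set V) (e : G.RayEnd → ℝ) (v : V) :
    weight s e (vertex G v) = s.indicator 1 v := by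
  simp [weight, vertex, Finsupp.linearCombination_single]

/-- Near an end `ω` the indicator is constant on `C(S, ω)`, and on an edge to `S` the weight changes
by at most the distance from the component. -/
theorem continuous_weight {s : Set V} {e : G.RayEnd → ℝ} (S : Finset V)
    (he : ∀ ω : G.RayEnd, ∀ v ∈ ω.comp S, s.indicator (1 : V → ℝ) v = e ω) :
    Continuous (weight s e) := by
  have h01 : ∀ v : V, s.indicator (1 : V → ℝ) v = 0 ∨ s.indicator (1 : V → ℝ) v = 1 := by
    intro v
    by_cases hv : v ∈ s <;> simp [hv]
  refine continuous_def.2 fun O hO => ⟨fun d => ?_, fun ω hω => ?_⟩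
  · refine hO.preimage (f := fun t => weight s e (arc d t)) ?_
    simp only [weight_arc]
    fun_prop
  · obtain ⟨ε, hε, hball⟩ := Metric.isOpen_iff.1 hO _ hω
    refine ⟨S, min ε 1, ⟨lt_min hε one_pos, min_le_right _ _⟩, ?_⟩
    rintro x (⟨v, hv, rfl⟩ | ⟨d, h₁, h₂, t, rfl⟩ | ⟨d, h₁, h₂, t, ht, rfl⟩ | ⟨ω', hω', rfl⟩)
    · change weight s e (vertex G v) ∈ O
      rw [weight_vertex, he ω v hv]
      exact hω
    · change weight s e (arc d t) ∈ O
      rw [weight_arc, he ω _ h₁, he ω _ h₂, ← add_mul, sub_add_cancel, one_mul]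
      exact hω
    · refine hball ?_
      have ht' : (t : ℝ) < ε := ht.trans_le (min_le_left _ _)
      have ht0 := t.2.1
      rw [Metric.mem_ball, weight_arc, Real.dist_eq]
      change |(1 - (t : ℝ)) * _ + t * _ - e ω| < ε
      rw [← he ω _ h₁]
      rcases h01 d.fst with h | h <;> rcases h01 d.snd with h' | h' <;> rw [h, h', abs_lt] <;>
        constructor <;> linarith
    · obtain ⟨v, hv⟩ := (ω'.comp S).nonempty
      change e ω' ∈ O
      rw [← he ω' v hv, he ω v (hω' ▸ hv)]
      exact hω

theorem indicator_comp {S : Finset V} [DecidableEq (G.ComponentCompl (S : Set V))]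
    (C : G.ComponentCompl (S : Set V)) (ω : G.RayEnd) (v : V) (hv : v ∈ ω.comp S) :
    (C : Set V).indicator (1 : V → ℝ) v = if ω.comp S = C then 1 else 0 := by
  by_cases h : ω.comp S = C
  · subst h
    rw [if_pos rfl, Set.indicator_of_mem hv, Pi.one_apply]
  · rw [if_neg h, Set.indicator_of_notMem]
    exact fun hv' => Set.disjoint_left.1 (ComponentCompl.pairwise_disjoint h) hv hv'

theorem rayEnd_ext {ω ω' : G.RayEnd} (h : ∀ S, ω.comp S = ω'.comp S) : ω = ω' := by
  induction ω using Quotient.inductionOn with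
  | _ r =>
    induction ω' using Quotient.inductionOn with
    | _ r' => exact Quotient.sound h

/-- Continuous weights separate points: a single coordinate for two points of the complex, a
component of the complement of the support for a point and an end, a component separating them for
two ends. -/
instance : T2Space G.Freudenthal := by
  classical
  refine ⟨fun x y hxy => ?_⟩
  have sep : ∀ {s : Set V} {e : G.RayEnd → ℝ}, Continuous (weight s e) →
      weight s e x ≠ weight s e y → ∃ u v, IsOpen u ∧ IsOpen v ∧ x ∈ u ∧ y ∈ v ∧ Disjoint u v :=
    fun hc hne => separated_by_continuous hc hne
  have key : ∀ (x : G.Realization) (ω : G.RayEnd), ∃ (s : Set V) (e : G.RayEnd → ℝ),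
      Continuous (weight s e) ∧ weight s e (.pt x) ≠ weight s e (.ofEnd ω) := by
    intro x ω
    refine ⟨(ω.comp x.1.support : Set V), _,
      continuous_weight x.1.support (indicator_comp (ω.comp x.1.support)), ?_⟩
    change Finsupp.linearCombination ℝ _ x.1 ≠ if _ then _ else _
    rw [if_pos rfl, Finsupp.linearCombination_apply, Finsupp.sum, Finset.sum_eq_zero]
    · exact zero_ne_one
    · intro v hv
      rw [Set.indicator_of_notMem, smul_zero]
      exact fun h => ComponentCompl.notMem_of_mem h hv
  rcases x with x | ω <;> rcases y with y | ω'
  · have hne : x.1 ≠ y.1 := fun h => hxy (congrArg _ (Subtype.ext h))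
    obtain ⟨v, hv⟩ := Finsupp.ne_iff.1 hne
    refine sep (s := {v}) (e := fun _ => 0) (continuous_weight {v} fun ω u hu => ?_) ?_
    · rw [Set.indicator_of_notMem]
      rintro rfl
      exact ComponentCompl.notMem_of_mem hu (by simp)
    · have : ∀ z : G.Realization, weight {v} (fun _ => 0) (.pt z) = z.1 v := fun z => by
        change Finsupp.linearCombination ℝ _ z.1 = _
        rw [Finsupp.linearCombination_apply, Finsupp.sum_eq_single v] <;>
          simp +contextual [Set.indicator]
      rwa [this, this]
  · obtain ⟨s, e, hc, hne⟩ := key x ω'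
    exact sep hc hne
  · obtain ⟨s, e, hc, hne⟩ := key y ω
    exact sep hc hne.symm
  · obtain ⟨S, hS⟩ : ∃ S, ω.comp S ≠ ω'.comp S := by
      by_contra! h
      exact hxy (congrArg _ (rayEnd_ext h))
    refine sep (continuous_weight S (indicator_comp (ω.comp S))) ?_
    change (if _ then _ else _) ≠ if _ then _ else _
    rw [if_pos rfl, if_neg hS.symm]
    exact one_ne_zero

end Freudenthal

/-! ### Ends from compatible components -/

/-- A form of König's lemma. Each vertex other than `o` has a parent one level lower; from a far
vertex of `K (B m)` the ancestors stay in the smaller components `K (B n)`. For fixed `n` they range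
over a finite ball, so an ultrafilter limit picks one ancestor per level, and these form a ray. -/
theorem exists_rayEnd [G.LocallyFinite] (hG : G.Connected)
    (K : ∀ S : Finset V, G.ComponentCompl (S : Set V))
    (hK : ∀ S T, S ⊆ T → ∀ v ∈ K T, v ∈ K S) : ∃ ω : G.RayEnd, ∀ S, ω.comp S = K S := by
  classical
  obtain ⟨o⟩ := hG.nonempty
  let B : ℕ → Finset V := fun n => (hG.finite_ball o n).toFinset
  have hB : ∀ n v, v ∈ B n ↔ G.dist o v ≤ n := fun n v => by simp [B]
  have hBmono : ∀ {m n}, m ≤ n → B m ⊆ B n := fun h v hv =>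
    (hB _ _).2 (((hB _ _).1 hv).trans h)
  have hlow : ∀ v, ∃ u, 0 < G.dist o v → G.Adj u v ∧ G.dist o u + 1 = G.dist o v := by
    intro v
    by_cases h : 0 < G.dist o v
    · obtain ⟨u, hu⟩ := hG.exists_lower h
      exact ⟨u, fun _ => hu⟩
    · exact ⟨v, fun h' => absurd h' h⟩
  choose par hpar using hlow
  have hdesc : ∀ n k v, v ∈ K (B n) → G.dist o v = n + 1 + k → par^[k] v ∈ K (B n) ∧
      G.dist o (par^[k] v) = n + 1 := by
    intro n k
    induction k with
    | zero => exact fun v hv hd => ⟨hv, hd⟩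
    | succ k ih =>
      intro v hv hd
      obtain ⟨hadj, hd'⟩ := hpar v (by omega)
      refine ih (par v) (ComponentCompl.mem_of_adj v _ hv ?_ hadj.symm) (by omega)
      rw [Finset.mem_coe, hB]
      omega
  have hz : ∀ m, ∃ z ∈ K (B m), G.dist o z = m + 1 := by
    intro m
    obtain ⟨v, hv⟩ := (K (B m)).nonempty
    have hv' : ¬ G.dist o v ≤ m := fun h => ComponentCompl.notMem_of_mem hv ((hB _ _).2 h)
    obtain ⟨k, hk⟩ : ∃ k, G.dist o v = m + 1 + k := ⟨G.dist o v - (m + 1), by omega⟩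
    exact ⟨_, hdesc m k v hv hk⟩
  choose z hzK hzd using hz
  have hanc : ∀ n m, n ≤ m → par^[m - n] (z m) ∈ K (B n) ∧ G.dist o (par^[m - n] (z m)) = n + 1 :=
    fun n m h => hdesc n (m - n) (z m) (hK _ _ (hBmono h) _ (hzK m)) (by rw [hzd]; omega)
  have hlim : ∀ n, ∃ y, ∀ᶠ m in hyperfilter ℕ, n ≤ m ∧ par^[m - n] (z m) = y := by
    intro n
    have : ∀ᶠ m in hyperfilter ℕ, ∃ y ∈ {v | G.dist o v ≤ n + 1},
        n ≤ m ∧ par^[m - n] (z m) = y := by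
      filter_upwards [(eventually_ge_atTop n).filter_mono Nat.hyperfilter_le_atTop] with m hm
      exact ⟨_, (hanc n m hm).2.le, hm, rfl⟩
    rw [Ultrafilter.eventually_exists_mem_iff (hG.finite_ball o (n + 1))] at this
    obtain ⟨y, -, hy⟩ := this
    exact ⟨y, hy⟩
  choose y hy using hlim
  have hyK : ∀ n, y n ∈ K (B n) ∧ G.dist o (y n) = n + 1 := by
    intro n
    obtain ⟨m, hm, h⟩ := (hy n).exists
    exact h ▸ hanc n m hm
  have hpy : ∀ n, par (y (n + 1)) = y n := by
    intro n
    obtain ⟨m, ⟨hm, h⟩, hm', h'⟩ := ((hy n).and (hy (n + 1))).exists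
    rw [← h, ← h', ← Function.iterate_succ_apply' par]
    congr 1
    omega
  let ρ : G.Ray :=
    { vert := y
      injective := fun m n h => by
        have h₁ := (hyK m).2
        rw [h, (hyK n).2] at h₁
        omega
      adj := fun n => by
        have := (hpar (y (n + 1)) (by rw [(hyK _).2]; omega)).1
        rwa [hpy] at this }
  refine ⟨Quotient.mk _ ρ, fun S => (ρ.comp_eq_iff S _).2 ?_⟩
  filter_upwards [eventually_ge_atTop (S.sup (G.dist o))] with n hn
  refine hK S (B n) (fun v hv => (hB _ _).2 ?_) _ (hyK n).1
  exact (Finset.le_sup (f := G.dist o) hv).trans hn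

end SimpleGraph

end

noncomputable section

/-! ### Placing the vertices on the line: weights, gaps and the ends at gaps -/

namespace SimpleGraph

open Filter Set

variable {V : Type*}

/-! ### Total weights of sets of vertices -/

/-- The sum of the weights of the elements of `s`. -/
def mass (wt : V → ℝ) (s : Set V) : ℝ := ∑' u, s.indicator wt u

section Mass

variable {wt : V → ℝ}

theorem mass_union (hsum : Summable wt) {s t : Set V} (h : Disjoint s t) :
    mass wt (s ∪ t) = mass wt s + mass wt t := by
  rw [mass, Set.indicator_union_of_disjoint h]
  exact (hsum.indicator s).tsum_add (hsum.indicator t)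

theorem mass_singleton (v : V) : mass wt {v} = wt v := by
  rw [mass, tsum_eq_single v]
  · simp
  · intro u hu
    simp [hu]

theorem mass_mono (hpos : ∀ v, 0 < wt v) (hsum : Summable wt) {s t : Set V} (h : s ⊆ t) :
    mass wt s ≤ mass wt t :=
  (hsum.indicator s).tsum_le_tsum
    (fun _ => Set.indicator_le_indicator_of_subset h (fun v => (hpos v).le) _) (hsum.indicator t)

theorem exists_finset_mass_compl_lt (hsum : Summable wt) {ε : ℝ} (hε : 0 < ε) :
    ∃ F : Finset V, mass wt (F : Set V)ᶜ < ε := by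
  have h₁ : Tendsto (fun F : Finset V => ∑ u ∈ F, wt u) atTop (nhds (mass wt univ)) := by
    rw [mass, Set.indicator_univ]
    exact hsum.hasSum
  obtain ⟨F, hF⟩ := (h₁.eventually (lt_mem_nhds (sub_lt_self _ hε))).exists
  refine ⟨F, ?_⟩
  have h₂ : mass wt (F : Set V) = ∑ u ∈ F, wt u := by
    rw [mass, tsum_eq_sum (s := F)]
    · exact Finset.sum_congr rfl fun u hu => by simp [hu]
    · intro u hu
      simp [hu]
  have h₃ := mass_union hsum (disjoint_compl_right (a := (F : Set V)))
  rw [Set.union_compl_self] at h₃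
  linarith

end Mass

/-! ### Parametrizing a Hamilton circle -/

/-- A circle order together with its successor function and a positive summable weight. -/
structure CircleParam (G : SimpleGraph V) [LinearOrder V] (o b : V) (nxt : V → V) (wt : V → ℝ) :
    Prop where
  order : IsCircleOrder G o b
  adj : ∀ v, G.Adj v (nxt v)
  covBy : ∀ v, v ≠ b → v ⋖ nxt v
  nxt_top : nxt b = o
  pos : ∀ v, 0 < wt v
  summable : Summable wt

theorem IsCircleOrder.exists_circleParam {G : SimpleGraph V} [LinearOrder V] [Countable V]
    {o b : V} (h : IsCircleOrder G o b) : ∃ nxt wt, CircleParam G o b nxt wt := by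
  have : ∀ v, ∃ w, G.Adj v w ∧ (v ≠ b → v ⋖ w) ∧ (v = b → w = o) := by
    intro v
    by_cases hv : v = b
    · exact ⟨o, hv ▸ h.adj, fun h => absurd hv h, fun _ => rfl⟩
    · obtain ⟨w, hw, hvw⟩ := h.exists_succ v hv
      exact ⟨w, hvw, fun _ => hw, fun h => absurd h hv⟩
  choose nxt h₁ h₂ h₃ using this
  obtain ⟨wt, hpos, c, hc, -⟩ := NNReal.exists_pos_sum_of_countable one_ne_zero V
  exact ⟨nxt, fun v => wt v, h, h₁, h₂, h₃ b rfl, fun v => by exact_mod_cast hpos v,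
    by exact_mod_cast hc.summable⟩

/-- The point of the real line at which the vertex `v` is placed. -/
def place [Preorder V] (wt : V → ℝ) (v : V) : ℝ := mass wt (Iio v)

/-- `t` lies in no interval between a vertex and its successor. -/
def IsGap [Preorder V] (wt : V → ℝ) (t : ℝ) : Prop :=
  0 ≤ t ∧ t < mass wt univ ∧ ∀ v, place wt v ≤ t → place wt v + wt v ≤ t

/-- `C` contains an interval of vertices around the gap at `t`. -/
def Straddles [Preorder V] (wt : V → ℝ) (t : ℝ) (C : Set V) : Prop :=
  ∃ v w, place wt v ≤ t ∧ t < place wt w ∧ Icc v w ⊆ C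

namespace CircleParam

variable {G : SimpleGraph V} [LinearOrder V] {o b : V} {nxt : V → V} {wt : V → ℝ}

theorem place_add_le (h : CircleParam G o b nxt wt) {v w : V} (hvw : v < w) :
    place wt v + wt v ≤ place wt w := by
  rw [place, ← mass_singleton (wt := wt) v, ← mass_union h.summable (by simp)]
  refine mass_mono h.pos h.summable ?_
  rintro u (hu | rfl)
  · exact lt_trans hu hvw
  · exact hvw

theorem place_lt (h : CircleParam G o b nxt wt) {v w : V} (hvw : v < w) : place wt v < place wt w :=
  (lt_add_of_pos_right _ (h.pos v)).trans_le (h.place_add_le hvw)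

theorem place_covBy (h : CircleParam G o b nxt wt) {v w : V} (hvw : v ⋖ w) :
    place wt w = place wt v + wt v := by
  rw [place, place, ← mass_singleton (wt := wt) v, ← mass_union h.summable (by simp)]
  congr 1
  ext u
  simp only [mem_Iio, mem_union, mem_singleton_iff]
  exact ⟨fun hu => (hvw.le_of_lt hu).lt_or_eq, fun hu => hu.elim (fun h => h.trans hvw.1)
    fun h => h ▸ hvw.1⟩

theorem place_bot (h : CircleParam G o b nxt wt) : place wt o = 0 := by
  have : Iio o = (∅ : Set V) := by
    ext u
    simpa using h.order.bot_le u
  simp [place, this, mass]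

theorem place_top (h : CircleParam G o b nxt wt) : place wt b + wt b = mass wt univ := by
  rw [place, ← mass_singleton (wt := wt) b, ← mass_union h.summable (by simp)]
  congr 1
  ext u
  simpa using h.order.le_top u

theorem place_nonneg (h : CircleParam G o b nxt wt) (v : V) : 0 ≤ place wt v := by
  rcases (h.order.bot_le v).eq_or_lt with rfl | hv
  · exact h.place_bot.ge
  · rw [← h.place_bot]
    exact (h.place_lt hv).le

theorem place_add_le_total (h : CircleParam G o b nxt wt) (v : V) :
    place wt v + wt v ≤ mass wt univ := by
  rcases (h.order.le_top v).eq_or_lt with rfl | hv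
  · exact h.place_top.le
  · exact (h.place_add_le hv).trans (by linarith [h.place_top, h.pos b])

theorem place_lt_total (h : CircleParam G o b nxt wt) (v : V) : place wt v < mass wt univ :=
  (lt_add_of_pos_right _ (h.pos v)).trans_le (h.place_add_le_total v)

theorem place_le_iff (h : CircleParam G o b nxt wt) {v w : V} :
    place wt v ≤ place wt w ↔ v ≤ w := by
  constructor
  · intro hvw
    by_contra! hlt
    exact absurd (h.place_lt hlt) hvw.not_gt
  · intro hvw
    rcases hvw.eq_or_lt with rfl | hvw
    · exact le_rfl
    · exact (h.place_lt hvw).le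

theorem eq_of_mem_Ico (h : CircleParam G o b nxt wt) {v w : V} {t : ℝ} (hv : place wt v ≤ t)
    (hv' : t < place wt v + wt v)
    (hw : place wt w ≤ t) (hw' : t < place wt w + wt w) : v = w := by
  rcases lt_trichotomy v w with hvw | hvw | hvw
  · linarith [h.place_add_le hvw]
  · exact hvw
  · linarith [h.place_add_le hvw]

theorem gap_nxt (h : CircleParam G o b nxt wt) {t : ℝ} (ht : IsGap wt t) {v : V}
    (hv : place wt v ≤ t) :
    v ⋖ nxt v ∧ place wt (nxt v) ≤ t := by
  have hvb : v ≠ b := by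
    rintro rfl
    linarith [ht.2.2 v hv, ht.2.1, h.place_top]
  refine ⟨h.covBy v hvb, ?_⟩
  rw [h.place_covBy (h.covBy v hvb)]
  exact ht.2.2 v hv

theorem gap_pred (h : CircleParam G o b nxt wt) {t : ℝ} (ht : IsGap wt t) {w : V}
    (hw : t < place wt w) :
    ∃ u, u < w ∧ t < place wt u := by
  have hwo : w ≠ o := by
    rintro rfl
    linarith [ht.1, h.place_bot]
  obtain ⟨u, hu⟩ := h.order.exists_pred w hwo
  refine ⟨u, hu.1, ?_⟩
  by_contra! hut
  linarith [ht.2.2 u hut, h.place_covBy hu]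

/-- No vertex is last below a gap, since its successor is again placed below; so any finite set can
be passed. -/
theorem exists_lower_of_gap (h : CircleParam G o b nxt wt) {t : ℝ} (ht : IsGap wt t)
    (F : Finset V) :
    ∃ v, place wt v ≤ t ∧ ∀ u ∈ F, place wt u ≤ t → u < v := by
  induction F using Finset.induction_on with
  | empty => exact ⟨o, h.place_bot.trans_le ht.1, by simp⟩
  | insert a F _ ih =>
    obtain ⟨v, hv, hF⟩ := ih
    by_cases ha : place wt a ≤ t
    · refine ⟨nxt (max v a), (h.gap_nxt ht ?_).2, fun u hu hut => ?_⟩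
      · rcases max_choice v a with e | e <;> rw [e] <;> assumption
      · have hm := (h.gap_nxt ht (v := max v a) (by
          rcases max_choice v a with e | e <;> rw [e] <;> assumption)).1.1
        rcases Finset.mem_insert.1 hu with rfl | hu
        · exact (le_max_right _ _).trans_lt hm
        · exact (hF u hu hut).trans ((le_max_left _ _).trans_lt hm)
    · refine ⟨v, hv, fun u hu hut => ?_⟩
      rcases Finset.mem_insert.1 hu with rfl | hu
      · exact absurd hut ha
      · exact hF u hu hut

theorem exists_upper_of_gap (h : CircleParam G o b nxt wt) {t : ℝ} (ht : IsGap wt t)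
    (F : Finset V) :
    ∃ w, t < place wt w ∧ ∀ u ∈ F, t < place wt u → w < u := by
  induction F using Finset.induction_on with
  | empty =>
    refine ⟨b, ?_, by simp⟩
    by_contra! hb
    linarith [ht.2.2 b hb, ht.2.1, h.place_top]
  | insert a F _ ih =>
    obtain ⟨v, hv, hF⟩ := ih
    by_cases ha : t < place wt a
    · obtain ⟨w, hw, hwt⟩ := h.gap_pred ht (w := min v a) (by
        rcases min_choice v a with e | e <;> rw [e] <;> assumption)
      refine ⟨w, hwt, fun u hu hut => ?_⟩
      rcases Finset.mem_insert.1 hu with rfl | hu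
      · exact hw.trans_le (min_le_right _ _)
      · exact (hw.trans_le (min_le_left _ _)).trans (hF u hu hut)
    · refine ⟨v, hv, fun u hu hut => ?_⟩
      rcases Finset.mem_insert.1 hu with rfl | hu
      · exact absurd hut ha
      · exact hF u hu hut

/-- The vertices approach a gap from above. -/
theorem exists_place_lt (h : CircleParam G o b nxt wt) {t t' : ℝ} (ht : IsGap wt t)
    (htt' : t < t') :
    ∃ w, t < place wt w ∧ place wt w < t' := by
  -- All but less than `t' - t` of the total weight sits on `F`. Vertices `v`, `w` on the two sides
  -- of the gap that have passed `F` are thus less than `t' - t` apart.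
  obtain ⟨F, hF⟩ := exists_finset_mass_compl_lt h.summable (sub_pos.2 htt')
  obtain ⟨v, hv, hvF⟩ := h.exists_lower_of_gap ht F
  obtain ⟨w, hw, hwF⟩ := h.exists_upper_of_gap ht F
  refine ⟨w, hw, ?_⟩
  have hvw : v < w := by
    by_contra! hwv
    linarith [h.place_le_iff.2 hwv]
  have h₁ : place wt w = place wt v + mass wt (Ico v w) := by
    rw [place, place, ← mass_union h.summable]
    · rw [Iio_union_Ico_eq_Iio hvw.le]
    · exact Set.disjoint_left.2 fun u hu hu' => absurd hu (not_lt.2 hu'.1)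
  have h₂ : mass wt (Ico v w) ≤ mass wt (F : Set V)ᶜ := by
    refine mass_mono h.pos h.summable fun u hu huF => ?_
    rcases le_or_gt (place wt u) t with hut | hut
    · exact absurd (hvF u huF hut) (not_lt.2 hu.1)
    · exact absurd (hwF u huF hut) (not_lt.2 hu.2.le)
  linarith

/-- Take the component of a vertex `v` below the gap that has passed `X`. If its last vertex `c`
were below the gap too, the successor of `c` would lie in `X`, hence before `v`, although `v ≤ c`.
-/
theorem exists_straddles_interval (h : CircleParam G o b nxt wt) {t : ℝ} (ht : IsGap wt t)
    {X : Finset V}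
    (hX : ∀ K : G.ComponentCompl (X : Set V), ∃ a c, ∀ x, x ∈ K ↔ a ≤ x ∧ x ≤ c) :
    ∃ (K : G.ComponentCompl (X : Set V)) (a c : V), (∀ x, x ∈ K ↔ a ≤ x ∧ x ≤ c) ∧
      place wt a ≤ t ∧ t < place wt c := by
  obtain ⟨v, hv, hvX⟩ := h.exists_lower_of_gap ht X
  have hvX' : v ∉ (X : Set V) := fun hm => lt_irrefl v (hvX v hm hv)
  have hvK := G.componentComplMk_mem hvX'
  obtain ⟨a, c, hac⟩ := hX (G.componentComplMk hvX')
  obtain ⟨hav, hvc⟩ := (hac v).1 hvK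
  refine ⟨_, a, c, hac, (h.place_le_iff.2 hav).trans hv, ?_⟩
  by_contra! hc
  obtain ⟨h₁, h₂⟩ := h.gap_nxt ht hc
  have hcK := (hac c).2 ⟨hav.trans hvc, le_rfl⟩
  have h₃ : nxt c ∈ X := by
    by_contra hno
    have := (hac _).1 (ComponentCompl.mem_of_adj c (nxt c) hcK hno (h.adj c))
    exact absurd h₁.1 (not_lt.2 this.2)
  exact absurd ((hvX _ h₃ h₂).trans_le hvc) (not_lt.2 h₁.1.le)

theorem straddles_unique (h : CircleParam G o b nxt wt) {t : ℝ} {S : Finset V}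
    {C D : G.ComponentCompl (S : Set V)}
    (hC : Straddles wt t (C : Set V)) (hD : Straddles wt t (D : Set V)) : C = D := by
  obtain ⟨v, w, hv, hw, hC⟩ := hC
  obtain ⟨v', w', hv', hw', hD⟩ := hD
  have lt : ∀ {x y}, place wt x ≤ t → t < place wt y → x ≤ y := fun hx hy =>
    h.place_le_iff.1 (hx.trans hy.le)
  by_contra hne
  exact Set.disjoint_left.1 (ComponentCompl.pairwise_disjoint hne)
    (hC ⟨le_max_left v v', max_le (lt hv hw) (lt hv' hw)⟩)
    (hD ⟨le_max_right v v', max_le (lt hv hw') (lt hv' hw')⟩)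

theorem exists_straddles (h : CircleParam G o b nxt wt) {t : ℝ} (ht : IsGap wt t) (S : Finset V) :
    ∃ C : G.ComponentCompl (S : Set V), Straddles wt t (C : Set V) := by
  obtain ⟨X, hSX, hX⟩ := h.order.exists_interval S
  obtain ⟨K, a, c, hK, ha, hc⟩ := h.exists_straddles_interval ht hX
  exact ⟨K.hom (Finset.coe_subset.2 hSX), a, c, ha, hc, fun x hx =>
    ComponentCompl.subset_hom _ _ ((hK x).2 hx)⟩

theorem exists_rayEnd_of_isGap (h : CircleParam G o b nxt wt) [G.LocallyFinite] (hG : G.Connected)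
    {t : ℝ} (ht : IsGap wt t) :
    ∃ ω : G.RayEnd, ∀ S, Straddles wt t (ω.comp S : Set V) := by
  choose K hK using h.exists_straddles ht
  obtain ⟨ω, hω⟩ := exists_rayEnd hG K fun S T hST v hv => by
    have : (K T).hom (Finset.coe_subset.2 hST) = K S := by
      refine h.straddles_unique ?_ (hK S)
      obtain ⟨v, w, hv, hw, hs⟩ := hK T
      exact ⟨v, w, hv, hw, hs.trans (ComponentCompl.subset_hom _ _)⟩
    exact this ▸ ComponentCompl.subset_hom _ _ hv
  exact ⟨ω, fun S => hω S ▸ hK S⟩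

end CircleParam

end SimpleGraph

end

noncomputable section

/-! ### The circle in the compactification -/

namespace SimpleGraph

open Filter Set

variable {V : Type*}

namespace CircleParam

variable {G : SimpleGraph V} [LinearOrder V] {o b : V} {nxt : V → V} {wt : V → ℝ}
  (h : CircleParam G o b nxt wt)

/-- The edge from `v` to its successor. -/
def dart (v : V) : G.Dart := ⟨(v, nxt v), h.adj v⟩

/-- The edge from `v` to its successor, parametrized by the real line. -/
def edge (v : V) (s : ℝ) : G.Freudenthal :=
  Freudenthal.arc (h.dart v) (projIcc 0 1 zero_le_one ((s - place wt v) / wt v))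

theorem continuous_edge (v : V) : Continuous (h.edge v) := by
  refine (Freudenthal.continuous_arc _).comp (continuous_projIcc.comp ?_)
  fun_prop

theorem edge_left (v : V) : h.edge v (place wt v) = Freudenthal.vertex G v := by
  rw [edge, sub_self, zero_div, projIcc_left]
  exact Freudenthal.arc_zero _

theorem edge_right (v : V) : h.edge v (place wt v + wt v) = Freudenthal.vertex G (nxt v) := by
  rw [edge, add_sub_cancel_left, div_self (h.pos v).ne', projIcc_right]
  exact Freudenthal.arc_one _

/-- A map of the real line to `|G|` that follows the circle order on `[0, T]`. -/
structure Follows (f : ℝ → G.Freudenthal) : Prop where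
  edge : ∀ v s, place wt v ≤ s → s ≤ place wt v + wt v → f s = h.edge v s
  gap : ∀ t, IsGap wt t → ∃ ω : G.RayEnd, f t = .ofEnd ω ∧
    ∀ S, Straddles wt t (ω.comp S : Set V)

theorem exists_follows [G.LocallyFinite] (hG : G.Connected) : ∃ f, h.Follows f := by
  classical
  let E : ∀ t, IsGap wt t → G.RayEnd := fun t ht => (h.exists_rayEnd_of_isGap hG ht).choose
  -- The default value `o` is also the right one at the total weight, where the last edge returns
  -- from `b` to `o`.
  let f : ℝ → G.Freudenthal := fun s =>
    if hs : ∃ v, place wt v ≤ s ∧ s < place wt v + wt v then h.edge hs.choose s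
    else if ht : IsGap wt s then .ofEnd (E s ht) else Freudenthal.vertex G o
  have hf : ∀ v s, place wt v ≤ s → s < place wt v + wt v → f s = h.edge v s := by
    intro v s h₁ h₂
    have hs : ∃ v, place wt v ≤ s ∧ s < place wt v + wt v := ⟨v, h₁, h₂⟩
    have := h.eq_of_mem_Ico hs.choose_spec.1 hs.choose_spec.2 h₁ h₂
    simp only [f, dif_pos hs, this]
  refine ⟨f, fun v s h₁ h₂ => ?_, fun t ht => ?_⟩
  · rcases h₂.lt_or_eq with h₂ | rfl
    · exact hf v s h₁ h₂
    rw [h.edge_right]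
    by_cases hv : v = b
    · subst hv
      have hno : ¬ ∃ u, place wt u ≤ place wt v + wt v ∧
          place wt v + wt v < place wt u + wt u := by
        rintro ⟨u, -, hu⟩
        linarith [h.place_add_le_total u, h.place_top]
      have hno' : ¬ IsGap wt (place wt v + wt v) := fun hg => by
        linarith [hg.2.1, h.place_top]
      simp only [f, dif_neg hno, dif_neg hno', h.nxt_top]
    · have e := h.place_covBy (h.covBy v hv)
      rw [← e, hf (nxt v) _ le_rfl (lt_add_of_pos_right _ (h.pos _)), h.edge_left]
  · have hno : ¬ ∃ v, place wt v ≤ t ∧ t < place wt v + wt v := by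
      rintro ⟨v, h₁, h₂⟩
      linarith [ht.2.2 v h₁]
    exact ⟨E t ht, by simp only [f, dif_neg hno, dif_pos ht],
      (h.exists_rayEnd_of_isGap hG ht).choose_spec⟩

theorem isGap_or {t : ℝ} (ht : t ∈ Ico 0 (mass wt univ)) :
    IsGap wt t ∨ ∃ v, place wt v ≤ t ∧ t < place wt v + wt v := by
  by_cases hv : ∃ v, place wt v ≤ t ∧ t < place wt v + wt v
  · exact .inr hv
  · push Not at hv
    exact .inl ⟨ht.1, ht.2, hv⟩

namespace Follows

variable {h} {f : ℝ → G.Freudenthal}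

theorem apply_place (hf : h.Follows f) (v : V) : f (place wt v) = Freudenthal.vertex G v := by
  rw [hf.edge v _ le_rfl (by linarith [h.pos v]), h.edge_left]

theorem apply_zero (hf : h.Follows f) : f 0 = Freudenthal.vertex G o := by
  rw [← h.place_bot, hf.apply_place]

theorem apply_total (hf : h.Follows f) : f (mass wt univ) = Freudenthal.vertex G o := by
  rw [← h.place_top, hf.edge b _ (by linarith [h.pos b]) le_rfl, h.edge_right, h.nxt_top]

theorem continuousOn_edge (hf : h.Follows f) (v : V) : ContinuousOn f
    (Icc (place wt v) (place wt v + wt v)) :=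
  (h.continuous_edge v).continuousOn.congr fun s hs => hf.edge v s hs.1 hs.2

/-- Enlarge `S` to `X` so that the component of the end is an interval from `a` to `c`. Strictly
between the places of `a` and `c`, all edges have both ends in this component and all gaps have ends
in it, so `f` stays in the basic neighbourhood. -/
theorem continuousAt_gap (hf : h.Follows f) {t : ℝ} (ht : IsGap wt t) : ContinuousAt f t := by
  obtain ⟨ω, hω, hS⟩ := hf.gap t ht
  rw [ContinuousAt, hω]
  intro U hU
  obtain ⟨O, hOU, hO, hωO⟩ := mem_nhds_iff.1 hU
  obtain ⟨S, ε, hε, hSO⟩ := hO.2 ω hωO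
  obtain ⟨X, hSX, hX⟩ := h.order.exists_interval S
  obtain ⟨K, a, c, hK, ha, hc⟩ := h.exists_straddles_interval ht hX
  have hKω : ω.comp X = K :=
    h.straddles_unique (hS X) ⟨a, c, ha, hc, fun x hx => (hK x).2 hx⟩
  have ha' : place wt a < t := by
    have := h.gap_nxt ht ha
    exact (h.place_lt this.1.1).trans_le this.2
  refine mem_map.2 (mem_of_superset (Ioo_mem_nhds ha' hc) fun s hs => hOU (hSO ?_))
  refine Freudenthal.basicNhd_mono hSX ω le_rfl ?_
  have hs' : s ∈ Ico 0 (mass wt univ) :=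
    ⟨(h.place_nonneg a).trans hs.1.le, hs.2.trans (h.place_lt_total c)⟩
  rcases isGap_or hs' with hg | ⟨v, hv, hv'⟩
  · obtain ⟨ω', hω', hS'⟩ := hf.gap s hg
    refine .inr (.inr (.inr ⟨ω', ?_, hω'⟩))
    rw [hKω]
    exact h.straddles_unique (hS' X) ⟨a, c, hs.1.le, hs.2, fun x hx => (hK x).2 hx⟩
  · have hvc : v < c := by
      by_contra! hcv
      linarith [h.place_le_iff.2 hcv, hs.2]
    have hav : a ≤ v := by
      by_contra! hva
      linarith [h.place_add_le hva, hs.1]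
    have hvb : v ≠ b := fun e => absurd (h.order.le_top c) (not_le.2 (e ▸ hvc))
    have hcov := h.covBy v hvb
    refine .inr (.inl ⟨h.dart v, ?_, ?_, _, hf.edge v s hv hv'.le⟩)
    · rw [hKω]
      exact (hK v).2 ⟨hav, hvc.le⟩
    · rw [hKω]
      exact (hK (nxt v)).2 ⟨hav.trans hcov.1.le, hcov.ge_of_gt hvc⟩

theorem continuousOn (hf : h.Follows f) : ContinuousOn f (Icc 0 (mass wt univ)) := by
  intro t ht
  rcases ht.2.eq_or_lt with rfl | htT
  · have hmem := right_mem_Icc.2 (le_add_of_nonneg_right (a := place wt b) (h.pos b).le)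
    rw [h.place_top] at hmem
    have := hf.continuousOn_edge b
    rw [h.place_top] at this
    exact (this _ hmem).mono_of_mem_nhdsWithin (mem_of_superset
      (inter_mem_nhdsWithin _ (Ioi_mem_nhds (h.place_lt_total b))) fun s hs => ⟨hs.2.le, hs.1.2⟩)
  rcases isGap_or ⟨ht.1, htT⟩ with hg | ⟨v, hv, hv'⟩
  · exact (hf.continuousAt_gap hg).continuousWithinAt
  · by_cases hvo : v = o
    · have hc := hf.continuousOn_edge v t ⟨hv, hv'.le⟩
      refine hc.mono_of_mem_nhdsWithin (mem_of_superset
        (inter_mem_nhdsWithin _ (Iio_mem_nhds hv')) fun s hs => ⟨?_, hs.2.le⟩)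
      rw [hvo, h.place_bot]
      exact hs.1.1
    · obtain ⟨u, hu⟩ := h.order.exists_pred v hvo
      have e := h.place_covBy hu
      have hc := (hf.continuousOn_edge u).union_of_isClosed (hf.continuousOn_edge v)
        isClosed_Icc isClosed_Icc
      rw [← e, Icc_union_Icc_eq_Icc (h.place_lt hu.1).le (by linarith [h.pos v])] at hc
      exact (hc.continuousAt (Icc_mem_nhds ((h.place_lt hu.1).trans_le hv) hv')).continuousWithinAt

theorem injOn (hf : h.Follows f) (h3 : ∃ x, x ≠ o ∧ x ≠ b) : InjOn f (Ico 0 (mass wt univ)) := by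
  have gaps : ∀ {s t}, IsGap wt s → IsGap wt t → s < t → f s ≠ f t := by
    intro s t hs ht hst heq
    -- A vertex `w` is placed between the two gaps. Once `w` is in `X`, one interval component
    -- straddling both gaps would have to contain `w`.
    obtain ⟨w, hw, hw'⟩ := h.exists_place_lt hs hst
    obtain ⟨X, hwX, hX⟩ := h.order.exists_interval {w}
    obtain ⟨K, a, c, hK, ha, hc⟩ := h.exists_straddles_interval hs hX
    obtain ⟨K', a', c', hK', ha', hc'⟩ := h.exists_straddles_interval ht hX
    obtain ⟨ω, hω, hS⟩ := hf.gap s hs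
    obtain ⟨ω', hω', hS'⟩ := hf.gap t ht
    rw [hω, hω'] at heq
    cases heq
    have e : K = K' := (h.straddles_unique ⟨a, c, ha, hc, fun x hx => (hK x).2 hx⟩ (hS X)).trans
      (h.straddles_unique (hS' X) ⟨a', c', ha', hc', fun x hx => (hK' x).2 hx⟩)
    subst e
    have h₁ : a' ≤ c' := h.place_le_iff.1 (ha'.trans hc'.le)
    have hwc : w ≤ c := (h.place_le_iff.1 (hw'.le.trans hc'.le)).trans
      ((hK c').1 ((hK' c').2 ⟨h₁, le_rfl⟩)).2
    have haw : a ≤ w := h.place_le_iff.1 (ha.trans hw.le)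
    exact ComponentCompl.notMem_of_mem ((hK w).2 ⟨haw, hwc⟩) (hwX (by simp))
  have hpt : ∀ v s, h.edge v s = .pt ⟨edgePoint v (nxt v)
      (projIcc (0 : ℝ) 1 zero_le_one ((s - place wt v) / wt v)), .inr ⟨h.dart v, _, rfl⟩⟩ :=
    fun _ _ => rfl
  intro s hs t ht heq
  rcases isGap_or hs with hgs | ⟨v, hv, hv'⟩ <;> rcases isGap_or ht with hgt | ⟨w, hw, hw'⟩
  · rcases lt_trichotomy s t with hst | hst | hst
    · exact absurd heq (gaps hgs hgt hst)
    · exact hst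
    · exact absurd heq.symm (gaps hgt hgs hst)
  · obtain ⟨ω, hω, -⟩ := hf.gap s hgs
    rw [hω, hf.edge w t hw hw'.le, hpt] at heq
    cases heq
  · obtain ⟨ω, hω, -⟩ := hf.gap t hgt
    rw [hω, hf.edge v s hv hv'.le, hpt] at heq
    cases heq
  · rw [hf.edge v s hv hv'.le, hf.edge w t hw hw'.le, hpt, hpt] at heq
    have coe : ∀ {v s}, place wt v ≤ s → s < place wt v + wt v →
        ((projIcc (0 : ℝ) 1 zero_le_one ((s - place wt v) / wt v) : Icc (0 : ℝ) 1) : ℝ) =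
          (s - place wt v) / wt v ∧ (s - place wt v) / wt v < 1 := by
      intro v s h₁ h₂
      have h₃ : (s - place wt v) / wt v < 1 := by rw [div_lt_one (h.pos v)]; linarith
      rw [projIcc_of_mem zero_le_one ⟨div_nonneg (by linarith) (h.pos v).le, h₃.le⟩]
      exact ⟨rfl, h₃⟩
    have heq' := congrArg Subtype.val (Freudenthal.pt.inj heq)
    simp only at heq'
    obtain ⟨e₁, l₁⟩ := coe hv hv'
    obtain ⟨e₂, l₂⟩ := coe hw hw'
    rw [e₁, e₂] at heq'
    have hvw : v = w := by
      -- A point other than the far end of the edge at `v` has positive coordinate at `v`, so it can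
      -- lie on the edge at `w` only if `w` is followed by `v`.
      have step : ∀ {v w : V} {x y : ℝ}, x < 1 → v ≠ w →
          edgePoint v (nxt v) x = edgePoint w (nxt w) y → nxt w = v := by
        intro v w x y hx hne he
        by_contra hn
        have := DFunLike.congr_fun he v
        simp [edgePoint, (h.adj v).ne', hne.symm, hn] at this
        linarith
      by_contra hne
      have h₁ := step l₁ hne heq'
      have h₂ := step l₂ (Ne.symm hne) heq'.symm
      obtain ⟨x, hxo, hxb⟩ := h3
      -- Two vertices can follow each other only if one of them is `b` and the other `o`, with
      -- nothing in between; a third vertex excludes this.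
      have two : ∀ {v w : V}, nxt w = v → nxt v = w → v ≠ b := by
        rintro v w h₁ h₂ rfl
        rw [h.nxt_top] at h₂
        subst h₂
        have hob : o ≠ v := by
          rintro rfl
          exact (h.order.adj).ne rfl
        have hcov := h.covBy o hob
        rw [h₁] at hcov
        exact hcov.2 (lt_of_le_of_ne (h.order.bot_le x) hxo.symm)
          (lt_of_le_of_ne (h.order.le_top x) hxb)
      have c₁ := (h.covBy v (two h₁ h₂)).1
      have c₂ := (h.covBy w (two h₂ h₁)).1
      rw [h₁] at c₂
      rw [h₂] at c₁
      exact lt_asymm c₁ c₂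
    subst hvw
    have := DFunLike.congr_fun heq' (nxt v)
    simp [edgePoint, (h.adj v).ne] at this
    have hp := h.pos v
    field_simp at this
    linarith

end Follows

/-- The two ends of the parameter interval both map to `o`, so `f` descends to a circle; a
continuous injection from a compact space to a Hausdorff space is an embedding. -/
theorem hasHamiltonCircle [G.LocallyFinite] (hG : G.Connected) (h3 : ∃ x, x ≠ o ∧ x ≠ b)
    (h : CircleParam G o b nxt wt) : G.HasHamiltonCircle := by
  obtain ⟨f, hf⟩ := h.exists_follows hG
  have hT : 0 < mass wt univ := (h.place_nonneg o).trans_lt (h.place_lt_total o)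
  have : Fact (0 < mass wt univ) := ⟨hT⟩
  let F : AddCircle (mass wt univ) → G.Freudenthal := AddCircle.liftIco (mass wt univ) 0 f
  have hF : Continuous F := AddCircle.liftIco_continuous
    (by rw [zero_add, hf.apply_zero, hf.apply_total]) (by rw [zero_add]; exact hf.continuousOn)
  have hFa : ∀ x ∈ Ico 0 (mass wt univ), F x = f x := fun x hx =>
    AddCircle.liftIco_coe_apply (by rwa [zero_add])
  have hinj : Function.Injective F := by
    have rep : ∀ x : AddCircle (mass wt univ),
        ∃ y ∈ Ico 0 (mass wt univ), (y : AddCircle _) = x := by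
      intro x
      have := (AddCircle.coe_image_Ico_eq (mass wt univ) 0).symm ▸ mem_univ x
      rwa [zero_add] at this
    intro x y hxy
    obtain ⟨s, hs, rfl⟩ := rep x
    obtain ⟨t, ht, rfl⟩ := rep y
    rw [hFa s hs, hFa t ht] at hxy
    rw [hf.injOn h3 hs ht hxy]
  let e := AddCircle.homeomorphCircle hT.ne'
  have hφ : Topology.IsClosedEmbedding (F ∘ e.symm) :=
    (hF.comp e.symm.continuous).isClosedEmbedding (hinj.comp e.symm.injective)
  refine ⟨range (F ∘ e.symm), ⟨hφ.isEmbedding.toHomeomorph⟩, fun v => ?_⟩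
  refine ⟨e (place wt v : ℝ), ?_⟩
  rw [Function.comp_apply, e.symm_apply_apply, hFa _ ⟨h.place_nonneg v, h.place_lt_total v⟩,
    hf.apply_place]

end CircleParam

end SimpleGraph

end

theorem theorem1p3 {V : Type*} (G : SimpleGraph V) [G.LocallyFinite]
    (hconn : G.IsKConnected 2) (hclaw : G.IsClawFree) (hpaw : G.PawCondition) :
    G.HasHamiltonCircle := by
  have hG := hconn.connected
  obtain ⟨_, o, b, h⟩ :=
    SimpleGraph.exists_isCircleOrder hconn hclaw.clawProp hpaw.pawPropOn
  have := hG.countable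
  obtain ⟨nxt, wt, hp⟩ := h.exists_circleParam
  exact hp.hasHamiltonCircle hG (hconn.exists_ne o b)
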